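/- **Setting.** For every integer $N\ge 0$ let $s=s(N)\in(N,\infty]$, and assume that $\lambda:=\lim_{N\to\infty}N/s(N)$ exists (so $\lambda\in[0,1]$, and $N/\infty=0$). The symbol $\max\{1,|z|\}^{-\infty}$ denotes the characteristic function of the closed unit disk. Let $p_0,p_1,\dots$ be any monic polynomials with real coefficients, $\deg p_n=n$, and put $$\langle f|g\rangle=\int_{\mathbb R}\int_{\mathbb R}\max\{1,|x|\}^{-s}\max\{1,|y|\}^{-s}f(x)g(y)\,\mathrm{sgn}(y-x)\,dx\,dy-2\mathrm i\int_{\mathbb C}\max\{1,|z|\}^{-2s}\,\overline{f(z)}\,g(z)\,\mathrm{sgn}(\operatorname{Im}z)\,dA(z),$$ $$\mathbf U=\big[\langle p_{m-1}|p_{n-1}\rangle\big]_{m,n=1}^N,\qquad \mathbf b=\Big[\int_{\mathbb R}p_{m-1}(x)\max\{1,|x|\}^{-s}dx\Big]_{m=1}^N .$$ Here $dA$ is area measure. Let $[\mu_{m,n}]_{m,n=1}^N$ be $\mathbf U^{-1}$ if $N$ is even, and the upper left $N\times N$ block of $\begin{bmatrix}\mathbf U&\mathbf b\\-\mathbf b^{\mathsf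 T}&0\end{bmatrix}^{-1}$ if $N$ is odd. The $(1,1)$-entry of the matrix kernel of the roots of random polynomials in the real Mahler ensemble is $$\varkappa_N(u,v)=\max\{1,|u|\}^{-s}\max\{1,|v|\}^{-s}\,\varkappa_N^{\circ}(u,v),\qquad \varkappa_N^{\circ}(u,v)=-2\sum_{m,n=1}^N\mu_{m,n}\,p_{m-1}(u)\,p_{n-1}(v).$$ Let $$M(z)=\frac1{\Gamma(3/2)}\sum_{n=0}^\infty\frac{\Gamma(n+3/2)}{\Gamma(n+1)}\frac{z^n}{n!}={}_1F_1(3/2;1;z),$$ and let $\omega(\tau)=\min\{1,e^{-\operatorname{Re}\tau/\lambda}\}$ if $\lambda>0$, while for $\lambda=0$ let $\omega$ be the characteristic function of the closed left half-plane $\{\operatorname{Re}\tau\le 0\}$. **Theorem.** Let $\xi=1$ or $\xi=-1$, and for $u,v\in\mathbb C$ put $$L_\xi(u,v)=\frac\xi4\int_0^1\tau(1-\lambda\tau)\big[M'(u\xi\tau)M(v\xi\tau)-M(u\xi\tau)M'(v\xi\tau)\big]d\tau,\qquad \varkappa_\xi(u,v)=\omega(u\xi)\,\omega(v\xi)\,L_\xi(u,v).$$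 1. If $\lambda>0$, then $\displaystyle\lim_{N\to\infty}\frac1{N^2}\varkappa_N\Big(\xi+\frac uN,\xi+\frac vN\Big)=\varkappa_\xi(u,v)$ uniformly on compact subsets of $\mathbb C\times\mathbb C$. 2. If $\lambda=0$, the same limit holds uniformly on compact subsets of $\{(u,v)\in\mathbb C\times\mathbb C:\max\{\operatorname{Re}(u\xi),\operatorname{Re}(v\xi)\}\ne0\}$. 3. For every $\lambda\in[0,1]$, without the weights, $\displaystyle\lim_{N\to\infty}\frac1{N^2}\varkappa_N^{\circ}\Big(\xi+\frac uN,\xi+\frac vN\Big)=L_\xi(u,v)$ uniformly on compact subsets of $\mathbb C\times\mathbb C$. -/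

import Mathlib

open scoped ENNReal Topology

noncomputable section

namespace RealMahler

/-- The weight `max {1, |z|} ^ (-s)` for `s ∈ [0, ∞]`; for `s = ∞` it is the characteristic
function of the closed unit disk. -/
def weight (s : ℝ≥0∞) (z : ℂ) : ℝ :=
  if s = ⊤ then (if ‖z‖ ≤ 1 then 1 else 0) else (max 1 ‖z‖) ^ (-s.toReal)

/-- The value at a complex number of a polynomial with real coefficients. -/
def val (p : Polynomial ℝ) (z : ℂ) : ℂ := Polynomial.aeval z p

/-- The skew-symmetric form `⟨f|g⟩_ℝ`. -/
def realForm (s : ℝ≥0∞) (f g : Polynomial ℝ) : ℂ :=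
  ∫ y : ℝ, ∫ x : ℝ,
    (weight s (x : ℂ) : ℂ) * (weight s (y : ℂ) : ℂ) * val f (x : ℂ) * val g (y : ℂ) *
      (Real.sign (y - x) : ℂ)

/-- The skew-symmetric form `⟨f|g⟩_ℂ`; the integral is with respect to area measure on `ℂ`. -/
def complexForm (s : ℝ≥0∞) (f g : Polynomial ℝ) : ℂ :=
  -2 * Complex.I *
    ∫ z : ℂ, (weight (2 * s) z : ℂ) * starRingEnd ℂ (val f z) * val g z * (Real.sign z.im : ℂ)

/-- The matrix `U` with entries `⟨p_m|p_n⟩_ℝ + ⟨p_m|p_n⟩_ℂ`, `0 ≤ m, n < N`. -/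
def skewGram (s : ℝ≥0∞) (p : ℕ → Polynomial ℝ) (N : ℕ) : Matrix (Fin N) (Fin N) ℂ :=
  Matrix.of fun m n => realForm s (p m) (p n) + complexForm s (p m) (p n)

/-- The weighted integral `∫_ℝ f(x) max {1, |x|} ^ (-s) dx`. -/
def realMean (s : ℝ≥0∞) (f : Polynomial ℝ) : ℂ :=
  ∫ x : ℝ, (weight s (x : ℂ) : ℂ) * val f (x : ℂ)

/-- The antisymmetric matrix used for odd `N`: the matrix `U` bordered by the column of the
weighted integrals of `p_0, …, p_{N-1}` over `ℝ`. -/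
def borderedGram (s : ℝ≥0∞) (p : ℕ → Polynomial ℝ) (N : ℕ) :
    Matrix (Fin N ⊕ Unit) (Fin N ⊕ Unit) ℂ :=
  Matrix.fromBlocks (skewGram s p N) (Matrix.of fun m _ => realMean s (p m))
    (Matrix.of fun _ n => -realMean s (p n)) 0

/-- The coefficients `μ_{m,n}` of the kernel: the entries of `U⁻¹` when `N` is even, and the
entries of the upper left `N × N` block of the inverse of the bordered matrix when `N` is odd. -/
def kernelCoeff (s : ℝ≥0∞) (p : ℕ → Polynomial ℝ) (N : ℕ) : Matrix (Fin N) (Fin N) ℂ :=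
  if Even N then (skewGram s p N)⁻¹ else ((borderedGram s p N)⁻¹).toBlocks₁₁

/-- The polynomial part `-2 ∑ μ_{m,n} p_m(u) p_n(v)` of the (1,1)-entry of the matrix kernel. -/
def polyKernel (s : ℝ≥0∞) (p : ℕ → Polynomial ℝ) (N : ℕ) (u v : ℂ) : ℂ :=
  -2 * ∑ m : Fin N, ∑ n : Fin N, kernelCoeff s p N m n * val (p m) u * val (p n) v

/-- The (1,1)-entry `ϰ_N(u,v)` of the matrix kernel of the real Mahler ensemble. -/
def varkappa (s : ℝ≥0∞) (p : ℕ → Polynomial ℝ) (N : ℕ) (u v : ℂ) : ℂ :=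
  (weight s u : ℂ) * (weight s v : ℂ) * polyKernel s p N u v

/-- The function `M(z) = ₁F₁(3/2; 1; z)`. -/
def M (z : ℂ) : ℂ :=
  (1 / Real.Gamma (3 / 2) : ℝ) *
    ∑' n : ℕ, (Real.Gamma (n + 3 / 2) / Real.Gamma (n + 1) : ℝ) * (z ^ n / (n.factorial : ℂ))

/-- `ω(τ) = min {1, exp (-Re τ / lam)}`; for `lam = 0` this is read as the characteristic
function of the closed left half-plane. -/
def omega (lam : ℝ) (τ : ℂ) : ℝ :=
  if lam = 0 then (if τ.re ≤ 0 then 1 else 0) else min 1 (Real.exp (-τ.re / lam))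

/-- The limit of the polynomial part of the kernel. -/
def polyLimit (lam : ℝ) (ξ u v : ℂ) : ℂ :=
  ξ / 4 * ∫ τ in (0 : ℝ)..1, (τ : ℂ) * (1 - (lam : ℂ) * (τ : ℂ)) *
    (deriv M (u * ξ * τ) * M (v * ξ * τ) - M (u * ξ * τ) * deriv M (v * ξ * τ))

/-- The limit kernel `ϰ_ξ(u,v)`. -/
def varkappaLimit (lam : ℝ) (ξ u v : ℂ) : ℂ :=
  (omega lam (u * ξ) : ℂ) * (omega lam (v * ξ) : ℂ) * polyLimit lam ξ u v

end RealMahler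

end

open Finset

noncomputable section

namespace RealMahler

/-- The coefficient of `z ^ n` in the expansion of `(1 - z) ^ (-a)` at the origin. -/
def negBinom (a : ℝ) (n : ℕ) : ℝ := ∏ i ∈ range n, (a + i) / (i + 1)

@[simp] lemma negBinom_zero (a : ℝ) : negBinom a 0 = 1 := by simp [negBinom]

lemma negBinom_succ (a : ℝ) (n : ℕ) :
    negBinom a (n + 1) = negBinom a n * ((a + n) / (n + 1)) := by
  rw [negBinom, prod_range_succ, negBinom]

lemma succ_mul_negBinom_succ (a : ℝ) (n : ℕ) :
    ((n : ℝ) + 1) * negBinom a (n + 1) = (a + n) * negBinom a n := by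
  have : (n : ℝ) + 1 ≠ 0 := by positivity
  rw [negBinom_succ]; field_simp

lemma negBinom_pos {a : ℝ} (ha : 0 < a) (n : ℕ) : 0 < negBinom a n :=
  prod_pos fun i _ => by positivity

lemma sum_antidiagonal_negBinom (a b : ℝ) (n : ℕ) :
    ∑ ij ∈ antidiagonal n, negBinom a ij.1 * negBinom b ij.2 = negBinom (a + b) n := by
  induction n with
  | zero => simp
  | succ n ih =>
    have hn : (n : ℝ) + 1 ≠ 0 := by positivity
    apply mul_left_cancel₀ hn
    rw [succ_mul_negBinom_succ, ← ih]
    have h1 : ((n : ℝ) + 1) * ∑ ij ∈ antidiagonal (n + 1), negBinom a ij.1 * negBinom b ij.2 =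
        ∑ ij ∈ antidiagonal (n + 1), ((ij.1 : ℝ) * negBinom a ij.1) * negBinom b ij.2 +
        ∑ ij ∈ antidiagonal (n + 1), negBinom a ij.1 * ((ij.2 : ℝ) * negBinom b ij.2) := by
      rw [mul_sum, ← sum_add_distrib]
      refine sum_congr rfl fun ij hij => ?_
      have : (ij.1 : ℝ) + ij.2 = n + 1 := by exact_mod_cast mem_antidiagonal.1 hij
      rw [← this]; ring
    rw [h1, Nat.sum_antidiagonal_succ, Nat.sum_antidiagonal_succ']
    simp only [Nat.cast_zero, zero_mul, mul_zero, zero_add, Nat.cast_add, Nat.cast_one,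
      succ_mul_negBinom_succ]
    rw [← sum_add_distrib, mul_sum]
    refine sum_congr rfl fun ij hij => ?_
    have : (ij.1 : ℝ) + ij.2 = n := by exact_mod_cast mem_antidiagonal.1 hij
    rw [← this]; ring

lemma negBinom_sub_one (a : ℝ) (n : ℕ) :
    negBinom (a - 1) (n + 1) = negBinom a (n + 1) - negBinom a n := by
  induction n with
  | zero => simp [negBinom_succ]
  | succ n ih =>
    rw [negBinom_succ, ih, negBinom_succ a (n + 1), negBinom_succ a n]
    have h1 : (n : ℝ) + 1 ≠ 0 := by positivity
    have h2 : (n : ℝ) + 2 ≠ 0 := by positivity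
    have h3 : (n : ℝ) + 1 + 1 ≠ 0 := by positivity
    push_cast
    field_simp
    ring

lemma negBinom_natCast_succ (l n : ℕ) :
    negBinom ((l : ℝ) + 1) n = ((n + l).choose l : ℝ) := by
  induction n with
  | zero => simp
  | succ n ih =>
    have h1 : (n : ℝ) + 1 ≠ 0 := by positivity
    rw [negBinom_succ, ih]
    have := Nat.add_one_mul_choose_eq (n + l) n
    have e1 : (n + l).choose l = (n + l).choose n := by
      rw [← Nat.choose_symm_add, add_comm]
    have e2 : (n + 1 + l).choose l = (n + l + 1).choose (n + 1) := by
      rw [show n + l + 1 = n + 1 + l by ring, ← Nat.choose_symm_add]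
    rw [e1, e2]
    have h2 : ((n : ℝ) + l + 1) * ((n + l).choose n) = ((n + l + 1).choose (n + 1)) * (n + 1) := by
      exact_mod_cast this
    field_simp
    linarith

lemma negBinom_zero_left (n : ℕ) : negBinom 0 (n + 1) = 0 := by
  simp [negBinom, prod_range_succ']

lemma negBinom_neg_one (n : ℕ) : negBinom (-1) (n + 2) = 0 := by
  simp [negBinom, prod_range_succ']

lemma negBinom_one (n : ℕ) : negBinom 1 n = 1 := by
  simpa using negBinom_natCast_succ 0 n

lemma negBinom_three_halves (k : ℕ) :
    negBinom (3 / 2) k = (2 * k + 1) * negBinom (1 / 2) k := by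
  induction k with
  | zero => simp
  | succ k ih =>
    have h1 : (k : ℝ) + 1 ≠ 0 := by positivity
    rw [negBinom_succ, ih, negBinom_succ]
    push_cast
    field_simp
    ring

lemma negBinom_three_halves_le (k : ℕ) : negBinom (3 / 2) k ≤ k + 1 := by
  induction k with
  | zero => simp
  | succ k ih =>
    have h1 : (0 : ℝ) < (k : ℝ) + 1 := by positivity
    rw [negBinom_succ]
    calc _ ≤ ((k : ℝ) + 1) * ((3 / 2 + k) / (k + 1)) := by gcongr
      _ = 3 / 2 + k := by field_simp
      _ ≤ _ := by push_cast; linarith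

/-- `negBinom a k * choose k l` as a product of two such coefficients. -/
lemma negBinom_mul_choose (a : ℝ) (l k : ℕ) :
    negBinom a (l + k) * ((l + k).choose l : ℝ) = negBinom a l * negBinom (a + l) k := by
  induction k with
  | zero => simp
  | succ k ih =>
    have h1 : (k : ℝ) + 1 ≠ 0 := by positivity
    have h2 : (l : ℝ) + k + 1 ≠ 0 := by positivity
    have h : ((l : ℝ) + k + 1) * ((l + k).choose l) = ((l + k + 1).choose l) * (k + 1) := by
      have := Nat.choose_mul_succ_eq (l + k) l
      have h3 : l + k + 1 - l = k + 1 := by omega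
      rw [h3] at this
      have h4 : (((l + k).choose l * (l + k + 1) : ℕ) : ℝ) = ((l + k + 1).choose l * (k + 1) : ℕ) := by
        exact_mod_cast this
      push_cast at h4
      linarith
    rw [negBinom_succ (a + l) k, ← mul_assoc, ← ih, ← add_assoc, negBinom_succ]
    push_cast
    field_simp
    linear_combination (-(negBinom a (l + k) * (a + (l + k)))) * h

lemma sum_negBinom_choose (a b : ℝ) (n l : ℕ) (hl : l ≤ n) :
    ∑ ij ∈ antidiagonal n, negBinom a ij.1 * negBinom b ij.2 * (ij.1.choose l : ℝ) =
      negBinom a l * negBinom (a + b + l) (n - l) := by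
  obtain ⟨m, rfl⟩ := Nat.exists_eq_add_of_le hl
  rw [Nat.add_sub_cancel_left, show a + b + l = (a + l) + b by ring,
    ← sum_antidiagonal_negBinom, mul_sum, Nat.sum_antidiagonal_eq_sum_range_succ_mk,
    Nat.sum_antidiagonal_eq_sum_range_succ_mk, show (l + m).succ = l + (m + 1) by omega, sum_range_add]
  rw [sum_eq_zero, zero_add]
  · refine sum_congr rfl fun k _ => ?_
    simp only
    rw [show l + m - (l + k) = m - k by omega]
    linear_combination (negBinom b (m - k)) * negBinom_mul_choose a l k
  · intro k hk
    simp [Nat.choose_eq_zero_of_lt (mem_range.1 hk)]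

/-- Re-expansion at `1` of a polynomial whose coefficients are products of binomial ones. -/
lemma sum_negBinom_mul_pow (a b : ℝ) (n : ℕ) (z : ℂ) :
    ∑ ij ∈ antidiagonal n, ((negBinom a ij.1 * negBinom b ij.2 : ℝ) : ℂ) * z ^ ij.1 =
      ∑ l ∈ range (n + 1), ((negBinom a l * negBinom (a + b + l) (n - l) : ℝ) : ℂ) *
        (z - 1) ^ l := by
  have h : ∀ ij ∈ antidiagonal n, ((negBinom a ij.1 * negBinom b ij.2 : ℝ) : ℂ) * z ^ ij.1 =
      ∑ l ∈ range (n + 1), ((negBinom a ij.1 * negBinom b ij.2 * (ij.1.choose l : ℝ) : ℝ) : ℂ) *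
        (z - 1) ^ l := by
    intro ij hij
    have hle : ij.1 ≤ n := by have := mem_antidiagonal.1 hij; omega
    conv_lhs => rw [show z = (z - 1) + 1 by ring, add_pow, mul_sum]
    rw [← sum_subset (range_subset_range.2 (Nat.succ_le_succ hle))]
    · refine sum_congr rfl fun l _ => ?_
      push_cast; ring
    · intro l _ hl
      have : ij.1 < l := by simpa using hl
      simp [Nat.choose_eq_zero_of_lt this]
  rw [sum_congr rfl h, sum_comm]
  refine sum_congr rfl fun l hl => ?_
  rw [← sum_mul, ← Complex.ofReal_sum, sum_negBinom_choose _ _ _ _ (by simpa [Nat.lt_succ_iff] using hl)]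

/-- The sum `∑ negBinom a i * negBinom b j / (x - i)` over `i + j = n`. -/
def cauchySum (a b : ℝ) (n : ℕ) (x : ℝ) : ℝ :=
  ∑ ij ∈ antidiagonal n, negBinom a ij.1 * negBinom b ij.2 / (x - ij.1)

lemma cauchySum_succ (a b : ℝ) (n : ℕ) {x : ℝ} (hx : ∀ i : ℕ, x ≠ i) :
    (x - (n + 1)) * cauchySum a b (n + 1) x =
      (x - n - b) * cauchySum a b n x + negBinom (a + b - 1) (n + 1) := by
  have hx' : ∀ i : ℕ, x - i ≠ 0 := fun i => sub_ne_zero.2 (hx i)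
  have h1 : (x - (n + 1)) * cauchySum a b (n + 1) x = negBinom (a + b) (n + 1) -
      ∑ ij ∈ antidiagonal (n + 1), negBinom a ij.1 * ((ij.2 : ℝ) * negBinom b ij.2) / (x - ij.1) := by
    rw [← sum_antidiagonal_negBinom, cauchySum, mul_sum, ← sum_sub_distrib]
    refine sum_congr rfl fun ij hij => ?_
    have : (ij.1 : ℝ) + ij.2 = n + 1 := by exact_mod_cast mem_antidiagonal.1 hij
    rw [← this]
    field_simp [hx' ij.1]
    ring
  have h2 : (x - n - b) * cauchySum a b n x = negBinom (a + b) n -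
      ∑ ij ∈ antidiagonal n, negBinom a ij.1 * ((b + ij.2) * negBinom b ij.2) / (x - ij.1) := by
    rw [← sum_antidiagonal_negBinom, cauchySum, mul_sum, ← sum_sub_distrib]
    refine sum_congr rfl fun ij hij => ?_
    have : (ij.1 : ℝ) + ij.2 = n := by exact_mod_cast mem_antidiagonal.1 hij
    rw [← this]
    field_simp [hx' ij.1]
    ring
  rw [h1, h2, negBinom_sub_one, Nat.sum_antidiagonal_succ']
  simp only [Nat.cast_zero, zero_mul, mul_zero, zero_div, Nat.cast_add, Nat.cast_one,
    succ_mul_negBinom_succ]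
  ring

lemma half_ne_natCast (j : ℕ) (i : ℕ) : (j : ℝ) + 1 / 2 ≠ i := by
  intro h
  have : (2 * j + 1 : ℝ) = 2 * i := by linarith
  have : 2 * j + 1 = 2 * i := by exact_mod_cast this
  omega

lemma half_ne_natCast' (j : ℕ) (i : ℕ) : (j : ℝ) - 1 / 2 ≠ i := by
  intro h
  have : (2 * j : ℝ) = 2 * i + 1 := by linarith
  have : 2 * j = 2 * i + 1 := by exact_mod_cast this
  omega

lemma cauchySum_eq_zero (a b : ℝ) {n₀ n : ℕ} {x : ℝ} (hx : ∀ i : ℕ, x ≠ i) (h : n₀ < n)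
    (h₀ : x = n₀ + b) (hab : ∀ m, n₀ ≤ m → negBinom (a + b - 1) (m + 1) = 0) :
    cauchySum a b n x = 0 := by
  obtain ⟨k, rfl⟩ := Nat.exists_eq_add_of_lt h
  clear h
  have key : ∀ m : ℕ, n₀ ≤ m → (x - m - b) * cauchySum a b m x = 0 →
      cauchySum a b (m + 1) x = 0 := by
    intro m hm h
    have := cauchySum_succ a b m hx
    rw [h, hab m hm, add_zero] at this
    have h' := hx (m + 1)
    push_cast at h'
    exact (mul_eq_zero.1 this).resolve_left (sub_ne_zero.2 h')
  induction k with
  | zero => exact key n₀ le_rfl (by rw [h₀]; simp)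
  | succ k ih => exact key (n₀ + k + 1) (by omega) (by rw [ih, mul_zero])

lemma cauchySum_half_half_eq_zero {n j : ℕ} (h : j < n) :
    cauchySum (1 / 2) (1 / 2) n (j + 1 / 2) = 0 :=
  cauchySum_eq_zero _ _ (half_ne_natCast j) h rfl fun m _ => by
    norm_num [negBinom_zero_left]

lemma cauchySum_three_halves_neg_half_eq_zero {n i : ℕ} (h : i < n) :
    cauchySum (3 / 2) (-1 / 2) n (i - 1 / 2) = 0 :=
  cauchySum_eq_zero _ _ (half_ne_natCast' i) h (by ring) fun m _ => by
    norm_num [negBinom_zero_left]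

lemma cauchySum_half_neg_half_eq_zero {n j : ℕ} (h : j + 1 < n) :
    cauchySum (1 / 2) (-1 / 2) n (j + 1 / 2) = 0 :=
  cauchySum_eq_zero (n₀ := j + 1) _ _ (half_ne_natCast j) h (by push_cast; ring) fun m hm => by
    obtain ⟨m, rfl⟩ := Nat.exists_eq_add_of_le' (show 1 ≤ m by omega)
    norm_num [negBinom_neg_one]

lemma cauchySum_three_halves_half {n i : ℕ} (h : i ≤ n) :
    cauchySum (3 / 2) (1 / 2) n (i - 1 / 2) = -2 := by
  have key : ∀ m : ℕ, ((i : ℝ) - 1 / 2 - m - 1 / 2) * (cauchySum (3 / 2) (1 / 2) m (i - 1 / 2) + 2) = 0 →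
      cauchySum (3 / 2) (1 / 2) (m + 1) (i - 1 / 2) = -2 := by
    intro m h
    have := cauchySum_succ (3 / 2) (1 / 2) m (half_ne_natCast' i)
    rw [show (3 / 2 + 1 / 2 - 1 : ℝ) = 1 by norm_num, negBinom_one] at this
    have h' := half_ne_natCast' i (m + 1)
    push_cast at h'
    apply mul_left_cancel₀ (sub_ne_zero.2 h')
    linear_combination this + h
  induction n, h using Nat.le_induction with
  | base =>
    cases i with
    | zero => simp [cauchySum]
    | succ i => exact key i (by push_cast; ring)
  | succ n hn ih => exact key n (by rw [ih]; ring)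

lemma prod_range_add_half (n : ℕ) :
    ∏ l ∈ range (n + 1), ((l : ℝ) + 1 / 2) = n.factorial * negBinom (3 / 2) n / 2 := by
  induction n with
  | zero => simp
  | succ n ih =>
    have h1 : (n : ℝ) + 1 ≠ 0 := by positivity
    rw [prod_range_succ, ih, negBinom_succ, Nat.factorial_succ]
    push_cast
    field_simp
    ring

lemma prod_range_natCast_sub_add (n : ℕ) (t : ℝ) :
    ∏ k ∈ range (n + 1), ((n : ℝ) - k + t) = ∏ k ∈ range (n + 1), ((k : ℝ) + t) := by
  rw [← prod_range_reflect]
  refine prod_congr rfl fun k hk => ?_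
  have : k ≤ n := by simpa [Nat.lt_succ_iff] using hk
  rw [show n + 1 - 1 - k = n - k by omega, Nat.cast_sub this]
  ring

lemma prod_range_natCast_succ (n : ℕ) :
    ∏ k ∈ range n, ((k : ℝ) + 1) = n.factorial := by
  rw [← prod_range_add_one_eq_factorial]; push_cast; rfl

lemma cauchySum_half_half_mul_prod (n : ℕ) {x : ℝ} (hx : ∀ i : ℕ, x ≠ i) :
    cauchySum (1 / 2) (1 / 2) n x * ∏ k ∈ range (n + 1), (x - k) =
      ∏ k ∈ range n, (x - k - 1 / 2) := by
  induction n with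
  | zero =>
    have := sub_ne_zero.2 (hx 0)
    simp only [Nat.cast_zero, sub_zero] at this
    simp [cauchySum, this]
  | succ n ih =>
    have := cauchySum_succ (1 / 2) (1 / 2) n hx
    rw [show (1 / 2 + 1 / 2 - 1 : ℝ) = 0 by norm_num, negBinom_zero_left, add_zero] at this
    rw [prod_range_succ _ (n + 1), prod_range_succ (fun k : ℕ => x - k - 1 / 2) n, ← ih]
    push_cast
    linear_combination (∏ k ∈ range (n + 1), (x - k)) * this

lemma cauchySum_half_half_self (n : ℕ) :
    negBinom (3 / 2) n * cauchySum (1 / 2) (1 / 2) n (n + 1 / 2) = 2 := by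
  have h := cauchySum_half_half_mul_prod n (half_ne_natCast n)
  have e1 : ∏ k ∈ range (n + 1), ((n : ℝ) + 1 / 2 - k) = n.factorial * negBinom (3 / 2) n / 2 := by
    rw [← prod_range_add_half, ← prod_range_natCast_sub_add]
    exact prod_congr rfl fun k _ => by ring
  have e2 : ∏ k ∈ range n, ((n : ℝ) + 1 / 2 - k - 1 / 2) = n.factorial := by
    rw [← prod_range_natCast_succ, ← prod_range_reflect]
    refine prod_congr rfl fun k hk => ?_
    have hk' : k + 1 ≤ n := by simpa using hk
    rw [show n - 1 - k = n - (k + 1) by omega, Nat.cast_sub hk']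
    push_cast
    ring
  rw [e1, e2] at h
  have : (n.factorial : ℝ) ≠ 0 := by positivity
  apply mul_left_cancel₀ this
  linarith

lemma cauchySum_three_halves_half_mul_prod (n : ℕ) {x : ℝ} (hx : ∀ i : ℕ, x ≠ i) :
    (cauchySum (3 / 2) (1 / 2) n x + 2) * ∏ k ∈ range (n + 1), (x - k) =
      2 * ∏ k ∈ range (n + 1), (x - k + 1 / 2) := by
  induction n with
  | zero =>
    have := sub_ne_zero.2 (hx 0)
    simp only [Nat.cast_zero, sub_zero] at this
    simp [cauchySum]
    field_simp
    ring
  | succ n ih =>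
    have := cauchySum_succ (3 / 2) (1 / 2) n hx
    rw [show (3 / 2 + 1 / 2 - 1 : ℝ) = 1 by norm_num, negBinom_one] at this
    rw [prod_range_succ, prod_range_succ _ (n + 1), ← mul_assoc 2, ← ih]
    push_cast
    linear_combination (∏ k ∈ range (n + 1), (x - k)) * this

lemma cauchySum_three_halves_half_self (n : ℕ) :
    negBinom (1 / 2) (n + 1) * (cauchySum (3 / 2) (1 / 2) n (n + 1 / 2) + 2) = 2 := by
  have h := cauchySum_three_halves_half_mul_prod n (half_ne_natCast n)
  have e1 : ∏ k ∈ range (n + 1), ((n : ℝ) + 1 / 2 - k) = n.factorial * negBinom (3 / 2) n / 2 := by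
    rw [← prod_range_add_half, ← prod_range_natCast_sub_add]
    exact prod_congr rfl fun k _ => by ring
  have e2 : ∏ k ∈ range (n + 1), ((n : ℝ) + 1 / 2 - k + 1 / 2) = (n + 1).factorial := by
    rw [← prod_range_natCast_succ, ← prod_range_natCast_sub_add]
    exact prod_congr rfl fun k _ => by ring
  rw [e1, e2, Nat.factorial_succ, negBinom_three_halves] at h
  have : (n.factorial : ℝ) ≠ 0 := by positivity
  have h1 : (n : ℝ) + 1 ≠ 0 := by positivity
  rw [negBinom_succ]
  push_cast at h
  field_simp at h ⊢
  linarith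

section

open MeasureTheory Set

/-- The reciprocal `1 / s` of the exponent as a real number; it is `0` for `s = ∞`. -/
def recip (s : ℝ≥0∞) : ℝ := s.toReal⁻¹

lemma weight_nonneg (s : ℝ≥0∞) (z : ℂ) : 0 ≤ weight s z := by
  unfold weight
  split_ifs <;> positivity

lemma weight_eq_one (s : ℝ≥0∞) {z : ℂ} (hz : ‖z‖ ≤ 1) : weight s z = 1 := by
  unfold weight
  split_ifs <;> simp [max_eq_left hz]

lemma weight_top {z : ℂ} (hz : 1 < ‖z‖) : weight ⊤ z = 0 := by
  simp [weight, hz]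

lemma weight_of_ne_top {s : ℝ≥0∞} (hs : s ≠ ⊤) {z : ℂ} (hz : 1 ≤ ‖z‖) :
    weight s z = ‖z‖ ^ (-s.toReal) := by
  simp [weight, hs, max_eq_right hz]

lemma weight_le_max_rpow {s : ℝ≥0∞} {t : ℝ} (ht : ENNReal.ofReal t ≤ s) (z : ℂ) :
    weight s z ≤ max 1 ‖z‖ ^ (-t) := by
  rcases le_or_gt ‖z‖ 1 with hz | hz
  · simp [weight_eq_one s hz, max_eq_left hz]
  · by_cases hs : s = ⊤
    · subst hs
      rw [weight_top hz]; positivity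
    · rw [weight_of_ne_top hs hz.le, max_eq_right hz.le]
      exact Real.rpow_le_rpow_of_exponent_le hz.le
        (neg_le_neg ((ENNReal.ofReal_le_iff_le_toReal hs).1 ht))

lemma weight_le_one (s : ℝ≥0∞) (z : ℂ) : weight s z ≤ 1 := by
  simpa using weight_le_max_rpow (s := s) (t := 0) (by simp) z

lemma measurable_weight (s : ℝ≥0∞) : Measurable (weight s) := by
  unfold weight
  split_ifs
  · exact Measurable.ite (measurableSet_le measurable_norm measurable_const)
      measurable_const measurable_const
  · fun_prop

lemma weight_two_mul (s : ℝ≥0∞) (z : ℂ) : weight (2 * s) z = weight s z * weight s z := by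
  rcases le_or_gt ‖z‖ 1 with hz | hz
  · simp [weight_eq_one _ hz]
  · by_cases hs : s = ⊤
    · subst hs
      simp [weight_top hz]
    · rw [weight_of_ne_top hs hz.le, weight_of_ne_top (ENNReal.mul_ne_top (by simp) hs) hz.le,
        ← Real.rpow_add (by linarith), ENNReal.toReal_mul]
      congr 1
      norm_num
      ring

lemma weight_ofReal_norm (s : ℝ≥0∞) (z : ℂ) : weight s (‖z‖ : ℝ) = weight s z := by
  simp [weight]

lemma weight_neg (s : ℝ≥0∞) (z : ℂ) : weight s (-z) = weight s z := by
  simp [weight]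

lemma weight_mul_pow_le {s : ℝ≥0∞} {t : ℝ} (ht : ENNReal.ofReal t ≤ s) {m : ℕ} (hm : (m : ℝ) ≤ t)
    (z : ℂ) : weight s z * ‖z‖ ^ m ≤ 2 ^ (t - m) * (1 + ‖z‖) ^ (-(t - m)) := by
  have h1 : (0 : ℝ) < max 1 ‖z‖ := by positivity
  calc weight s z * ‖z‖ ^ m ≤ max 1 ‖z‖ ^ (-t) * max 1 ‖z‖ ^ m := by
        gcongr
        · exact weight_le_max_rpow ht z
        · exact le_max_right _ _
    _ = max 1 ‖z‖ ^ (-(t - m)) := by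
        rw [← Real.rpow_natCast, ← Real.rpow_add h1]; congr 1; ring
    _ ≤ ((1 + ‖z‖) / 2) ^ (-(t - m)) := by
        apply Real.rpow_le_rpow_of_nonpos (by positivity)
        · have := le_max_left 1 ‖z‖
          have := le_max_right 1 ‖z‖
          linarith
        · linarith
    _ = 2 ^ (t - m) * (1 + ‖z‖) ^ (-(t - m)) := by
        rw [Real.div_rpow (by positivity) (by positivity), Real.rpow_neg (by norm_num : (0:ℝ) ≤ 2)]
        field_simp

lemma exists_real_between {a : ℕ} {s : ℝ≥0∞} (h : (a : ℝ≥0∞) < s) :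
    ∃ t : ℝ, (a : ℝ) < t ∧ ENNReal.ofReal t ≤ s := by
  obtain ⟨q, -, h1, h2⟩ := ENNReal.lt_iff_exists_rat_btwn.1 h
  refine ⟨q, ?_, h2.le⟩
  by_contra hc
  push Not at hc
  have := ENNReal.ofReal_le_ofReal hc
  rw [ENNReal.ofReal_natCast] at this
  exact absurd h1 (not_lt.2 this)

lemma integrable_weight_mul_pow {s : ℝ≥0∞} {m : ℕ} (h : ((m + 1 : ℕ) : ℝ≥0∞) < s) :
    Integrable fun x : ℝ => weight s x * x ^ m := by
  obtain ⟨t, ht, hts⟩ := exists_real_between h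
  push_cast at ht
  have hi : Integrable fun x : ℝ => (2 : ℝ) ^ (t - m) * (1 + ‖x‖) ^ (-(t - m)) :=
    (integrable_one_add_norm (by simp; linarith)).const_mul _
  refine hi.mono' ?_ (Filter.Eventually.of_forall fun x => ?_)
  · exact (((measurable_weight s).comp Complex.measurable_ofReal).mul
      (measurable_id.pow_const m)).aestronglyMeasurable
  · have := weight_mul_pow_le hts (show (m : ℝ) ≤ t by linarith) (x : ℂ)
    rwa [Complex.norm_real, ← norm_pow, ← Real.norm_of_nonneg (weight_nonneg s x), ← norm_mul] at this

lemma integrable_weight_mul_norm_pow {s : ℝ≥0∞} {m : ℕ} (h : ((m + 2 : ℕ) : ℝ≥0∞) < s) :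
    Integrable fun z : ℂ => weight s z * ‖z‖ ^ m := by
  obtain ⟨t, ht, hts⟩ := exists_real_between h
  push_cast at ht
  have hi : Integrable fun x : ℂ => (2 : ℝ) ^ (t - m) * (1 + ‖x‖) ^ (-(t - m)) :=
    (integrable_one_add_norm (by rw [Complex.finrank_real_complex]; push_cast; linarith)).const_mul _
  refine hi.mono' ?_ (Filter.Eventually.of_forall fun x => ?_)
  · exact ((measurable_weight s).mul (measurable_norm.pow_const m)).aestronglyMeasurable
  · rw [Real.norm_of_nonneg (mul_nonneg (weight_nonneg s x) (by positivity))]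
    exact weight_mul_pow_le hts (show (m : ℝ) ≤ t by linarith) x

lemma natCast_lt_toReal {s : ℝ≥0∞} {k : ℕ} (hs : s ≠ ⊤) (h : (k : ℝ≥0∞) < s) :
    (k : ℝ) < s.toReal := by
  rw [← ENNReal.toReal_natCast]
  exact (ENNReal.toReal_lt_toReal (ENNReal.natCast_ne_top k) hs).2 h

lemma recip_pos_den {s : ℝ≥0∞} {k : ℕ} (h : (k : ℝ≥0∞) < s) : 0 < 1 - (k : ℝ) * recip s := by
  by_cases hs : s = ⊤
  · simp [recip, hs]
  · have h1 := natCast_lt_toReal hs h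
    have h0 : 0 < s.toReal := lt_of_le_of_lt (by positivity) h1
    have : (k : ℝ) * recip s < 1 := by
      rw [recip, ← div_eq_mul_inv, div_lt_one h0]; exact h1
    linarith

lemma recip_two_mul (s : ℝ≥0∞) : recip (2 * s) = recip s / 2 := by
  simp [recip, ENNReal.toReal_mul]; ring

/-- The weighted moment of order `m` of the interval `(1, ∞)`. -/
def tailMoment (s : ℝ≥0∞) (m : ℕ) : ℝ := recip s / (1 - ((m + 1 : ℕ) : ℝ) * recip s)

lemma setIntegral_Ioi_weight {s : ℝ≥0∞} {m : ℕ} (h : ((m + 1 : ℕ) : ℝ≥0∞) < s) {y : ℝ}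
    (hy : 1 ≤ y) :
    ∫ x in Ioi y, weight s x * x ^ m = tailMoment s m * (weight s y * y ^ (m + 1)) := by
  have hn : ∀ x ∈ Ioi y, 1 < ‖(x : ℂ)‖ := fun x hx => by
    rw [Complex.norm_real, Real.norm_of_nonneg (by have := mem_Ioi.1 hx; linarith)]
    exact lt_of_le_of_lt hy hx
  by_cases hs : s = ⊤
  · subst hs
    rw [setIntegral_congr_fun (g := fun _ => (0 : ℝ)) measurableSet_Ioi
      fun x hx => by simp [weight_top (hn x hx)]]
    simp [tailMoment, recip]
  · have h1 := natCast_lt_toReal hs h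
    have h0 : 0 < s.toReal := lt_of_le_of_lt (by positivity) h1
    have hy0 : 0 < y := by linarith
    rw [setIntegral_congr_fun (g := fun x => x ^ ((m : ℝ) - s.toReal)) measurableSet_Ioi]
    · push_cast at h1
      rw [integral_Ioi_rpow_of_lt (by linarith) hy0, tailMoment, recip,
        weight_of_ne_top hs (by rw [Complex.norm_real, Real.norm_of_nonneg hy0.le]; exact hy),
        Complex.norm_real, Real.norm_of_nonneg hy0.le, ← Real.rpow_natCast, ← Real.rpow_add hy0]
      have e : (m : ℝ) - s.toReal + 1 = -s.toReal + ((m + 1 : ℕ) : ℝ) := by push_cast; ring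
      have h2 : -s.toReal + (m + 1) ≠ 0 := by linarith
      have h3 : s.toReal - (m + 1) ≠ 0 := by linarith
      rw [e]
      push_cast
      field_simp
      ring
    · intro x hx
      have hx0 : 0 < x := by have := mem_Ioi.1 hx; linarith
      simp only
      rw [weight_of_ne_top hs (hn x hx).le, Complex.norm_real, Real.norm_of_nonneg hx0.le,
        ← Real.rpow_natCast, ← Real.rpow_add hx0]
      congr 1; ring

/-- Integration over `(y, ∞)`, split at `1`. -/
lemma setIntegral_Ioi_split {f : ℝ → ℝ} {y : ℝ} (hy : y ≤ 1) (hf : IntegrableOn f (Ioi y)) :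
    ∫ x in Ioi y, f x = (∫ x in y..1, f x) + ∫ x in Ioi 1, f x := by
  rw [intervalIntegral.integral_of_le hy, ← setIntegral_union (by
    rw [Set.disjoint_left]; intro x hx hx'; exact absurd hx' (not_lt.2 hx.2)) measurableSet_Ioi
    (hf.mono_set fun _ hx => hx.1) (hf.mono_set fun _ hx => lt_of_le_of_lt hy hx),
    Ioc_union_Ioi_eq_Ioi hy]

lemma setIntegral_Ioi_weight_of_le_one {s : ℝ≥0∞} {m : ℕ} (h : ((m + 1 : ℕ) : ℝ≥0∞) < s) {y : ℝ}
    (hy0 : 0 ≤ y) (hy : y ≤ 1) :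
    ∫ x in Ioi y, weight s x * x ^ m = (1 - y ^ (m + 1)) / (m + 1) + tailMoment s m := by
  rw [setIntegral_Ioi_split hy (integrable_weight_mul_pow h).integrableOn,
    setIntegral_Ioi_weight h le_rfl, weight_eq_one s (z := ((1 : ℝ) : ℂ)) (by simp),
    intervalIntegral.integral_congr (g := fun x => x ^ m)]
  · simp
  · intro x hx
    rw [Set.uIcc_of_le hy] at hx
    simp only
    rw [weight_eq_one, one_mul]
    rw [Complex.norm_real, Real.norm_of_nonneg (hy0.trans hx.1)]
    exact hx.2

lemma integral_eq_setIntegral_Ioi {f : ℝ → ℝ} (hf : Integrable f) :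
    ∫ x, f x = ∫ x in Ioi 0, (f x + f (-x)) := by
  rw [integral_add hf.integrableOn hf.comp_neg.integrableOn, integral_comp_neg_Ioi, neg_zero,
    ← integral_add_compl (measurableSet_Ioi (a := (0 : ℝ))) hf, compl_Ioi]

lemma integral_weight_mul_pow {s : ℝ≥0∞} {m : ℕ} (h : ((m + 1 : ℕ) : ℝ≥0∞) < s) :
    ∫ x : ℝ, weight s x * x ^ m = (1 + (-1) ^ m) * (1 / (m + 1) + tailMoment s m) := by
  rw [integral_eq_setIntegral_Ioi (integrable_weight_mul_pow h)]
  have : ∀ x : ℝ, weight s x * x ^ m + weight s ((-x : ℝ) : ℂ) * (-x) ^ m =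
      (1 + (-1) ^ m) * (weight s x * x ^ m) := fun x => by
    rw [Complex.ofReal_neg, weight_neg, neg_pow x]; ring
  simp_rw [this]
  rw [integral_const_mul, setIntegral_Ioi_weight_of_le_one h le_rfl zero_le_one]
  simp

/-- The inner integral of the real skew form of two monomials. -/
def innerMoment (s : ℝ≥0∞) (m : ℕ) (y : ℝ) : ℝ :=
  ∫ x : ℝ, weight s x * x ^ m * Real.sign (y - x)

lemma measurable_sign : Measurable Real.sign := by
  unfold Real.sign
  exact Measurable.ite measurableSet_Iio measurable_const
    (Measurable.ite measurableSet_Ioi measurable_const measurable_const)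

lemma abs_sign_le_one (x : ℝ) : |Real.sign x| ≤ 1 := by
  rcases Real.sign_apply_eq x with h | h | h <;> simp [h]

lemma integrable_weight_mul_pow_mul_sign {s : ℝ≥0∞} {m : ℕ} (h : ((m + 1 : ℕ) : ℝ≥0∞) < s) (y : ℝ) :
    Integrable fun x : ℝ => weight s x * x ^ m * Real.sign (y - x) :=
  (integrable_weight_mul_pow h).mul_bdd (c := 1)
    (measurable_sign.comp (measurable_const.sub measurable_id)).aestronglyMeasurable
    (Filter.Eventually.of_forall fun _ => abs_sign_le_one _)

lemma innerMoment_eq {s : ℝ≥0∞} {m : ℕ} (h : ((m + 1 : ℕ) : ℝ≥0∞) < s) (y : ℝ) :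
    innerMoment s m y =
      (∫ x : ℝ, weight s x * x ^ m) - 2 * ∫ x in Ioi y, weight s x * x ^ m := by
  rw [innerMoment, ← integral_const_mul, ← integral_indicator measurableSet_Ioi, ← integral_sub
    (integrable_weight_mul_pow h)
    (((integrable_weight_mul_pow h).const_mul 2).indicator measurableSet_Ioi)]
  refine integral_congr_ae ?_
  have : ∀ᵐ x : ℝ, x ≠ y := by simp [ae_iff]
  filter_upwards [this] with x hx
  rcases lt_or_gt_of_ne hx with hx | hx
  · rw [indicator_of_notMem (by simpa using hx.le), Real.sign_of_pos (by linarith)]; ring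
  · rw [indicator_of_mem (by simpa using hx), Real.sign_of_neg (by linarith)]; ring

lemma innerMoment_neg (s : ℝ≥0∞) (m : ℕ) (y : ℝ) :
    innerMoment s m (-y) = -(-1) ^ m * innerMoment s m y := by
  rw [innerMoment, ← integral_neg_eq_self, innerMoment, ← integral_const_mul]
  refine integral_congr_ae (Filter.Eventually.of_forall fun x => ?_)
  simp only
  rw [Complex.ofReal_neg, weight_neg, neg_pow x, show -y - -x = -(y - x) by ring, Real.sign_neg]
  ring

lemma integrable_weight_mul_pow_mul_innerMoment {s : ℝ≥0∞} {m n : ℕ}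
    (h : ((m + 1 : ℕ) : ℝ≥0∞) < s) (h' : ((n + 1 : ℕ) : ℝ≥0∞) < s) :
    Integrable fun y : ℝ => weight s y * y ^ n * innerMoment s m y := by
  refine (integrable_weight_mul_pow h').mul_bdd (c := ∫ x : ℝ, ‖weight s x * x ^ m‖) ?_
    (Filter.Eventually.of_forall fun y => ?_)
  · have : Measurable (Function.uncurry fun y x : ℝ => weight s x * x ^ m * Real.sign (y - x)) :=
      ((((measurable_weight s).comp Complex.measurable_ofReal).mul
        (measurable_id.pow_const m)).comp measurable_snd).mul
        (measurable_sign.comp (measurable_fst.sub measurable_snd))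
    exact (this.stronglyMeasurable.integral_prod_right (ν := volume)).aestronglyMeasurable
  · refine (norm_integral_le_integral_norm _).trans (integral_mono
      (integrable_weight_mul_pow_mul_sign h y).norm (integrable_weight_mul_pow h).norm fun x => ?_)
    simp only [norm_mul]
    exact mul_le_of_le_one_right (by positivity) (abs_sign_le_one _)

lemma integrable_weight_mul_tail {s : ℝ≥0∞} {m n : ℕ}
    (h : ((m + 1 : ℕ) : ℝ≥0∞) < s) (h' : ((n + 1 : ℕ) : ℝ≥0∞) < s) :
    Integrable fun y : ℝ => weight s y * y ^ n * ∫ x in Ioi y, weight s x * x ^ m := by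
  have h3 : (fun y : ℝ => weight s y * y ^ n * ∫ x in Ioi y, weight s x * x ^ m) = fun y : ℝ =>
      (weight s y * y ^ n * ((∫ x : ℝ, weight s x * x ^ m) / 2) -
        weight s y * y ^ n * innerMoment s m y / 2) := by
    funext y
    rw [innerMoment_eq h]; ring
  rw [h3]
  exact ((integrable_weight_mul_pow h').mul_const _).sub
    ((integrable_weight_mul_pow_mul_innerMoment h h').div_const _)

lemma setIntegral_weight_mul_tail {s : ℝ≥0∞} {m n : ℕ}
    (h : ((m + 1 : ℕ) : ℝ≥0∞) < s) (h' : ((n + 1 : ℕ) : ℝ≥0∞) < s)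
    (h2 : ((n + (m + 1) + 1 : ℕ) : ℝ≥0∞) < 2 * s) :
    ∫ y in Ioi (0 : ℝ), weight s y * y ^ n * ∫ x in Ioi y, weight s x * x ^ m =
      (1 / (m + 1) + tailMoment s m) / (n + 1) - 1 / ((m + 1) * (m + n + 2)) +
        tailMoment s m * tailMoment (2 * s) (n + (m + 1)) := by
  have hi := integrable_weight_mul_tail h h'
  rw [setIntegral_Ioi_split zero_le_one hi.integrableOn]
  congr 1
  · rw [intervalIntegral.integral_congr
      (g := fun y => (1 / (m + 1) + tailMoment s m) * y ^ n - 1 / (m + 1) * y ^ (m + n + 1))]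
    · rw [intervalIntegral.integral_sub (Continuous.intervalIntegrable (by fun_prop) _ _)
        (Continuous.intervalIntegrable (by fun_prop) _ _),
        intervalIntegral.integral_const_mul, intervalIntegral.integral_const_mul, integral_pow,
        integral_pow]
      have h1 : (m : ℝ) + 1 ≠ 0 := by positivity
      have h3 : (m : ℝ) + n + 1 + 1 ≠ 0 := by positivity
      have h4 : (m : ℝ) + n + 2 ≠ 0 := by positivity
      push_cast
      simp
      field_simp
      ring
    · intro y hy
      rw [Set.uIcc_of_le zero_le_one] at hy
      simp only
      rw [setIntegral_Ioi_weight_of_le_one h hy.1 hy.2, weight_eq_one]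
      · ring
      · rw [Complex.norm_real, Real.norm_of_nonneg hy.1]; exact hy.2
  · rw [setIntegral_congr_fun
      (g := fun y : ℝ => tailMoment s m * (weight (2 * s) y * y ^ (n + (m + 1)))) measurableSet_Ioi]
    · rw [integral_const_mul, setIntegral_Ioi_weight h2 le_rfl, weight_eq_one _ (by simp)]
      simp
    · intro y hy
      simp only
      rw [setIntegral_Ioi_weight h (le_of_lt hy), weight_two_mul]
      ring

/-- The real skew form of two monomials. -/
lemma integral_weight_mul_innerMoment {s : ℝ≥0∞} {m n : ℕ}
    (h : ((m + 1 : ℕ) : ℝ≥0∞) < s) (h' : ((n + 1 : ℕ) : ℝ≥0∞) < s)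
    (h2 : ((n + (m + 1) + 1 : ℕ) : ℝ≥0∞) < 2 * s) :
    ∫ y : ℝ, weight s y * y ^ n * innerMoment s m y = (1 - (-1) ^ (m + n)) *
      ((1 + (-1) ^ m) * (1 / (m + 1) + tailMoment s m) * (1 / (n + 1) + tailMoment s n) -
      2 * ((1 / (m + 1) + tailMoment s m) / (n + 1) - 1 / ((m + 1) * (m + n + 2)) +
        tailMoment s m * tailMoment (2 * s) (n + (m + 1)))) := by
  rw [integral_eq_setIntegral_Ioi (integrable_weight_mul_pow_mul_innerMoment h h')]
  have key : ∀ y : ℝ, weight s y * y ^ n * innerMoment s m y +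
      weight s ((-y : ℝ) : ℂ) * (-y) ^ n * innerMoment s m (-y) = (1 - (-1) ^ (m + n)) *
      ((1 + (-1) ^ m) * (1 / (m + 1) + tailMoment s m) * (weight s y * y ^ n) -
        2 * (weight s y * y ^ n * ∫ x in Ioi y, weight s x * x ^ m)) := fun y => by
    rw [innerMoment_neg, innerMoment_eq h, integral_weight_mul_pow h, Complex.ofReal_neg, weight_neg,
      neg_pow y, pow_add]
    ring
  simp_rw [key]
  have hi := integrable_weight_mul_tail h h'
  rw [integral_const_mul, integral_sub ((integrable_weight_mul_pow h').integrableOn.const_mul _)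
    (hi.integrableOn.const_mul _), integral_const_mul, integral_const_mul,
    setIntegral_weight_mul_tail h h' h2, setIntegral_Ioi_weight_of_le_one h' le_rfl zero_le_one]
  simp

lemma integral_sin_intCast_mul (k : ℤ) :
    ∫ θ in (0 : ℝ)..Real.pi, Real.sin (k * θ) = if Even k then 0 else 2 / (k : ℝ) := by
  by_cases hk : k = 0
  · simp [hk]
  have hk' : (k : ℝ) ≠ 0 := by exact_mod_cast hk
  rw [intervalIntegral.integral_comp_mul_left (fun x => Real.sin x) hk', integral_sin]
  simp only [mul_zero, Real.cos_zero, Real.cos_int_mul_pi, smul_eq_mul]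
  split_ifs with h
  · simp [h.neg_one_zpow]
  · rw [(Int.not_even_iff_odd.1 h).neg_one_zpow]
    field_simp; norm_num

lemma setIntegral_exp_mul_sign_sin (k : ℤ) :
    ∫ θ in Ioo (-Real.pi) Real.pi,
      Complex.exp (k * θ * Complex.I) * (Real.sign (Real.sin θ) : ℂ) =
        if Even k then 0 else 4 * Complex.I / (k : ℂ) := by
  have hpi := Real.pi_pos
  have hcont : ∀ a b : ℝ, IntervalIntegrable
      (fun θ : ℝ => Complex.exp (k * θ * Complex.I)) volume a b := fun a b =>
    Continuous.intervalIntegrable (by fun_prop) _ _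
  have hae : ∀ᵐ θ : ℝ, θ ≠ Real.pi := by simp [ae_iff]
  have hae0 : ∀ᵐ θ : ℝ, θ ≠ 0 := by simp [ae_iff]
  have hneg : ∀ᵐ θ : ℝ, θ ∈ Set.uIoc (-Real.pi) 0 → -Complex.exp (k * θ * Complex.I) =
      Complex.exp (k * θ * Complex.I) * (Real.sign (Real.sin θ) : ℂ) := by
    filter_upwards [hae0] with θ h0 hθ
    rw [Set.uIoc_of_le (by linarith)] at hθ
    rw [Real.sign_of_neg (Real.sin_neg_of_neg_of_neg_pi_lt (lt_of_le_of_ne hθ.2 h0) hθ.1)]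
    simp
  have hpos : ∀ᵐ θ : ℝ, θ ∈ Set.uIoc 0 Real.pi → Complex.exp (k * θ * Complex.I) =
      Complex.exp (k * θ * Complex.I) * (Real.sign (Real.sin θ) : ℂ) := by
    filter_upwards [hae] with θ h0 hθ
    rw [Set.uIoc_of_le (by linarith)] at hθ
    rw [Real.sign_of_pos (Real.sin_pos_of_pos_of_lt_pi hθ.1 (lt_of_le_of_ne hθ.2 h0))]
    simp
  rw [← integral_Ioc_eq_integral_Ioo, ← intervalIntegral.integral_of_le (by linarith),
    ← intervalIntegral.integral_add_adjacent_intervals (b := 0)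
      ((hcont _ _).neg.congr_ae ((ae_restrict_iff' measurableSet_uIoc).2 hneg))
      ((hcont _ _).congr_ae ((ae_restrict_iff' measurableSet_uIoc).2 hpos)),
    ← intervalIntegral.integral_congr_ae hneg, ← intervalIntegral.integral_congr_ae hpos,
    intervalIntegral.integral_neg]
  have e : ∫ θ in (-Real.pi)..0, Complex.exp (k * θ * Complex.I) =
      ∫ θ in (0 : ℝ)..Real.pi, Complex.exp (-(k * θ * Complex.I)) := by
    have := intervalIntegral.integral_comp_neg (a := 0) (b := Real.pi)
      (fun θ : ℝ => Complex.exp (k * θ * Complex.I))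
    rw [neg_zero] at this
    rw [← this]
    refine intervalIntegral.integral_congr fun θ _ => ?_
    push_cast
    congr 1; ring
  rw [e, neg_add_eq_sub, ← intervalIntegral.integral_sub (hcont _ _)
    (Continuous.intervalIntegrable (by fun_prop) _ _)]
  have e2 : ∀ θ : ℝ, Complex.exp (k * θ * Complex.I) - Complex.exp (-(k * θ * Complex.I)) =
      2 * Complex.I * ((Real.sin (k * θ) : ℝ) : ℂ) := fun θ => by
    push_cast
    rw [Complex.sin, neg_mul]
    have := Complex.I_sq
    linear_combination (-(Complex.exp (-(k * θ * Complex.I)) - Complex.exp (k * θ * Complex.I))) * this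
  simp_rw [e2]
  rw [intervalIntegral.integral_const_mul, intervalIntegral.integral_ofReal,
    integral_sin_intCast_mul]
  split_ifs
  · simp
  · push_cast; ring

lemma integral_complex_monomial {s : ℝ≥0∞} {m n : ℕ} (h : ((m + n + 1 + 1 : ℕ) : ℝ≥0∞) < 2 * s) :
    ∫ z : ℂ, (weight (2 * s) z : ℂ) * (starRingEnd ℂ z) ^ m * z ^ n * (Real.sign z.im : ℂ) =
      (1 / (m + n + 2) + tailMoment (2 * s) (m + n + 1) : ℝ) *
        (if Even (m + n) then 0 else 4 * Complex.I / (n - m)) := by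
  rw [← Complex.integral_comp_polarCoord_symm]
  have h1 : ∀ p ∈ polarCoord.target, p.1 • ((weight (2 * s) (Complex.polarCoord.symm p) : ℂ) *
      (starRingEnd ℂ (Complex.polarCoord.symm p)) ^ m * (Complex.polarCoord.symm p) ^ n *
      (Real.sign (Complex.polarCoord.symm p).im : ℂ)) =
      ((weight (2 * s) (p.1 : ℂ) * p.1 ^ (m + n + 1) : ℝ) : ℂ) *
      (Complex.exp (((n : ℤ) - m : ℤ) * p.2 * Complex.I) * (Real.sign (Real.sin p.2) : ℂ)) := by
    rintro ⟨ρ, θ⟩ ⟨hρ, hθ⟩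
    simp only [Set.mem_Ioi] at hρ
    have e1 : (Complex.polarCoord.symm (ρ, θ)) = ρ * Complex.exp (θ * Complex.I) := by
      rw [Complex.polarCoord_symm_apply, Complex.exp_mul_I]; simp
    have e2 : weight (2 * s) (ρ * Complex.exp (θ * Complex.I)) = weight (2 * s) ρ := by
      rw [← weight_ofReal_norm]
      simp [Complex.norm_exp_ofReal_mul_I, abs_of_pos hρ]
    have e3 : (ρ * Complex.exp (θ * Complex.I)).im = ρ * Real.sin θ := by
      rw [Complex.im_ofReal_mul, Complex.exp_ofReal_mul_I_im]
    have e4 : Real.sign (ρ * Real.sin θ) = Real.sign (Real.sin θ) := by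
      rcases lt_trichotomy (Real.sin θ) 0 with h | h | h
      · rw [Real.sign_of_neg h, Real.sign_of_neg (mul_neg_of_pos_of_neg hρ h)]
      · rw [h, mul_zero]
      · rw [Real.sign_of_pos h, Real.sign_of_pos (mul_pos hρ h)]
    have e5 : starRingEnd ℂ (ρ * Complex.exp (θ * Complex.I)) = ρ * Complex.exp (-(θ * Complex.I)) := by
      rw [map_mul, Complex.conj_ofReal, ← Complex.exp_conj]; simp
    have e6 : Complex.exp (((n : ℤ) - m : ℤ) * θ * Complex.I) =
        Complex.exp (-(θ * Complex.I)) ^ m * Complex.exp (θ * Complex.I) ^ n := by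
      rw [← Complex.exp_nat_mul, ← Complex.exp_nat_mul, ← Complex.exp_add]
      congr 1; push_cast; ring
    simp only
    rw [e1, e2, e3, e4, e5, e6, Complex.real_smul]
    push_cast
    ring
  rw [setIntegral_congr_fun polarCoord.open_target.measurableSet h1, polarCoord_target,
    Measure.volume_eq_prod, setIntegral_prod_mul
      (fun ρ : ℝ => ((weight (2 * s) (ρ : ℂ) * ρ ^ (m + n + 1) : ℝ) : ℂ))
      (fun θ : ℝ => Complex.exp (((n : ℤ) - m : ℤ) * θ * Complex.I) * (Real.sign (Real.sin θ) : ℂ)),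
    integral_complex_ofReal, setIntegral_exp_mul_sign_sin,
    setIntegral_Ioi_weight_of_le_one h le_rfl zero_le_one]
  have : Even ((n : ℤ) - m) ↔ Even (m + n) := by
    rw [Int.even_sub, Int.even_coe_nat, Int.even_coe_nat, Nat.even_add]; tauto
  simp only [this]
  congr 1
  · congr 1; push_cast; simp; ring
  · push_cast; rfl

lemma integrable_complex_monomial {s : ℝ≥0∞} {m n : ℕ}
    (h : ((m + n + 2 : ℕ) : ℝ≥0∞) < 2 * s) :
    Integrable fun z : ℂ =>
      (weight (2 * s) z : ℂ) * (starRingEnd ℂ z) ^ m * z ^ n * (Real.sign z.im : ℂ) := by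
  refine (integrable_weight_mul_norm_pow h).mono' ?_ (Filter.Eventually.of_forall fun z => ?_)
  · refine Measurable.aestronglyMeasurable ?_
    have h1 := Complex.measurable_ofReal.comp (measurable_weight (2 * s))
    have h2 := Complex.measurable_ofReal.comp (measurable_sign.comp Complex.measurable_im)
    exact ((h1.mul (by fun_prop)).mul (by fun_prop)).mul h2
  · rw [norm_mul, norm_mul, norm_mul, norm_pow, norm_pow, RCLike.norm_conj, Complex.norm_real,
      Complex.norm_real, Real.norm_of_nonneg (weight_nonneg _ _), mul_assoc (weight _ _), ← pow_add]
    exact mul_le_of_le_one_right (mul_nonneg (weight_nonneg _ _) (by positivity)) (abs_sign_le_one _)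

/-- The value of the skew form on a pair of monomials of degrees `m` and `n`. -/
def monomialGram (r : ℝ) (m n : ℕ) : ℝ :=
  if Even (m + n) then 0
  else if Even m then 4 / ((m + 1) * (1 - (n + 1) * r) * (n - m))
  else 4 / ((n + 1) * (1 - (m + 1) * r) * (n - m))

/-- The weighted integral over the real line of the monomial of degree `m`. -/
def monomialMean (r : ℝ) (m : ℕ) : ℝ :=
  if Even m then 2 / ((m + 1) * (1 - (m + 1) * r)) else 0

lemma inv_add_tailMoment {s : ℝ≥0∞} {m : ℕ} (h : ((m + 1 : ℕ) : ℝ≥0∞) < s) :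
    1 / ((m : ℝ) + 1) + tailMoment s m = 1 / ((m + 1) * (1 - (m + 1) * recip s)) := by
  have h1 := (recip_pos_den h).ne'
  have h2 : (m : ℝ) + 1 ≠ 0 := by positivity
  rw [tailMoment]
  push_cast at h1 ⊢
  field_simp
  ring

lemma integral_weight_mul_pow_eq {s : ℝ≥0∞} {m : ℕ} (h : ((m + 1 : ℕ) : ℝ≥0∞) < s) :
    ∫ x : ℝ, weight s x * x ^ m = monomialMean (recip s) m := by
  rw [integral_weight_mul_pow h, inv_add_tailMoment h, monomialMean]
  split_ifs with hm
  · rw [hm.neg_one_pow]; ring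
  · rw [(Nat.not_even_iff_odd.1 hm).neg_one_pow]; ring

lemma add_lt_two_mul {a b : ℕ} {s : ℝ≥0∞} (h : (a : ℝ≥0∞) < s) (h' : (b : ℝ≥0∞) < s) :
    ((a + b : ℕ) : ℝ≥0∞) < 2 * s := by
  push_cast
  rw [two_mul]
  exact ENNReal.add_lt_add h h'

lemma monomialGram_eq {s : ℝ≥0∞} {m n : ℕ}
    (h : ((m + 1 : ℕ) : ℝ≥0∞) < s) (h' : ((n + 1 : ℕ) : ℝ≥0∞) < s) :
    ((∫ y : ℝ, weight s y * y ^ n * innerMoment s m y : ℝ) : ℂ) + (-2 * Complex.I *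
      ∫ z : ℂ, (weight (2 * s) z : ℂ) * (starRingEnd ℂ z) ^ m * z ^ n * (Real.sign z.im : ℂ)) =
      (monomialGram (recip s) m n : ℂ) := by
  have h2 := add_lt_two_mul h h'
  rw [integral_weight_mul_innerMoment h h' (by convert h2 using 2; ring),
    integral_complex_monomial (by convert h2 using 2; ring), monomialGram]
  by_cases hmn : Even (m + n)
  · simp [hmn, hmn.neg_one_pow]
  have hne : (n : ℝ) - m ≠ 0 := by
    intro h0
    have : n = m := by exact_mod_cast sub_eq_zero.1 h0
    exact hmn ⟨m, by rw [this]⟩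
  have hd := (recip_pos_den h).ne'
  have hd' := (recip_pos_den h').ne'
  have hd2 := (recip_pos_den h2).ne'
  rw [recip_two_mul] at hd2
  have hm1 : (m : ℝ) + 1 ≠ 0 := by positivity
  have hn1 : (n : ℝ) + 1 ≠ 0 := by positivity
  have hmn2 : (m : ℝ) + n + 2 ≠ 0 := by positivity
  have e1 : n + (m + 1) = m + n + 1 := by ring
  rw [if_neg hmn, if_neg hmn, (Nat.not_even_iff_odd.1 hmn).neg_one_pow, inv_add_tailMoment h,
    inv_add_tailMoment h', e1]
  have e2 : (-2 * Complex.I * ((1 / (m + n + 2) + tailMoment (2 * s) (m + n + 1) : ℝ) *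
      (4 * Complex.I / (n - m)))) =
      ((8 / (n - m) * (1 / (m + n + 2) + tailMoment (2 * s) (m + n + 1)) : ℝ) : ℂ) := by
    push_cast
    have := Complex.I_sq
    linear_combination (-(8 / ((n : ℂ) - m) * (1 / (m + n + 2) + tailMoment (2 * s) (m + n + 1)))) * this
  rw [e2, ← Complex.ofReal_add]
  congr 1
  have e3 : tailMoment (2 * s) (m + n + 1) = recip s / (2 - (m + n + 2) * recip s) := by
    have : 2 - ((m : ℝ) + n + 2) * recip s ≠ 0 := by
      intro h0; apply hd2; push_cast; linarith
    rw [tailMoment, recip_two_mul]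
    push_cast at hd2 ⊢
    rw [div_eq_div_iff (by convert hd2 using 3; ring) this]
    ring
  have e4 : 2 - ((m : ℝ) + n + 2) * recip s ≠ 0 := by
    intro h0; apply hd2; push_cast; linarith
  rw [e3, tailMoment]
  push_cast at hd hd' ⊢
  generalize recip s = r at *
  generalize (m : ℝ) = a at *
  generalize (n : ℝ) = b at *
  obtain ⟨D, hD⟩ : ∃ D, D = 1 - (a + 1) * r := ⟨_, rfl⟩
  obtain ⟨E, hE⟩ : ∃ E, E = 1 - (b + 1) * r := ⟨_, rfl⟩
  obtain ⟨F, hF⟩ : ∃ F, F = 2 - (a + b + 2) * r := ⟨_, rfl⟩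
  rw [← hD] at hd ⊢
  rw [← hE] at hd' ⊢
  rw [← hF] at e4 ⊢
  split_ifs with hm
  · rw [hm.neg_one_pow]
    field_simp
    rw [hD, hE, hF]
    ring
  · rw [(Nat.not_even_iff_odd.1 hm).neg_one_pow]
    field_simp
    rw [hD, hF]
    ring

lemma val_eq_sum {f : Polynomial ℝ} {N : ℕ} (hf : f.natDegree < N) (z : ℂ) :
    val f z = ∑ k ∈ Finset.range N, (f.coeff k : ℂ) * z ^ k := by
  rw [val, Polynomial.aeval_eq_sum_range' hf]
  simp

lemma natCast_lt_of_lt {N k : ℕ} {s : ℝ≥0∞} (hs : (N : ℝ≥0∞) < s) (h : k < N) :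
    ((k + 1 : ℕ) : ℝ≥0∞) < s :=
  lt_of_le_of_lt (by exact_mod_cast h) hs

lemma realMean_eq_sum {s : ℝ≥0∞} {N : ℕ} (hs : (N : ℝ≥0∞) < s) {f : Polynomial ℝ}
    (hf : f.natDegree < N) :
    realMean s f = ∑ k ∈ Finset.range N, ((f.coeff k * monomialMean (recip s) k : ℝ) : ℂ) := by
  have h : ∀ x : ℝ, (weight s x : ℂ) * val f x = ∑ k ∈ Finset.range N,
      (f.coeff k : ℂ) * ((weight s x * x ^ k : ℝ) : ℂ) := fun x => by
    rw [val_eq_sum hf, mul_sum]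
    refine sum_congr rfl fun k _ => ?_
    push_cast; ring
  simp_rw [realMean, h]
  rw [integral_finsetSum _ fun k hk => ((integrable_weight_mul_pow
    (natCast_lt_of_lt hs (Finset.mem_range.1 hk))).ofReal).const_mul _]
  refine sum_congr rfl fun k hk => ?_
  rw [integral_const_mul, integral_complex_ofReal,
    integral_weight_mul_pow_eq (natCast_lt_of_lt hs (Finset.mem_range.1 hk))]
  push_cast; rfl

lemma realForm_eq_sum {s : ℝ≥0∞} {N : ℕ} (hs : (N : ℝ≥0∞) < s) {f g : Polynomial ℝ}
    (hf : f.natDegree < N) (hg : g.natDegree < N) :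
    realForm s f g = ∑ m ∈ Finset.range N, ∑ n ∈ Finset.range N, (f.coeff m : ℂ) * (g.coeff n : ℂ) *
      ((∫ y : ℝ, weight s y * y ^ n * innerMoment s m y : ℝ) : ℂ) := by
  have hin : ∀ y : ℝ, ∫ x : ℝ, (weight s (x : ℂ) : ℂ) * (weight s (y : ℂ) : ℂ) * val f (x : ℂ) *
      val g (y : ℂ) * (Real.sign (y - x) : ℂ) = ∑ m ∈ Finset.range N, ∑ n ∈ Finset.range N,
        (f.coeff m : ℂ) * (g.coeff n : ℂ) * ((weight s y * y ^ n * innerMoment s m y : ℝ) : ℂ) := by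
    intro y
    have h : ∀ x : ℝ, (weight s (x : ℂ) : ℂ) * (weight s (y : ℂ) : ℂ) * val f (x : ℂ) *
        val g (y : ℂ) * (Real.sign (y - x) : ℂ) = ∑ m ∈ Finset.range N,
        ((f.coeff m : ℂ) * (weight s y * val g y)) *
          ((weight s x * x ^ m * Real.sign (y - x) : ℝ) : ℂ) := fun x => by
      rw [val_eq_sum hf, mul_sum, sum_mul, sum_mul]
      refine sum_congr rfl fun k _ => ?_
      push_cast; ring
    simp_rw [h]
    rw [integral_finsetSum _ fun k hk => ((integrable_weight_mul_pow_mul_sign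
      (natCast_lt_of_lt hs (Finset.mem_range.1 hk)) y).ofReal).const_mul _]
    refine sum_congr rfl fun m _ => ?_
    rw [integral_const_mul, integral_complex_ofReal, val_eq_sum hg, mul_sum, mul_sum, sum_mul]
    refine sum_congr rfl fun n _ => ?_
    rw [innerMoment]
    push_cast; ring
  have hI : ∀ m ∈ Finset.range N, ∀ n ∈ Finset.range N, Integrable fun y : ℝ =>
      (f.coeff m : ℂ) * (g.coeff n : ℂ) * ((weight s y * y ^ n * innerMoment s m y : ℝ) : ℂ) :=
    fun m hm n hn => ((integrable_weight_mul_pow_mul_innerMoment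
      (natCast_lt_of_lt hs (Finset.mem_range.1 hm))
      (natCast_lt_of_lt hs (Finset.mem_range.1 hn))).ofReal).const_mul _
  simp_rw [realForm, hin]
  rw [integral_finsetSum _ fun m hm => integrable_finsetSum _ (hI m hm)]
  refine sum_congr rfl fun m hm => ?_
  rw [integral_finsetSum _ (hI m hm)]
  refine sum_congr rfl fun n hn => ?_
  rw [integral_const_mul, integral_complex_ofReal]

lemma complexForm_eq_sum {s : ℝ≥0∞} {N : ℕ} (hs : (N : ℝ≥0∞) < s) {f g : Polynomial ℝ}
    (hf : f.natDegree < N) (hg : g.natDegree < N) :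
    complexForm s f g = ∑ m ∈ Finset.range N, ∑ n ∈ Finset.range N,
      (f.coeff m : ℂ) * (g.coeff n : ℂ) * (-2 * Complex.I * ∫ z : ℂ,
        (weight (2 * s) z : ℂ) * (starRingEnd ℂ z) ^ m * z ^ n * (Real.sign z.im : ℂ)) := by
  have h : ∀ z : ℂ, (weight (2 * s) z : ℂ) * starRingEnd ℂ (val f z) * val g z *
      (Real.sign z.im : ℂ) = ∑ m ∈ Finset.range N, ∑ n ∈ Finset.range N,
        (f.coeff m : ℂ) * (g.coeff n : ℂ) *
        ((weight (2 * s) z : ℂ) * (starRingEnd ℂ z) ^ m * z ^ n * (Real.sign z.im : ℂ)) := by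
    intro z
    rw [val_eq_sum hf, val_eq_sum hg, map_sum, mul_assoc, mul_assoc, sum_mul, mul_sum]
    refine sum_congr rfl fun m _ => ?_
    rw [sum_mul, mul_sum, mul_sum]
    refine sum_congr rfl fun n _ => ?_
    rw [map_mul, map_pow, Complex.conj_ofReal]
    ring
  have hI : ∀ m ∈ Finset.range N, ∀ n ∈ Finset.range N, Integrable fun z : ℂ =>
      (f.coeff m : ℂ) * (g.coeff n : ℂ) *
        ((weight (2 * s) z : ℂ) * (starRingEnd ℂ z) ^ m * z ^ n * (Real.sign z.im : ℂ)) :=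
    fun m hm n hn => (integrable_complex_monomial (by
      have := add_lt_two_mul (natCast_lt_of_lt hs (Finset.mem_range.1 hm))
        (natCast_lt_of_lt hs (Finset.mem_range.1 hn))
      convert this using 2; ring)).const_mul _
  simp_rw [complexForm, h]
  rw [integral_finsetSum _ fun m hm => integrable_finsetSum _ (hI m hm), mul_sum]
  refine sum_congr rfl fun m hm => ?_
  rw [integral_finsetSum _ (hI m hm), mul_sum]
  refine sum_congr rfl fun n hn => ?_
  rw [integral_const_mul]
  ring

/-- The skew form in terms of coefficients. -/
lemma realForm_add_complexForm {s : ℝ≥0∞} {N : ℕ} (hs : (N : ℝ≥0∞) < s) {f g : Polynomial ℝ}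
    (hf : f.natDegree < N) (hg : g.natDegree < N) :
    realForm s f g + complexForm s f g = ∑ m ∈ Finset.range N, ∑ n ∈ Finset.range N,
      ((f.coeff m * g.coeff n * monomialGram (recip s) m n : ℝ) : ℂ) := by
  rw [realForm_eq_sum hs hf hg, complexForm_eq_sum hs hf hg, ← sum_add_distrib]
  refine sum_congr rfl fun m hm => ?_
  rw [← sum_add_distrib]
  refine sum_congr rfl fun n hn => ?_
  rw [← mul_add, monomialGram_eq (natCast_lt_of_lt hs (Finset.mem_range.1 hm))
    (natCast_lt_of_lt hs (Finset.mem_range.1 hn))]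
  push_cast; rfl

end

section

open Matrix

/-- The coefficients of `p_0, …, p_{N-1}` in the basis of monomials. -/
def coeffMatrix (p : ℕ → Polynomial ℝ) (N : ℕ) : Matrix (Fin N) (Fin N) ℂ :=
  Matrix.of fun m k => ((p m).coeff k : ℂ)

/-- The first `N` members of `p` have exact degrees `0, …, N - 1`. -/
def HasExactDegrees (p : ℕ → Polynomial ℝ) (N : ℕ) : Prop :=
  ∀ n < N, (p n).natDegree ≤ n ∧ (p n).coeff n ≠ 0

lemma det_coeffMatrix_ne_zero {p : ℕ → Polynomial ℝ} {N : ℕ} (hp : HasExactDegrees p N) :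
    (coeffMatrix p N).det ≠ 0 := by
  rw [Matrix.det_of_isLowerTriangular]
  · refine prod_ne_zero_iff.2 fun i _ => ?_
    simpa [coeffMatrix] using (hp i i.2).2
  · intro i j hij
    have : (i : ℕ) < j := hij
    simp [coeffMatrix, Polynomial.coeff_eq_zero_of_natDegree_lt ((hp i i.2).1.trans_lt this)]

/-- The Gram matrix of the monomials. -/
def monomialGramMatrix (r : ℝ) (N : ℕ) : Matrix (Fin N) (Fin N) ℂ :=
  Matrix.of fun m n => (monomialGram r m n : ℂ)

/-- The column of weighted integrals of the monomials. -/
def monomialMeanMatrix (r : ℝ) (N : ℕ) : Matrix (Fin N) Unit ℂ :=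
  Matrix.of fun m _ => (monomialMean r m : ℂ)

lemma skewGram_eq {s : ℝ≥0∞} {p : ℕ → Polynomial ℝ} {N : ℕ} (hs : (N : ℝ≥0∞) < s)
    (hp : HasExactDegrees p N) :
    skewGram s p N = coeffMatrix p N * monomialGramMatrix (recip s) N * (coeffMatrix p N)ᵀ := by
  ext m n
  simp only [skewGram, Matrix.of_apply]
  rw [realForm_add_complexForm hs ((hp m m.2).1.trans_lt m.2) ((hp n n.2).1.trans_lt n.2),
    ← Fin.sum_univ_eq_sum_range (fun a => ∑ b ∈ range N,
      (((p m).coeff a * (p n).coeff b * monomialGram (recip s) a b : ℝ) : ℂ)), Matrix.mul_apply]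
  simp_rw [Matrix.mul_apply, sum_mul]
  conv_rhs => rw [sum_comm]
  refine sum_congr rfl fun a _ => ?_
  rw [← Fin.sum_univ_eq_sum_range (fun b =>
      (((p m).coeff a * (p n).coeff b * monomialGram (recip s) a b : ℝ) : ℂ)) N]
  refine sum_congr rfl fun b _ => ?_
  simp only [coeffMatrix, monomialGramMatrix, Matrix.of_apply, Matrix.transpose_apply]
  push_cast; ring

lemma realMean_matrix_eq {s : ℝ≥0∞} {p : ℕ → Polynomial ℝ} {N : ℕ} (hs : (N : ℝ≥0∞) < s)
    (hp : HasExactDegrees p N) :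
    (Matrix.of fun (m : Fin N) (_ : Unit) => realMean s (p m)) =
      coeffMatrix p N * monomialMeanMatrix (recip s) N := by
  ext m i
  simp only [Matrix.of_apply]
  rw [realMean_eq_sum hs ((hp m m.2).1.trans_lt m.2), Matrix.mul_apply,
    ← Fin.sum_univ_eq_sum_range (fun k => (((p m).coeff k * monomialMean (recip s) k : ℝ) : ℂ))]
  refine sum_congr rfl fun b _ => ?_
  simp [coeffMatrix, monomialMeanMatrix]

/-- The kernel coefficients in the basis of monomials. -/
def monomialKernelCoeff (r : ℝ) (N : ℕ) : Matrix (Fin N) (Fin N) ℂ :=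
  if Even N then (monomialGramMatrix r N)⁻¹
  else ((Matrix.fromBlocks (monomialGramMatrix r N) (monomialMeanMatrix r N)
    (-(monomialMeanMatrix r N)ᵀ) 0)⁻¹).toBlocks₁₁

lemma kernelCoeff_eq {s : ℝ≥0∞} {p : ℕ → Polynomial ℝ} {N : ℕ} (hs : (N : ℝ≥0∞) < s)
    (hp : HasExactDegrees p N) :
    kernelCoeff s p N = (coeffMatrix p N)ᵀ⁻¹ * monomialKernelCoeff (recip s) N *
      (coeffMatrix p N)⁻¹ := by
  unfold kernelCoeff monomialKernelCoeff
  have hdet : IsUnit (coeffMatrix p N).det := (det_coeffMatrix_ne_zero hp).isUnit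
  split_ifs with hN
  · rw [skewGram_eq hs hp, Matrix.mul_inv_rev, Matrix.mul_inv_rev, Matrix.mul_assoc]
  · set P := coeffMatrix p N
    set U := monomialGramMatrix (recip s) N
    set b := monomialMeanMatrix (recip s) N
    have h1 : borderedGram s p N = Matrix.fromBlocks P 0 0 1 *
        Matrix.fromBlocks U b (-bᵀ) 0 * Matrix.fromBlocks Pᵀ 0 0 (1 : Matrix Unit Unit ℂ) := by
      have h2 : (Matrix.of fun (_ : Unit) (n : Fin N) => -realMean s (p n)) = -(P * b)ᵀ := by
        rw [← realMean_matrix_eq hs hp]; rfl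
      rw [borderedGram, realMean_matrix_eq hs hp, skewGram_eq hs hp, h2, Matrix.fromBlocks_multiply,
        Matrix.fromBlocks_multiply]
      simp [P, U, b, Matrix.transpose_mul]
    have h2 : (Matrix.fromBlocks P 0 0 (1 : Matrix Unit Unit ℂ))⁻¹ = Matrix.fromBlocks P⁻¹ 0 0 1 :=
      Matrix.inv_eq_right_inv (by
        rw [Matrix.fromBlocks_multiply]; simp [Matrix.mul_nonsing_inv _ hdet])
    have h3 : (Matrix.fromBlocks Pᵀ 0 0 (1 : Matrix Unit Unit ℂ))⁻¹ =
        Matrix.fromBlocks Pᵀ⁻¹ 0 0 1 :=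
      Matrix.inv_eq_right_inv (by
        rw [Matrix.fromBlocks_multiply]
        simp [Matrix.mul_nonsing_inv _ (Matrix.isUnit_det_transpose P hdet)])
    rw [h1, Matrix.mul_inv_rev, Matrix.mul_inv_rev, h2, h3]
    generalize (Matrix.fromBlocks U b (-bᵀ) 0)⁻¹ = X
    rw [← Matrix.fromBlocks_toBlocks X, Matrix.fromBlocks_multiply, Matrix.fromBlocks_multiply]
    simp [Matrix.mul_assoc]

lemma val_family_eq {p : ℕ → Polynomial ℝ} {N : ℕ} (hp : HasExactDegrees p N) (u : ℂ) :
    (fun m : Fin N => val (p m) u) = coeffMatrix p N *ᵥ fun k : Fin N => u ^ (k : ℕ) := by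
  ext m
  rw [val_eq_sum ((hp m m.2).1.trans_lt m.2),
    ← Fin.sum_univ_eq_sum_range (fun k => ((p m).coeff k : ℂ) * u ^ k)]
  rfl

/-- The polynomial kernel does not depend on the choice of the polynomials. -/
lemma polyKernel_eq_monomial {s : ℝ≥0∞} {p : ℕ → Polynomial ℝ} {N : ℕ} (hs : (N : ℝ≥0∞) < s)
    (hp : HasExactDegrees p N) (u v : ℂ) :
    polyKernel s p N u v = -2 * ((fun k : Fin N => u ^ (k : ℕ)) ⬝ᵥ
      (monomialKernelCoeff (recip s) N *ᵥ fun k : Fin N => v ^ (k : ℕ))) := by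
  have hdet : IsUnit (coeffMatrix p N).det := (det_coeffMatrix_ne_zero hp).isUnit
  have h : polyKernel s p N u v = -2 * ((fun m : Fin N => val (p m) u) ⬝ᵥ
      (kernelCoeff s p N *ᵥ fun m : Fin N => val (p m) v)) := by
    simp only [polyKernel, dotProduct, mulVec, mul_sum]
    refine sum_congr rfl fun m _ => sum_congr rfl fun n _ => ?_
    ring
  rw [h, val_family_eq hp, val_family_eq hp, kernelCoeff_eq hs hp, Matrix.mulVec_mulVec,
    Matrix.mul_assoc, Matrix.nonsing_inv_mul _ hdet, Matrix.mul_one, ← Matrix.mulVec_mulVec,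
    dotProduct_mulVec, ← Matrix.transpose_nonsing_inv, Matrix.vecMul_transpose,
    Matrix.mulVec_mulVec, Matrix.nonsing_inv_mul _ hdet, Matrix.one_mulVec]

lemma polyKernel_congr {s : ℝ≥0∞} {p q : ℕ → Polynomial ℝ} {N : ℕ} (hs : (N : ℝ≥0∞) < s)
    (hp : HasExactDegrees p N) (hq : HasExactDegrees q N) (u v : ℂ) :
    polyKernel s p N u v = polyKernel s q N u v := by
  rw [polyKernel_eq_monomial hs hp, polyKernel_eq_monomial hs hq]

lemma hasExactDegrees_of_monic {p : ℕ → Polynomial ℝ}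
    (hp : ∀ n : ℕ, (p n).Monic ∧ (p n).natDegree = n) (N : ℕ) : HasExactDegrees p N := fun n _ => by
  refine ⟨(hp n).2.le, ?_⟩
  have := (hp n).1.coeff_natDegree
  rw [(hp n).2] at this
  simp [this]

lemma sum_range_two_mul {A : Type*} [AddCommMonoid A] (f : ℕ → A) (J : ℕ) :
    ∑ k ∈ range (2 * J), f k = ∑ n ∈ range J, (f (2 * n) + f (2 * n + 1)) := by
  induction J with
  | zero => simp
  | succ J ih =>
    rw [show 2 * (J + 1) = 2 * J + 1 + 1 by ring, sum_range_succ, sum_range_succ, ih,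
      sum_range_succ, add_assoc]

lemma sum_range_two_mul_add_one {A : Type*} [AddCommMonoid A] (f : ℕ → A) (J : ℕ) :
    ∑ k ∈ range (2 * J + 1), f k = f 0 + ∑ n ∈ range J, (f (2 * n + 1) + f (2 * n + 2)) := by
  rw [sum_range_succ', sum_range_two_mul (fun k => f (k + 1)), add_comm]

lemma polyKernel_of_even {s : ℝ≥0∞} {q : ℕ → Polynomial ℝ} {J : ℕ} (S : ℕ → ℕ → ℂ)
    (hS : ∀ m n : Fin (2 * J), skewGram s q (2 * J) m n = S m n)
    (h00 : ∀ m n, S (2 * m) (2 * n) = 0) (h01 : ∀ m n, S (2 * m) (2 * n + 1) = if m = n then 4 else 0)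
    (h10 : ∀ m n, S (2 * m + 1) (2 * n) = if m = n then -4 else 0)
    (h11 : ∀ m n, S (2 * m + 1) (2 * n + 1) = 0) (u v : ℂ) :
    polyKernel s q (2 * J) u v = 1 / 2 * ∑ n ∈ range J,
      (val (q (2 * n)) u * val (q (2 * n + 1)) v - val (q (2 * n + 1)) u * val (q (2 * n)) v) := by
  have hinv : kernelCoeff s q (2 * J) = Matrix.of fun m n : Fin (2 * J) => -(S m n) / 16 := by
    rw [kernelCoeff, if_pos (even_two_mul J)]
    apply Matrix.inv_eq_right_inv
    ext ⟨m, hm⟩ ⟨n, hn⟩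
    rw [Matrix.mul_apply]
    simp only [hS, Matrix.of_apply]
    rw [Fin.sum_univ_eq_sum_range (fun k => S m k * (-S k n / 16)), sum_range_two_mul]
    simp only [Matrix.one_apply, Fin.mk.injEq]
    obtain ⟨m', rfl | rfl⟩ := m.even_or_odd' <;> obtain ⟨n', rfl | rfl⟩ := n.even_or_odd'
    · have hm' : m' < J := by omega
      simp only [h00, h01, h10, zero_mul, zero_add, ite_mul, sum_ite_eq, mem_range, hm', if_true]
      rcases eq_or_ne m' n' with h | h
      · subst h; norm_num
      · rw [if_neg h, if_neg (by omega)]; norm_num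
    · rw [if_neg (by omega)]
      simp [h00, h11]
    · rw [if_neg (by omega)]
      simp [h00, h11]
    · have hm' : m' < J := by omega
      simp only [h11, h01, h10, zero_mul, add_zero, ite_mul, sum_ite_eq, mem_range, hm', if_true]
      rcases eq_or_ne m' n' with h | h
      · subst h; norm_num
      · rw [if_neg h, if_neg (by omega)]; norm_num
  rw [polyKernel, hinv]
  simp only [Matrix.of_apply]
  rw [Finset.sum_congr rfl fun (m : Fin (2 * J)) _ => Fin.sum_univ_eq_sum_range
    (fun n => -S m n / 16 * val (q m) u * val (q n) v) (2 * J)]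
  rw [Fin.sum_univ_eq_sum_range (fun m => ∑ n ∈ range (2 * J), -S m n / 16 * val (q m) u * val (q n) v),
    sum_range_two_mul, mul_sum, mul_sum]
  refine sum_congr rfl fun m hm => ?_
  rw [sum_range_two_mul, sum_range_two_mul]
  simp only [h00, h01, h10, h11, neg_zero, zero_div, zero_mul, zero_add, add_zero]
  rw [sum_eq_single m, sum_eq_single m]
  · simp; ring
  · intro b _ hb; simp [hb.symm]
  · intro h; exact absurd hm h
  · intro b _ hb; simp [hb.symm]
  · intro h; exact absurd hm h

lemma polyKernel_of_odd {s : ℝ≥0∞} {q : ℕ → Polynomial ℝ} {J : ℕ} (S : ℕ → ℕ → ℂ) (b : ℕ → ℂ)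
    (hS : ∀ m n : Fin (2 * J + 1), skewGram s q (2 * J + 1) m n = S m n)
    (hb : ∀ m : Fin (2 * J + 1), realMean s (q m) = b m) (hb0 : b 0 ≠ 0) (hb1 : ∀ n, b (n + 1) = 0)
    (hz : S 0 0 = 0) (hz1 : ∀ n, S 0 (2 * n + 1) = -S (2 * n + 1) 0)
    (hz2 : ∀ n, S 0 (2 * n + 2) = 0) (hz3 : ∀ n, S (2 * n + 2) 0 = 0)
    (h00 : ∀ m n, S (2 * m + 1) (2 * n + 1) = 0)
    (h01 : ∀ m n, S (2 * m + 1) (2 * n + 2) = if m = n then 4 else 0)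
    (h10 : ∀ m n, S (2 * m + 2) (2 * n + 1) = if m = n then -4 else 0)
    (h11 : ∀ m n, S (2 * m + 2) (2 * n + 2) = 0) (u v : ℂ) :
    polyKernel s q (2 * J + 1) u v = 1 / 2 * ∑ n ∈ range J,
      (val (q (2 * n + 1)) u * val (q (2 * n + 2)) v -
        val (q (2 * n + 2)) u * val (q (2 * n + 1)) v) := by
  obtain ⟨X, hX⟩ : ∃ X : ℕ → ℕ → ℂ, X = fun m n => if m = 0 ∨ n = 0 then 0 else -(S m n) / 16 :=
    ⟨_, rfl⟩
  obtain ⟨x, hx⟩ : ∃ x : ℕ → ℂ, x = fun n => if n = 0 then 1 / b 0 else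
      if Even n then -S (n - 1) 0 / (4 * b 0) else 0 := ⟨_, rfl⟩
  have X0 : ∀ n, X 0 n = 0 := by simp [hX]
  have X0' : ∀ n, X n 0 = 0 := by simp [hX]
  have X00 : ∀ m n, X (2 * m + 1) (2 * n + 1) = 0 := by simp [hX, h00]
  have X01 : ∀ m n, X (2 * m + 1) (2 * n + 2) = if m = n then -1 / 4 else 0 := fun m n => by
    simp only [hX, h01]; split_ifs <;> simp_all; norm_num
  have X10 : ∀ m n, X (2 * m + 2) (2 * n + 1) = if m = n then 1 / 4 else 0 := fun m n => by
    simp only [hX, h10]; split_ifs <;> simp_all; norm_num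
  have X11 : ∀ m n, X (2 * m + 2) (2 * n + 2) = 0 := by simp [hX, h11]
  have x0 : x 0 = 1 / b 0 := by simp [hx]
  have x1 : ∀ n, x (2 * n + 1) = 0 := fun n => by simp [hx]
  have x2 : ∀ n, x (2 * n + 2) = -S (2 * n + 1) 0 / (4 * b 0) := fun n => by
    simp [hx, show Even (2 * n + 2) from ⟨n + 1, by ring⟩]
  have hinv : kernelCoeff s q (2 * J + 1) = Matrix.of fun m n : Fin (2 * J + 1) => X m n := by
    have hno : ¬ Even (2 * J + 1) := by simp
    rw [kernelCoeff, if_neg hno]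
    have : (borderedGram s q (2 * J + 1))⁻¹ = Matrix.fromBlocks
        (Matrix.of fun m n : Fin (2 * J + 1) => X m n)
        (Matrix.of fun (m : Fin (2 * J + 1)) (_ : Unit) => -x m)
        (Matrix.of fun (_ : Unit) (n : Fin (2 * J + 1)) => x n) 0 := by
      apply Matrix.inv_eq_right_inv
      rw [borderedGram, Matrix.fromBlocks_multiply, ← Matrix.fromBlocks_one]
      congr 1
      · ext ⟨m, hm⟩ ⟨n, hn⟩
        rw [Matrix.add_apply, Matrix.mul_apply, Matrix.mul_apply]
        simp only [hS, hb, Matrix.of_apply, univ_unique, sum_singleton, Matrix.one_apply,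
          Fin.mk.injEq]
        rw [Fin.sum_univ_eq_sum_range (fun k => S m k * X k n), sum_range_two_mul_add_one]
        simp only [X0, mul_zero, zero_add]
        rcases Nat.eq_zero_or_pos m with rfl | hm0
        · simp only [hz1, hz2, zero_mul, add_zero]
          rcases Nat.eq_zero_or_pos n with rfl | hn0
          · simp [X0', x0, hb0]
          · obtain ⟨n', rfl | rfl⟩ : ∃ n', n = 2 * n' + 1 ∨ n = 2 * n' + 2 :=
              ⟨(n - 1) / 2, by omega⟩
            · simp [X00, x1]
            · have hn' : n' < J := by omega
              simp only [X01, x2, mul_ite, mul_zero, sum_ite_eq', mem_range, hn', if_true]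
              rw [if_neg (by omega)]
              field_simp; ring
        · obtain ⟨m', rfl | rfl⟩ : ∃ m', m = 2 * m' + 1 ∨ m = 2 * m' + 2 :=
              ⟨(m - 1) / 2, by omega⟩
          · have hm' : m' < J := by omega
            simp only [h00, h01, zero_mul, zero_add, ite_mul, sum_ite_eq, mem_range, hm', if_true, hb1]
            rcases Nat.eq_zero_or_pos n with rfl | hn0
            · simp [X0']
            · obtain ⟨n', rfl | rfl⟩ : ∃ n', n = 2 * n' + 1 ∨ n = 2 * n' + 2 :=
                ⟨(n - 1) / 2, by omega⟩
              · rw [X10]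
                rcases eq_or_ne m' n' with h | h
                · subst h; norm_num
                · rw [if_neg h, if_neg (by omega)]; norm_num
              · rw [X11, if_neg (by omega)]; norm_num
          · have hm' : m' < J := by omega
            have hbm : b (2 * m' + 2) = 0 := hb1 (2 * m' + 1)
            simp only [h11, h10, zero_mul, add_zero, ite_mul, sum_ite_eq, mem_range, hm', if_true, hbm]
            rcases Nat.eq_zero_or_pos n with rfl | hn0
            · simp [X0']
            · obtain ⟨n', rfl | rfl⟩ : ∃ n', n = 2 * n' + 1 ∨ n = 2 * n' + 2 :=
                ⟨(n - 1) / 2, by omega⟩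
              · rw [X00, if_neg (by omega)]; norm_num
              · rw [X01]
                rcases eq_or_ne m' n' with h | h
                · subst h; norm_num
                · rw [if_neg h, if_neg (by omega)]; norm_num
      · ext ⟨m, hm⟩ i
        rw [Matrix.add_apply, Matrix.mul_apply]
        simp only [hS, Matrix.of_apply, Matrix.mul_zero, Matrix.zero_apply, add_zero]
        rw [Fin.sum_univ_eq_sum_range (fun k => S m k * -x k), sum_range_two_mul_add_one]
        simp only [x0, x1, x2, neg_zero, mul_zero, zero_add]
        rcases Nat.eq_zero_or_pos m with rfl | hm0
        · simp [hz, hz2]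
        · obtain ⟨m', rfl | rfl⟩ : ∃ m', m = 2 * m' + 1 ∨ m = 2 * m' + 2 :=
              ⟨(m - 1) / 2, by omega⟩
          · have hm' : m' < J := by omega
            simp only [h01, ite_mul, zero_mul, sum_ite_eq, mem_range, hm', if_true]
            field_simp; ring
          · simp [hz3, h11]
      · ext i ⟨n, hn⟩
        rw [Matrix.add_apply, Matrix.mul_apply]
        simp only [hb, Matrix.of_apply, Matrix.zero_mul, Matrix.zero_apply, add_zero]
        rw [Fin.sum_univ_eq_sum_range (fun k => -b k * X k n), sum_range_succ']
        simp [hb1, X0]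
      · ext i j
        rw [Matrix.add_apply, Matrix.mul_apply]
        simp only [hb, Matrix.of_apply, Matrix.zero_mul, Matrix.zero_apply, add_zero]
        rw [Fin.sum_univ_eq_sum_range (fun k => -b k * -x k), sum_range_succ']
        simp [hb1, x0, hb0]
    rw [this, Matrix.toBlocks_fromBlocks₁₁]
  rw [polyKernel, hinv]
  simp only [Matrix.of_apply]
  rw [Finset.sum_congr rfl fun (m : Fin (2 * J + 1)) _ => Fin.sum_univ_eq_sum_range
    (fun n => X m n * val (q m) u * val (q n) v) (2 * J + 1)]
  rw [Fin.sum_univ_eq_sum_range (fun m => ∑ n ∈ range (2 * J + 1), X m n * val (q m) u * val (q n) v),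
    sum_range_two_mul_add_one]
  simp only [X0, zero_mul, sum_const_zero, zero_add]
  rw [mul_sum, mul_sum]
  refine sum_congr rfl fun m hm => ?_
  rw [sum_range_two_mul_add_one, sum_range_two_mul_add_one]
  simp only [X0', X00, X01, X10, X11, zero_mul, zero_add, add_zero]
  rw [sum_eq_single m, sum_eq_single m]
  · simp; ring
  · intro b _ hb; simp [hb.symm]
  · intro h; exact absurd hm h
  · intro b _ hb; simp [hb.symm]
  · intro h; exact absurd hm h

end

open Polynomial in
/-- The skew-orthogonal polynomials whose degrees have the parity of `ε`. -/
def skewPolyG (ε n : ℕ) : Polynomial ℝ :=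
  ∑ ij ∈ antidiagonal n,
    monomial (2 * ij.1 + ε) (negBinom (3 / 2) ij.1 * negBinom (1 / 2) ij.2)

open Polynomial in
/-- The skew-orthogonal polynomials whose degrees have the parity opposite to that of `ε`. -/
def skewPolyF (r : ℝ) (ε n : ℕ) : Polynomial ℝ :=
  ∑ ij ∈ antidiagonal (n + ε), monomial (2 * ij.1 + (1 - ε))
    ((1 - ((2 * ij.1 + (1 - ε) + 1 : ℕ) : ℝ) * r) *
      (negBinom (3 / 2) ij.1 * negBinom (-1 / 2) ij.2))

lemma natDegree_sum_antidiagonal_monomial_le (n δ : ℕ) (a : ℕ × ℕ → ℝ) :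
    (∑ ij ∈ antidiagonal n, Polynomial.monomial (2 * ij.1 + δ) (a ij)).natDegree ≤ 2 * n + δ := by
  refine Polynomial.natDegree_sum_le_of_forall_le _ _ fun ij hij => ?_
  have := mem_antidiagonal.1 hij
  exact (Polynomial.natDegree_monomial_le _).trans (by omega)

lemma coeff_sum_antidiagonal_monomial (n δ : ℕ) (a : ℕ × ℕ → ℝ) :
    (∑ ij ∈ antidiagonal n, Polynomial.monomial (2 * ij.1 + δ) (a ij)).coeff (2 * n + δ) =
      a (n, 0) := by
  rw [Polynomial.finsetSum_coeff, sum_eq_single (n, 0)]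
  · simp
  · rintro ⟨i, j⟩ hij hne
    have := mem_antidiagonal.1 hij
    simp only at this
    rw [Polynomial.coeff_monomial, if_neg]
    intro h
    exact hne (by ext <;> simp <;> omega)
  · intro h; simp at h

/-- The skew form of two polynomials of degree less than `N`, in terms of their coefficients. -/
def gramForm (r : ℝ) (N : ℕ) (f g : Polynomial ℝ) : ℝ :=
  ∑ m ∈ range N, ∑ n ∈ range N, f.coeff m * g.coeff n * monomialGram r m n

lemma skewGram_apply {s : ℝ≥0∞} {q : ℕ → Polynomial ℝ} {N : ℕ} (hs : (N : ℝ≥0∞) < s)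
    (hq : HasExactDegrees q N) (m n : Fin N) :
    skewGram s q N m n = (gramForm (recip s) N (q m) (q n) : ℂ) := by
  rw [skewGram, Matrix.of_apply, realForm_add_complexForm hs ((hq m m.2).1.trans_lt m.2)
    ((hq n n.2).1.trans_lt n.2), gramForm]
  push_cast; rfl

lemma sum_range_coeff_mul {ι : Type*} (T : Finset ι) (d : ι → ℕ) (a : ι → ℝ) {N : ℕ}
    (hd : ∀ i ∈ T, d i < N) (w : ℕ → ℝ) :
    ∑ m ∈ range N, (∑ i ∈ T, Polynomial.monomial (d i) (a i)).coeff m * w m =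
      ∑ i ∈ T, a i * w (d i) := by
  simp_rw [Polynomial.finsetSum_coeff, sum_mul]
  rw [sum_comm]
  refine sum_congr rfl fun i hi => ?_
  simp [Polynomial.coeff_monomial, hd i hi]

lemma gramForm_sum_monomial {ι κ : Type*} (r : ℝ) {N : ℕ} (T : Finset ι) (d : ι → ℕ) (a : ι → ℝ)
    (T' : Finset κ) (d' : κ → ℕ) (a' : κ → ℝ) (hd : ∀ i ∈ T, d i < N) (hd' : ∀ i ∈ T', d' i < N) :
    gramForm r N (∑ i ∈ T, Polynomial.monomial (d i) (a i))
      (∑ i ∈ T', Polynomial.monomial (d' i) (a' i)) =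
      ∑ i ∈ T, ∑ j ∈ T', a i * a' j * monomialGram r (d i) (d' j) := by
  rw [gramForm]
  simp_rw [mul_assoc, ← mul_sum]
  rw [sum_range_coeff_mul T d a hd (fun m => ∑ n ∈ range N,
    (∑ i ∈ T', Polynomial.monomial (d' i) (a' i)).coeff n * monomialGram r m n)]
  refine sum_congr rfl fun i _ => ?_
  rw [sum_range_coeff_mul T' d' a' hd' (fun n => monomialGram r (d i) n)]

lemma monomialGram_swap (r : ℝ) (m n : ℕ) : monomialGram r n m = -monomialGram r m n := by
  unfold monomialGram
  rw [add_comm n m]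
  split_ifs with h1 h2 h3 h3
  · simp
  · exact absurd (h3.add h2) h1
  · rw [← neg_sub (n : ℝ) m, mul_neg, div_neg]
  · rw [← neg_sub (n : ℝ) m, mul_neg, div_neg]
  · exact absurd ((Nat.not_even_iff_odd.1 h3).add_odd (Nat.not_even_iff_odd.1 h2)) h1

lemma gramForm_swap (r : ℝ) (N : ℕ) (f g : Polynomial ℝ) : gramForm r N g f = -gramForm r N f g := by
  rw [gramForm, sum_comm, gramForm, ← sum_neg_distrib]
  refine sum_congr rfl fun m _ => ?_
  rw [← sum_neg_distrib]
  refine sum_congr rfl fun n _ => ?_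
  rw [monomialGram_swap]; ring

lemma monomialGram_of_even {r : ℝ} {m n : ℕ} (h : Even (m + n)) : monomialGram r m n = 0 :=
  if_pos h

lemma gramForm_eq_zero_of_parity (r : ℝ) {N n n' δ : ℕ} (a a' : ℕ × ℕ → ℝ)
    (h : 2 * n + δ < N) (h' : 2 * n' + δ < N) :
    gramForm r N (∑ ij ∈ antidiagonal n, Polynomial.monomial (2 * ij.1 + δ) (a ij))
      (∑ ij ∈ antidiagonal n', Polynomial.monomial (2 * ij.1 + δ) (a' ij)) = 0 := by
  rw [gramForm_sum_monomial]
  · refine sum_eq_zero fun i _ => sum_eq_zero fun j _ => ?_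
    rw [monomialGram_of_even ⟨i.1 + j.1 + δ, by ring⟩, mul_zero]
  · intro i hi; have := mem_antidiagonal.1 hi; omega
  · intro i hi; have := mem_antidiagonal.1 hi; omega

lemma gramForm_skewPoly_zero {r : ℝ} {N : ℕ} (hr : ∀ k : ℕ, k ≤ N → 0 < 1 - (k : ℝ) * r) {m n : ℕ}
    (hm : 2 * m + 1 < N) (hn : 2 * n < N) :
    gramForm r N (skewPolyG 0 n) (skewPolyF r 0 m) = if n = m then 4 else 0 := by
  have key : gramForm r N (skewPolyG 0 n) (skewPolyF r 0 m) =
      ∑ ij ∈ antidiagonal n, ∑ kl ∈ antidiagonal m, 2 * (negBinom (1 / 2) ij.1 *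
        negBinom (1 / 2) ij.2 * (negBinom (3 / 2) kl.1 * negBinom (-1 / 2) kl.2)) /
          ((kl.1 : ℝ) + 1 / 2 - ij.1) := by
    rw [skewPolyG, skewPolyF, gramForm_sum_monomial]
    · refine sum_congr rfl fun i hi => sum_congr rfl fun k hk => ?_
      have hkm := mem_antidiagonal.1 hk
      have h1 := (hr (2 * k.1 + 1 + 1) (by omega)).ne'
      have h2 : (2 * (i.1 : ℝ) + 1) ≠ 0 := by positivity
      have h3 : (k.1 : ℝ) + 1 / 2 - i.1 ≠ 0 := sub_ne_zero.2 (half_ne_natCast _ _)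
      have h4 : 2 * (k.1 : ℝ) + 1 - 2 * i.1 ≠ 0 := by
        intro h; apply h3; linarith
      rw [monomialGram, if_neg (by simp [parity_simps]), if_pos (by simp),
        negBinom_three_halves i.1]
      simp only [tsub_zero, add_zero]
      push_cast at h1 ⊢
      obtain ⟨D, hD⟩ : ∃ D, D = 1 - (2 * (k.1 : ℝ) + 1 + 1) * r := ⟨_, rfl⟩
      obtain ⟨E, hE⟩ : ∃ E, E = (k.1 : ℝ) + 1 / 2 - i.1 := ⟨_, rfl⟩
      have hE' : 2 * (k.1 : ℝ) + 1 - 2 * i.1 = 2 * E := by rw [hE]; ring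
      rw [hE', ← hD, ← hE]
      rw [← hD] at h1
      rw [← hE] at h3
      field_simp
      ring
    · intro i hi; have := mem_antidiagonal.1 hi; omega
    · intro i hi; have := mem_antidiagonal.1 hi; omega
  have hleft : gramForm r N (skewPolyG 0 n) (skewPolyF r 0 m) =
      ∑ kl ∈ antidiagonal m, 2 * (negBinom (3 / 2) kl.1 * negBinom (-1 / 2) kl.2) *
        cauchySum (1 / 2) (1 / 2) n (kl.1 + 1 / 2) := by
    rw [key, sum_comm]
    refine sum_congr rfl fun k _ => ?_
    rw [cauchySum, mul_sum]
    refine sum_congr rfl fun i _ => ?_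
    ring
  rcases lt_trichotomy n m with h | h | h
  · rw [key, if_neg h.ne]
    refine sum_eq_zero fun i hi => ?_
    have hi' := mem_antidiagonal.1 hi
    have : ∀ k ∈ antidiagonal m, 2 * (negBinom (1 / 2) i.1 *
        negBinom (1 / 2) i.2 * (negBinom (3 / 2) k.1 * negBinom (-1 / 2) k.2)) /
          ((k.1 : ℝ) + 1 / 2 - i.1) = -2 * (negBinom (1 / 2) i.1 * negBinom (1 / 2) i.2) *
          (negBinom (3 / 2) k.1 * negBinom (-1 / 2) k.2 / ((i.1 : ℝ) - 1 / 2 - k.1)) := by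
      intro k _
      rw [show (k.1 : ℝ) + 1 / 2 - i.1 = -((i.1 : ℝ) - 1 / 2 - k.1) by ring, div_neg]
      ring
    rw [sum_congr rfl this, ← mul_sum]
    have h0 := cauchySum_three_halves_neg_half_eq_zero (n := m) (i := i.1) (by omega)
    rw [cauchySum] at h0
    rw [h0, mul_zero]
  · subst h
    rw [hleft, if_pos rfl, sum_eq_single (n, 0)]
    · have := cauchySum_half_half_self n
      simp only [negBinom_zero]
      linear_combination 2 * this
    · rintro ⟨i, j⟩ hij hne
      have hij' : i + j = n := mem_antidiagonal.1 hij
      have : i < n := by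
        rcases Nat.eq_zero_or_pos j with rfl | hj
        · exact absurd (by ext <;> simp; omega) hne
        · omega
      rw [cauchySum_half_half_eq_zero this, mul_zero]
    · intro h; simp at h
  · rw [hleft, if_neg h.ne']
    refine sum_eq_zero fun k hk => ?_
    have hk' := mem_antidiagonal.1 hk
    rw [cauchySum_half_half_eq_zero (by omega), mul_zero]

lemma sum_antidiagonal_half_neg_half (m : ℕ) :
    ∑ kl ∈ antidiagonal (m + 1), negBinom (1 / 2) kl.1 * negBinom (-1 / 2) kl.2 = 0 := by
  rw [sum_antidiagonal_negBinom]; norm_num [negBinom_zero_left]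

lemma gramForm_skewPoly_one {r : ℝ} {N : ℕ} (hr : ∀ k : ℕ, k ≤ N → 0 < 1 - (k : ℝ) * r) {m n : ℕ}
    (hm : 2 * m + 2 < N) (hn : 2 * n + 1 < N) :
    gramForm r N (skewPolyG 1 n) (skewPolyF r 1 m) = if n = m then 4 else 0 := by
  have key : gramForm r N (skewPolyG 1 n) (skewPolyF r 1 m) =
      ∑ ij ∈ antidiagonal n, ∑ kl ∈ antidiagonal (m + 1), 2 * (negBinom (3 / 2) ij.1 *
        negBinom (1 / 2) ij.2 * (negBinom (1 / 2) kl.1 * negBinom (-1 / 2) kl.2)) /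
          ((kl.1 : ℝ) - 1 / 2 - ij.1) := by
    rw [skewPolyG, skewPolyF, gramForm_sum_monomial]
    · refine sum_congr rfl fun i hi => ?_
      have him := mem_antidiagonal.1 hi
      have h1 := (hr (2 * i.1 + 1 + 1) (by omega)).ne'
      have e : ∑ kl ∈ antidiagonal (m + 1), 2 * (negBinom (3 / 2) i.1 *
        negBinom (1 / 2) i.2 * (negBinom (1 / 2) kl.1 * negBinom (-1 / 2) kl.2)) /
          ((kl.1 : ℝ) - 1 / 2 - i.1) = ∑ kl ∈ antidiagonal (m + 1), (2 * (negBinom (3 / 2) i.1 *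
        negBinom (1 / 2) i.2 * (negBinom (1 / 2) kl.1 * negBinom (-1 / 2) kl.2)) /
          ((kl.1 : ℝ) - 1 / 2 - i.1) - 4 * r / (1 - ((2 * i.1 + 1 + 1 : ℕ) : ℝ) * r) *
          (negBinom (3 / 2) i.1 * negBinom (1 / 2) i.2) *
            (negBinom (1 / 2) kl.1 * negBinom (-1 / 2) kl.2)) := by
        rw [sum_sub_distrib, ← mul_sum, sum_antidiagonal_half_neg_half, mul_zero, sub_zero]
      rw [e]
      refine sum_congr rfl fun k hk => ?_
      have h2 : (2 * (k.1 : ℝ) + 1) ≠ 0 := by positivity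
      have h3 : (k.1 : ℝ) - 1 / 2 - i.1 ≠ 0 := sub_ne_zero.2 (half_ne_natCast' _ _)
      rw [monomialGram, if_neg (by simp [parity_simps]), if_neg (by simp),
        negBinom_three_halves k.1]
      simp only [tsub_self, add_zero]
      push_cast at h1 ⊢
      obtain ⟨D, hD⟩ : ∃ D, D = 1 - (2 * (i.1 : ℝ) + 1 + 1) * r := ⟨_, rfl⟩
      obtain ⟨E, hE⟩ : ∃ E, E = (k.1 : ℝ) - 1 / 2 - i.1 := ⟨_, rfl⟩
      have hE' : 2 * (k.1 : ℝ) - (2 * i.1 + 1) = 2 * E := by rw [hE]; ring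
      have hk1 : 1 - (2 * (k.1 : ℝ) + 1) * r = D - 2 * E * r := by rw [hE, hD]; ring
      rw [hE', hk1, ← hD, ← hE]
      rw [← hD] at h1
      rw [← hE] at h3
      field_simp
      ring
    · intro i hi; have := mem_antidiagonal.1 hi; omega
    · intro i hi; have := mem_antidiagonal.1 hi; omega
  have hleft : gramForm r N (skewPolyG 1 n) (skewPolyF r 1 m) =
      ∑ kl ∈ antidiagonal (m + 1), 2 * (negBinom (1 / 2) kl.1 * negBinom (-1 / 2) kl.2) *
        (cauchySum (3 / 2) (1 / 2) n (kl.1 - 1 / 2) + 2) := by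
    simp_rw [mul_add]
    rw [sum_add_distrib, ← sum_mul _ _ (2 : ℝ), ← mul_sum, sum_antidiagonal_half_neg_half, mul_zero,
      zero_mul, add_zero, key, sum_comm]
    refine sum_congr rfl fun k _ => ?_
    rw [cauchySum, mul_sum]
    refine sum_congr rfl fun i _ => ?_
    ring
  rcases lt_trichotomy n m with h | h | h
  · rw [key, if_neg h.ne]
    refine sum_eq_zero fun i hi => ?_
    have hi' := mem_antidiagonal.1 hi
    have : ∀ k ∈ antidiagonal (m + 1), 2 * (negBinom (3 / 2) i.1 *
        negBinom (1 / 2) i.2 * (negBinom (1 / 2) k.1 * negBinom (-1 / 2) k.2)) /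
          ((k.1 : ℝ) - 1 / 2 - i.1) = -2 * (negBinom (3 / 2) i.1 * negBinom (1 / 2) i.2) *
          (negBinom (1 / 2) k.1 * negBinom (-1 / 2) k.2 / ((i.1 : ℝ) + 1 / 2 - k.1)) := by
      intro k _
      rw [show (k.1 : ℝ) - 1 / 2 - i.1 = -((i.1 : ℝ) + 1 / 2 - k.1) by ring, div_neg]
      ring
    rw [sum_congr rfl this, ← mul_sum]
    have h0 := cauchySum_half_neg_half_eq_zero (n := m + 1) (j := i.1) (by omega)
    rw [cauchySum] at h0
    rw [h0, mul_zero]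
  · subst h
    rw [hleft, if_pos rfl, sum_eq_single (n + 1, 0)]
    · have := cauchySum_three_halves_half_self n
      simp only [negBinom_zero]
      push_cast
      rw [show (n : ℝ) + 1 - 1 / 2 = n + 1 / 2 by ring]
      linear_combination 2 * this
    · rintro ⟨i, j⟩ hij hne
      have hij' : i + j = n + 1 := mem_antidiagonal.1 hij
      have : i ≤ n := by
        rcases Nat.eq_zero_or_pos j with rfl | hj
        · exact absurd (by ext <;> simp; omega) hne
        · omega
      rw [cauchySum_three_halves_half this, neg_add_cancel, mul_zero]
    · intro h; simp at h
  · rw [hleft, if_neg h.ne']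
    refine sum_eq_zero fun k hk => ?_
    have hk' := mem_antidiagonal.1 hk
    rw [cauchySum_three_halves_half (by omega), neg_add_cancel, mul_zero]

lemma coeff_skewPolyF_ne_zero {r : ℝ} {N : ℕ} (hr : ∀ k : ℕ, k ≤ N → 0 < 1 - (k : ℝ) * r) {ε n : ℕ}
    (h : 2 * (n + ε) + (1 - ε) < N) :
    (skewPolyF r ε n).coeff (2 * (n + ε) + (1 - ε)) ≠ 0 := by
  rw [skewPolyF, coeff_sum_antidiagonal_monomial (n + ε) (1 - ε) (fun ij =>
    (1 - ((2 * ij.1 + (1 - ε) + 1 : ℕ) : ℝ) * r) *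
      (negBinom (3 / 2) ij.1 * negBinom (-1 / 2) ij.2))]
  simp only [negBinom_zero, mul_one]
  exact mul_ne_zero (hr _ h).ne' (negBinom_pos (by norm_num) _).ne'

lemma natDegree_skewPolyF_le (r : ℝ) (ε n : ℕ) :
    (skewPolyF r ε n).natDegree ≤ 2 * (n + ε) + (1 - ε) :=
  natDegree_sum_antidiagonal_monomial_le _ _ fun ij =>
    (1 - ((2 * ij.1 + (1 - ε) + 1 : ℕ) : ℝ) * r) *
      (negBinom (3 / 2) ij.1 * negBinom (-1 / 2) ij.2)

lemma coeff_skewPolyG_ne_zero (ε n : ℕ) : (skewPolyG ε n).coeff (2 * n + ε) ≠ 0 := by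
  rw [skewPolyG, coeff_sum_antidiagonal_monomial n ε (fun ij =>
    negBinom (3 / 2) ij.1 * negBinom (1 / 2) ij.2)]
  simp only [negBinom_zero, mul_one]
  exact (negBinom_pos (by norm_num) _).ne'

lemma natDegree_skewPolyG_le (ε n : ℕ) : (skewPolyG ε n).natDegree ≤ 2 * n + ε :=
  natDegree_sum_antidiagonal_monomial_le _ _ fun ij =>
    negBinom (3 / 2) ij.1 * negBinom (1 / 2) ij.2

/-- The skew-orthogonal family for even `N`. -/
def evenFamily (r : ℝ) (d : ℕ) : Polynomial ℝ :=
  if Even d then skewPolyG 0 (d / 2) else skewPolyF r 0 (d / 2)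

/-- The skew-orthogonal family for odd `N`. -/
def oddFamily (r : ℝ) (d : ℕ) : Polynomial ℝ :=
  if d = 0 then 1 else if Even d then skewPolyF r 1 (d / 2 - 1) else skewPolyG 1 (d / 2)

lemma evenFamily_two_mul (r : ℝ) (n : ℕ) : evenFamily r (2 * n) = skewPolyG 0 n := by
  simp [evenFamily]

lemma evenFamily_two_mul_add_one (r : ℝ) (n : ℕ) : evenFamily r (2 * n + 1) = skewPolyF r 0 n := by
  rw [evenFamily, if_neg (by simp), show (2 * n + 1) / 2 = n by omega]

lemma oddFamily_two_mul_add_one (r : ℝ) (n : ℕ) : oddFamily r (2 * n + 1) = skewPolyG 1 n := by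
  rw [oddFamily, if_neg (by omega), if_neg (by simp), show (2 * n + 1) / 2 = n by omega]

lemma oddFamily_two_mul_add_two (r : ℝ) (n : ℕ) : oddFamily r (2 * n + 2) = skewPolyF r 1 n := by
  rw [oddFamily, if_neg (by omega), if_pos ⟨n + 1, by ring⟩, show (2 * n + 2) / 2 - 1 = n by omega]

lemma hasExactDegrees_evenFamily {r : ℝ} {N : ℕ} (hr : ∀ k : ℕ, k ≤ N → 0 < 1 - (k : ℝ) * r) :
    HasExactDegrees (evenFamily r) N := by
  intro d hd
  obtain ⟨n, rfl | rfl⟩ := d.even_or_odd'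
  · rw [evenFamily_two_mul]
    exact ⟨natDegree_skewPolyG_le 0 n, coeff_skewPolyG_ne_zero 0 n⟩
  · rw [evenFamily_two_mul_add_one]
    exact ⟨natDegree_skewPolyF_le r 0 n, coeff_skewPolyF_ne_zero (ε := 0) hr hd⟩

lemma hasExactDegrees_oddFamily {r : ℝ} {N : ℕ} (hr : ∀ k : ℕ, k ≤ N → 0 < 1 - (k : ℝ) * r) :
    HasExactDegrees (oddFamily r) N := by
  intro d hd
  rcases Nat.eq_zero_or_pos d with rfl | h0
  · simp [oddFamily]
  obtain ⟨n, rfl | rfl⟩ : ∃ n, d = 2 * n + 1 ∨ d = 2 * n + 2 := ⟨(d - 1) / 2, by omega⟩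
  · rw [oddFamily_two_mul_add_one]
    exact ⟨natDegree_skewPolyG_le 1 n, coeff_skewPolyG_ne_zero 1 n⟩
  · rw [oddFamily_two_mul_add_two]
    exact ⟨natDegree_skewPolyF_le r 1 n, coeff_skewPolyF_ne_zero (ε := 1) hr hd⟩

lemma recip_den_pos {s : ℝ≥0∞} {N : ℕ} (hs : (N : ℝ≥0∞) < s) (k : ℕ) (hk : k ≤ N) :
    0 < 1 - (k : ℝ) * recip s :=
  recip_pos_den (lt_of_le_of_lt (by exact_mod_cast hk) hs)

lemma polyKernel_even {s : ℝ≥0∞} {p : ℕ → Polynomial ℝ} {J : ℕ} (hs : ((2 * J : ℕ) : ℝ≥0∞) < s)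
    (hp : HasExactDegrees p (2 * J)) (u v : ℂ) :
    polyKernel s p (2 * J) u v = 1 / 2 * ∑ n ∈ range J,
      (val (skewPolyG 0 n) u * val (skewPolyF (recip s) 0 n) v -
        val (skewPolyF (recip s) 0 n) u * val (skewPolyG 0 n) v) := by
  have hr := recip_den_pos hs
  have hq := hasExactDegrees_evenFamily hr
  rw [polyKernel_congr hs hp hq]
  obtain ⟨S, hS⟩ : ∃ S : ℕ → ℕ → ℂ, S = fun m n =>
    if m % 2 = 0 ∧ n = m + 1 then 4 else if n % 2 = 0 ∧ m = n + 1 then -4 else 0 := ⟨_, rfl⟩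
  have h00 : ∀ m n, S (2 * m) (2 * n) = 0 := fun m n => by
    simp only [hS]; split_ifs <;> first | rfl | (exfalso; omega)
  have h01 : ∀ m n, S (2 * m) (2 * n + 1) = if m = n then 4 else 0 := fun m n => by
    simp only [hS]; split_ifs <;> first | rfl | (exfalso; omega)
  have h10 : ∀ m n, S (2 * m + 1) (2 * n) = if m = n then -4 else 0 := fun m n => by
    simp only [hS]; split_ifs <;> first | rfl | (exfalso; omega)
  have h11 : ∀ m n, S (2 * m + 1) (2 * n + 1) = 0 := fun m n => by
    simp only [hS]; split_ifs <;> first | rfl | (exfalso; omega)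
  rw [polyKernel_of_even S _ h00 h01 h10 h11]
  · simp only [evenFamily_two_mul, evenFamily_two_mul_add_one]
  · rintro ⟨m, hm⟩ ⟨n, hn⟩
    rw [skewGram_apply hs hq]
    simp only
    obtain ⟨m, rfl | rfl⟩ := m.even_or_odd' <;> obtain ⟨n, rfl | rfl⟩ := n.even_or_odd'
    · rw [evenFamily_two_mul, evenFamily_two_mul, h00, skewPolyG, skewPolyG,
        gramForm_eq_zero_of_parity _ _ _ hm hn, Complex.ofReal_zero]
    · rw [evenFamily_two_mul, evenFamily_two_mul_add_one, gramForm_skewPoly_zero hr hn hm, h01]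
      split_ifs <;> simp
    · rw [evenFamily_two_mul, evenFamily_two_mul_add_one, gramForm_swap,
        gramForm_skewPoly_zero hr hm hn, h10]
      simp only [eq_comm (a := n)]
      split_ifs <;> simp
    · rw [evenFamily_two_mul_add_one, evenFamily_two_mul_add_one, h11,
        show gramForm (recip s) (2 * J) (skewPolyF (recip s) 0 m) (skewPolyF (recip s) 0 n) = 0 from
          gramForm_eq_zero_of_parity (δ := 1) _ _ _ hm hn, Complex.ofReal_zero]

lemma skewPolyF_one_parity_zero (r : ℝ) (n : ℕ) {N : ℕ} (h : 2 * n + 2 < N) :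
    gramForm r N 1 (skewPolyF r 1 n) = 0 := by
  have := gramForm_eq_zero_of_parity r (N := N) (n := 0) (n' := n + 1) (δ := 0) (fun _ => 1)
    (fun ij => (1 - ((2 * ij.1 + (1 - 1) + 1 : ℕ) : ℝ) * r) *
      (negBinom (3 / 2) ij.1 * negBinom (-1 / 2) ij.2)) (by omega) (by omega)
  simpa [skewPolyF] using this

lemma realMean_sum_monomial {s : ℝ≥0∞} {N : ℕ} (hs : (N : ℝ≥0∞) < s) {ι : Type*} (T : Finset ι)
    (d : ι → ℕ) (a : ι → ℝ) (hd : ∀ i ∈ T, d i < N)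
    (hdeg : (∑ i ∈ T, Polynomial.monomial (d i) (a i)).natDegree < N) :
    realMean s (∑ i ∈ T, Polynomial.monomial (d i) (a i)) =
      ((∑ i ∈ T, a i * monomialMean (recip s) (d i) : ℝ) : ℂ) := by
  rw [realMean_eq_sum hs hdeg, ← Complex.ofReal_sum,
    sum_range_coeff_mul T d a hd (monomialMean (recip s))]

lemma realMean_skewPolyG_one {s : ℝ≥0∞} {N n : ℕ} (hs : (N : ℝ≥0∞) < s) (hn : 2 * n + 1 < N) :
    realMean s (skewPolyG 1 n) = 0 := by
  have h := natDegree_skewPolyG_le 1 n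
  rw [skewPolyG] at h ⊢
  rw [realMean_sum_monomial hs _ _ _ _ (by omega), sum_eq_zero, Complex.ofReal_zero]
  · intro i _; simp [monomialMean]
  · intro i hi; have := mem_antidiagonal.1 hi; omega

lemma realMean_skewPolyF_one {s : ℝ≥0∞} {N n : ℕ} (hs : (N : ℝ≥0∞) < s) (hn : 2 * n + 2 < N) :
    realMean s (skewPolyF (recip s) 1 n) = 0 := by
  have h := natDegree_skewPolyF_le (recip s) 1 n
  rw [skewPolyF] at h ⊢
  rw [realMean_sum_monomial hs _ _ _ _ (by omega)]
  · have : ∀ ij ∈ antidiagonal (n + 1), (1 - ((2 * ij.1 + (1 - 1) + 1 : ℕ) : ℝ) * recip s) *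
        (negBinom (3 / 2) ij.1 * negBinom (-1 / 2) ij.2) *
          monomialMean (recip s) (2 * ij.1 + (1 - 1)) =
        2 * (negBinom (1 / 2) ij.1 * negBinom (-1 / 2) ij.2) := by
      intro ij hij
      have hk := mem_antidiagonal.1 hij
      have h1 := (recip_den_pos hs (2 * ij.1 + 1) (by omega)).ne'
      have h2 : (2 * (ij.1 : ℝ) + 1) ≠ 0 := by positivity
      rw [monomialMean, if_pos (by simp), negBinom_three_halves]
      simp only [tsub_self, add_zero]
      push_cast at h1 ⊢
      obtain ⟨D, hD⟩ : ∃ D, D = 1 - (2 * (ij.1 : ℝ) + 1) * recip s := ⟨_, rfl⟩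
      rw [← hD] at h1 ⊢
      field_simp
    rw [sum_congr rfl this, ← mul_sum, sum_antidiagonal_half_neg_half, mul_zero, Complex.ofReal_zero]
  · intro i hi; have := mem_antidiagonal.1 hi; omega

lemma realMean_one_ne_zero {s : ℝ≥0∞} (hs : ((1 : ℕ) : ℝ≥0∞) < s) : realMean s 1 ≠ 0 := by
  rw [realMean_eq_sum (N := 1) hs (by simp)]
  have h := (recip_den_pos hs 1 le_rfl).ne'
  push_cast at h
  simp only [range_one, sum_singleton, Polynomial.coeff_one_zero, monomialMean, one_mul]
  simp only [Nat.cast_zero, zero_add, one_mul] at h ⊢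
  exact_mod_cast div_ne_zero two_ne_zero h

lemma polyKernel_odd {s : ℝ≥0∞} {p : ℕ → Polynomial ℝ} {J : ℕ} (hs : ((2 * J + 1 : ℕ) : ℝ≥0∞) < s)
    (hp : HasExactDegrees p (2 * J + 1)) (u v : ℂ) :
    polyKernel s p (2 * J + 1) u v = 1 / 2 * ∑ n ∈ range J,
      (val (skewPolyG 1 n) u * val (skewPolyF (recip s) 1 n) v -
        val (skewPolyF (recip s) 1 n) u * val (skewPolyG 1 n) v) := by
  have hr := recip_den_pos hs
  have hq := hasExactDegrees_oddFamily hr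
  have hq0 : oddFamily (recip s) 0 = 1 := by simp [oddFamily]
  rw [polyKernel_congr hs hp hq]
  obtain ⟨t, ht⟩ : ∃ t : ℕ → ℂ, t = fun m =>
    (gramForm (recip s) (2 * J + 1) (oddFamily (recip s) m) 1 : ℂ) := ⟨_, rfl⟩
  obtain ⟨S, hS⟩ : ∃ S : ℕ → ℕ → ℂ, S = fun m n =>
    if m = 0 then (if n % 2 = 1 then -t n else 0) else
    if n = 0 then (if m % 2 = 1 then t m else 0) else
    if m % 2 = 1 ∧ n = m + 1 then 4 else if n % 2 = 1 ∧ m = n + 1 then -4 else 0 := ⟨_, rfl⟩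
  have h00 : ∀ m n, S (2 * m + 1) (2 * n + 1) = 0 := fun m n => by
    simp only [hS]; split_ifs <;> first | rfl | (exfalso; omega)
  have h01 : ∀ m n, S (2 * m + 1) (2 * n + 2) = if m = n then 4 else 0 := fun m n => by
    simp only [hS]; split_ifs <;> first | rfl | (exfalso; omega)
  have h10 : ∀ m n, S (2 * m + 2) (2 * n + 1) = if m = n then -4 else 0 := fun m n => by
    simp only [hS]; split_ifs <;> first | rfl | (exfalso; omega)
  have h11 : ∀ m n, S (2 * m + 2) (2 * n + 2) = 0 := fun m n => by
    simp only [hS]; split_ifs <;> first | rfl | (exfalso; omega)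
  have hz : S 0 0 = 0 := by simp [hS]
  have hz1' : ∀ n, S 0 (2 * n + 1) = -t (2 * n + 1) := fun n => by
    simp only [hS, if_true]; rw [if_pos (by omega)]
  have hz4 : ∀ n, S (2 * n + 1) 0 = t (2 * n + 1) := fun n => by
    simp only [hS, if_true]; rw [if_neg (Nat.succ_ne_zero _), if_pos (by omega)]
  have hz2 : ∀ n, S 0 (2 * n + 2) = 0 := fun n => by
    simp only [hS, if_true]; rw [if_neg (by omega)]
  have hz3 : ∀ n, S (2 * n + 2) 0 = 0 := fun n => by
    simp only [hS, if_true]; rw [if_neg (Nat.succ_ne_zero _), if_neg (by omega)]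
  rw [polyKernel_of_odd S (fun m => if m = 0 then realMean s 1 else 0) _ _ _ (by simp) hz
    (fun n => by rw [hz1', hz4]) hz2 hz3 h00 h01 h10 h11]
  · simp only [oddFamily_two_mul_add_one, oddFamily_two_mul_add_two]
  · rintro ⟨m, hm⟩ ⟨n, hn⟩
    rw [skewGram_apply hs hq]
    simp only
    rcases Nat.eq_zero_or_pos m with rfl | hm0
    · rcases Nat.eq_zero_or_pos n with rfl | hn0
      · have := gramForm_swap (recip s) (2 * J + 1) (oddFamily (recip s) 0) (oddFamily (recip s) 0)
        rw [hz, show gramForm (recip s) (2 * J + 1) (oddFamily (recip s) 0)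
          (oddFamily (recip s) 0) = 0 by linarith, Complex.ofReal_zero]
      obtain ⟨n, rfl | rfl⟩ : ∃ k, n = 2 * k + 1 ∨ n = 2 * k + 2 := ⟨(n - 1) / 2, by omega⟩
      · rw [hz1', ht, hq0, gramForm_swap, Complex.ofReal_neg]
      · rw [hz2, hq0, oddFamily_two_mul_add_two, skewPolyF_one_parity_zero _ _ hn,
          Complex.ofReal_zero]
    · obtain ⟨m, rfl | rfl⟩ : ∃ k, m = 2 * k + 1 ∨ m = 2 * k + 2 := ⟨(m - 1) / 2, by omega⟩
      · rcases Nat.eq_zero_or_pos n with rfl | hn0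
        · rw [hz4, ht, hq0]
        obtain ⟨n, rfl | rfl⟩ : ∃ k, n = 2 * k + 1 ∨ n = 2 * k + 2 := ⟨(n - 1) / 2, by omega⟩
        · rw [h00, oddFamily_two_mul_add_one, oddFamily_two_mul_add_one, skewPolyG, skewPolyG,
            gramForm_eq_zero_of_parity _ _ _ hm hn, Complex.ofReal_zero]
        · rw [h01, oddFamily_two_mul_add_one, oddFamily_two_mul_add_two,
            gramForm_skewPoly_one hr hn hm]
          split_ifs <;> simp
      · rcases Nat.eq_zero_or_pos n with rfl | hn0
        · rw [hz3, hq0, oddFamily_two_mul_add_two, gramForm_swap, skewPolyF_one_parity_zero _ _ hm,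
            neg_zero, Complex.ofReal_zero]
        obtain ⟨n, rfl | rfl⟩ : ∃ k, n = 2 * k + 1 ∨ n = 2 * k + 2 := ⟨(n - 1) / 2, by omega⟩
        · rw [h10, oddFamily_two_mul_add_one, oddFamily_two_mul_add_two, gramForm_swap,
            gramForm_skewPoly_one hr hm hn]
          simp only [eq_comm (a := n)]
          split_ifs <;> simp
        · rw [h11, oddFamily_two_mul_add_two, oddFamily_two_mul_add_two, skewPolyF, skewPolyF,
            gramForm_eq_zero_of_parity _ _ _ (by omega) (by omega), Complex.ofReal_zero]
  · rintro ⟨m, hm⟩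
    simp only
    rcases Nat.eq_zero_or_pos m with rfl | hm0
    · rw [if_pos rfl, hq0]
    · rw [if_neg hm0.ne']
      obtain ⟨m, rfl | rfl⟩ : ∃ k, m = 2 * k + 1 ∨ m = 2 * k + 2 := ⟨(m - 1) / 2, by omega⟩
      · rw [oddFamily_two_mul_add_one, realMean_skewPolyG_one hs hm]
      · rw [oddFamily_two_mul_add_two, realMean_skewPolyF_one hs hm]
  · rw [if_pos rfl]
    exact realMean_one_ne_zero (lt_of_le_of_lt (by push_cast; simp) hs)

/-- The polynomial kernel as a sum over skew-orthogonal polynomials. -/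
lemma polyKernel_eq_sum {s : ℝ≥0∞} {p : ℕ → Polynomial ℝ} {N : ℕ} (hs : (N : ℝ≥0∞) < s)
    (hp : HasExactDegrees p N) (u v : ℂ) :
    polyKernel s p N u v = 1 / 2 * ∑ n ∈ range (N / 2),
      (val (skewPolyG (N % 2) n) u * val (skewPolyF (recip s) (N % 2) n) v -
        val (skewPolyF (recip s) (N % 2) n) u * val (skewPolyG (N % 2) n) v) := by
  obtain ⟨J, rfl | rfl⟩ := N.even_or_odd'
  · rw [polyKernel_even hs hp]
    simp
  · rw [polyKernel_odd hs hp, show (2 * J + 1) / 2 = J by omega, show (2 * J + 1) % 2 = 1 by omega]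

section

open MeasureTheory Filter

lemma Gamma_add_three_halves_div (n : ℕ) :
    Real.Gamma (n + 3 / 2) / Real.Gamma (n + 1) = Real.Gamma (3 / 2) * negBinom (3 / 2) n := by
  induction n with
  | zero => simp
  | succ n ih =>
    have h1 : (n : ℝ) + 1 ≠ 0 := by positivity
    have h2 : Real.Gamma ((n : ℝ) + 1) ≠ 0 := (Real.Gamma_pos_of_pos (by positivity)).ne'
    rw [show ((n + 1 : ℕ) : ℝ) + 3 / 2 = (n + 3 / 2) + 1 by push_cast; ring,
      Real.Gamma_add_one (by positivity), Nat.cast_succ, Real.Gamma_add_one h1, negBinom_succ,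
      ← mul_assoc, ← ih]
    field_simp
    ring

lemma M_eq_tsum (z : ℂ) :
    M z = ∑' n : ℕ, (negBinom (3 / 2) n : ℂ) * (z ^ n / (n.factorial : ℂ)) := by
  rw [M, ← tsum_mul_left]
  refine tsum_congr fun n => ?_
  have h : (Real.Gamma (3 / 2) : ℂ) ≠ 0 := by
    exact_mod_cast (Real.Gamma_pos_of_pos (by norm_num)).ne'
  rw [Gamma_add_three_halves_div]
  push_cast
  field_simp

lemma summable_add_two_mul_pow_div_factorial (R : ℝ) (hR : 0 ≤ R) :
    Summable fun l : ℕ => ((l : ℝ) + 2) * R ^ l / l.factorial := by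
  refine Summable.of_nonneg_of_le (fun l => by positivity) (fun l => ?_)
    ((Real.summable_pow_div_factorial (2 * R)).mul_left 2)
  have h : (l : ℝ) + 2 ≤ 2 * 2 ^ l := by
    have : l + 1 ≤ 2 ^ l := Nat.lt_two_pow_self
    have h2 : (l : ℝ) + 1 ≤ 2 ^ l := by exact_mod_cast this
    have h3 : (1 : ℝ) ≤ 2 ^ l := one_le_pow₀ (by norm_num)
    linarith
  rw [mul_pow, ← mul_div_assoc, ← mul_assoc]
  gcongr

lemma hasDerivAt_M (z : ℂ) :
    HasDerivAt M (∑' n : ℕ, (negBinom (3 / 2) (n + 1) : ℂ) * (z ^ n / (n.factorial : ℂ))) z := by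
  have hM : M = fun z => ∑' n : ℕ, (negBinom (3 / 2) n : ℂ) * (z ^ n / (n.factorial : ℂ)) := by
    funext z; exact M_eq_tsum z
  set R := ‖z‖ + 1 with hR
  have hR0 : 0 < R := by positivity
  have hsum : Summable fun n : ℕ => ((n : ℝ) + 1) * (n * R ^ (n - 1) / n.factorial) := by
    rw [← summable_nat_add_iff 1]
    refine (summable_add_two_mul_pow_div_factorial R hR0.le).congr fun n => ?_
    rw [Nat.factorial_succ]
    push_cast
    have h1 : (n : ℝ) + 1 ≠ 0 := by positivity
    field_simp
    ring
  have hbound : ∀ (n : ℕ) (y : ℂ), y ∈ Metric.ball (0 : ℂ) R →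
      ‖(negBinom (3 / 2) n : ℂ) * (n * y ^ (n - 1) / (n.factorial : ℂ))‖ ≤
        ((n : ℝ) + 1) * (n * R ^ (n - 1) / n.factorial) := fun n y hy => by
    rw [mem_ball_zero_iff] at hy
    rw [norm_mul, norm_div, norm_mul, norm_pow, Complex.norm_natCast, Complex.norm_natCast,
      Complex.norm_real, Real.norm_of_nonneg (negBinom_pos (by norm_num) _).le]
    gcongr
    exact negBinom_three_halves_le n
  have key := hasDerivAt_tsum_of_isPreconnected (g := fun (n : ℕ) (z : ℂ) =>
      (negBinom (3 / 2) n : ℂ) * (z ^ n / (n.factorial : ℂ)))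
      (g' := fun (n : ℕ) (z : ℂ) => (negBinom (3 / 2) n : ℂ) * (n * z ^ (n - 1) / (n.factorial : ℂ)))
      (y₀ := 0) (y := z) hsum Metric.isOpen_ball
      (convex_ball (0 : ℂ) R).isPreconnected
      (fun n y _ => ((hasDerivAt_pow n y).div_const _).const_mul _) hbound
      (Metric.mem_ball_self hR0) ?_ (by rw [mem_ball_zero_iff, hR]; linarith)
  · rw [hM]
    refine key.congr_deriv ?_
    rw [tsum_eq_zero_add']
    · simp only [Nat.cast_zero, zero_mul, zero_div, mul_zero, zero_add, add_tsub_cancel_right]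
      refine tsum_congr fun n => ?_
      have h1 : (n : ℂ) + 1 ≠ 0 := by exact_mod_cast n.succ_ne_zero
      rw [Nat.factorial_succ]
      push_cast
      field_simp
    · rw [summable_nat_add_iff 1 (f := fun n : ℕ =>
        (negBinom (3 / 2) n : ℂ) * (n * z ^ (n - 1) / (n.factorial : ℂ)))]
      exact Summable.of_norm_bounded hsum fun n =>
        hbound n z (by rw [mem_ball_zero_iff, hR]; linarith)
  · refine summable_of_ne_finset_zero (s := {0}) fun n hn => ?_
    have : n ≠ 0 := by simpa using hn
    simp [this]

lemma deriv_M (z : ℂ) :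
    deriv M z = ∑' n : ℕ, (negBinom (3 / 2) (n + 1) : ℂ) * (z ^ n / (n.factorial : ℂ)) :=
  (hasDerivAt_M z).deriv

lemma differentiable_M : Differentiable ℂ M := fun z => (hasDerivAt_M z).differentiableAt

lemma continuous_deriv_M : Continuous (deriv M) :=
  (differentiable_M.contDiff (n := 1)).continuous_deriv le_rfl

lemma deriv_M_sub_M (z : ℂ) : deriv M z - M z =
    1 / 2 * ∑' n : ℕ, (negBinom (3 / 2) n : ℂ) * (z ^ n / ((n + 1).factorial : ℂ)) := by
  have h1 : Summable fun n : ℕ => (negBinom (3 / 2) (n + 1) : ℂ) * (z ^ n / (n.factorial : ℂ)) := by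
    refine Summable.of_norm_bounded (summable_add_two_mul_pow_div_factorial ‖z‖ (norm_nonneg _))
      fun n => ?_
    rw [norm_mul, norm_div, norm_pow, Complex.norm_natCast,
      Complex.norm_real, Real.norm_of_nonneg (negBinom_pos (by norm_num) _).le, mul_div_assoc]
    gcongr
    have := negBinom_three_halves_le (n + 1)
    push_cast at this
    linarith
  have h2 : Summable fun n : ℕ => (negBinom (3 / 2) n : ℂ) * (z ^ n / (n.factorial : ℂ)) := by
    refine Summable.of_norm_bounded (summable_add_two_mul_pow_div_factorial ‖z‖ (norm_nonneg _))
      fun n => ?_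
    rw [norm_mul, norm_div, norm_pow, Complex.norm_natCast,
      Complex.norm_real, Real.norm_of_nonneg (negBinom_pos (by norm_num) _).le, mul_div_assoc]
    gcongr
    have := negBinom_three_halves_le n
    linarith
  rw [deriv_M, M_eq_tsum, ← h1.tsum_sub h2, ← tsum_mul_left]
  refine tsum_congr fun n => ?_
  have h3 : (n : ℂ) + 1 ≠ 0 := by exact_mod_cast n.succ_ne_zero
  have h4 : ((n : ℂ) + 1) * negBinom (3 / 2) (n + 1) = (3 / 2 + n) * negBinom (3 / 2) n := by
    have := congrArg Complex.ofReal (succ_mul_negBinom_succ (3 / 2) n)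
    push_cast at this
    exact this
  rw [Nat.factorial_succ]
  push_cast
  field_simp
  have h5 : (n.factorial : ℂ) ≠ 0 := by exact_mod_cast n.factorial_ne_zero
  field_simp
  linear_combination 2 * z ^ n * h4

/-- The series `∑ d_l * choose m (l + j) * ζ ^ l`, a finite sum. -/
def chooseSum (d : ℕ → ℝ) (j m : ℕ) (ζ : ℂ) : ℂ :=
  ∑' l : ℕ, (d l : ℂ) * (m.choose (l + j) : ℂ) * ζ ^ l

lemma chooseSum_eq_sum (d : ℕ → ℝ) (j m K : ℕ) (ζ : ℂ) (h : m < K + j) :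
    chooseSum d j m ζ = ∑ l ∈ range K, (d l : ℂ) * (m.choose (l + j) : ℂ) * ζ ^ l := by
  rw [chooseSum, tsum_eq_sum]
  intro l hl
  have : K ≤ l := by simpa using hl
  rw [Nat.choose_eq_zero_of_lt (by omega)]
  simp

lemma norm_choose_term_le (d : ℝ) (j l : ℕ) {m N : ℕ} {ζ : ℂ} {R : ℝ} (hN : N ≠ 0) (hm : m ≤ N)
    (hζ : ‖(N : ℂ) * ζ‖ ≤ R) :
    ‖(d : ℂ) * (m.choose (l + j) : ℂ) * ζ ^ l / (N : ℂ) ^ j‖ ≤ |d| * R ^ l / (l + j).factorial := by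
  have hN' : (0 : ℝ) < N := by positivity
  rw [norm_div, norm_mul, norm_mul, norm_pow, norm_pow, Complex.norm_natCast, Complex.norm_natCast,
    Complex.norm_real, Real.norm_eq_abs]
  rw [norm_mul, Complex.norm_natCast] at hζ
  have h1 : (m.choose (l + j) : ℝ) ≤ (N : ℝ) ^ (l + j) / (l + j).factorial :=
    (Nat.choose_le_pow_div (l + j) m).trans (by gcongr)
  calc |d| * (m.choose (l + j) : ℝ) * ‖ζ‖ ^ l / (N : ℝ) ^ j
      ≤ |d| * ((N : ℝ) ^ (l + j) / (l + j).factorial) * ‖ζ‖ ^ l / (N : ℝ) ^ j := by gcongr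
    _ = |d| * (N * ‖ζ‖) ^ l / (l + j).factorial := by
        rw [pow_add, mul_pow]; field_simp
    _ ≤ _ := by gcongr

lemma norm_chooseSum_le {d : ℕ → ℝ} {j m N : ℕ} {ζ : ℂ} {R : ℝ}
    (hd : Summable fun l : ℕ => |d l| * R ^ l / (l + j).factorial) (hN : N ≠ 0) (hm : m ≤ N)
    (hζ : ‖(N : ℂ) * ζ‖ ≤ R) :
    ‖chooseSum d j m ζ / (N : ℂ) ^ j‖ ≤ ∑' l : ℕ, |d l| * R ^ l / (l + j).factorial := by
  rw [chooseSum, ← tsum_div_const]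
  exact tsum_of_norm_bounded hd.hasSum fun l => norm_choose_term_le (d l) j l hN hm hζ

lemma tendsto_choose_div_pow {ι : Type*} {L : Filter ι} {N m : ι → ℕ} {t : ℝ}
    (hN : Tendsto N L atTop) (hm : Tendsto (fun i => (m i : ℝ) / N i) L (𝓝 t)) (k : ℕ) :
    Tendsto (fun i => ((m i).choose k : ℝ) / (N i : ℝ) ^ k) L (𝓝 (t ^ k / k.factorial)) := by
  induction k with
  | zero => simpa using tendsto_const_nhds
  | succ k ih =>
    have h0 : Tendsto (fun i => (k : ℝ) / N i) L (𝓝 0) :=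
      tendsto_const_nhds.div_atTop (tendsto_natCast_atTop_atTop.comp hN)
    have h1 : (k : ℝ) + 1 ≠ 0 := by positivity
    have h := (ih.mul (hm.sub h0)).div_const ((k : ℝ) + 1)
    have e : t ^ k / k.factorial * (t - 0) / (k + 1) = t ^ (k + 1) / (k + 1).factorial := by
      rw [Nat.factorial_succ]; push_cast; field_simp; ring
    rw [e] at h
    refine h.congr' ?_
    filter_upwards [hN.eventually_ge_atTop 1] with i hi
    have hi' : (N i : ℝ) ≠ 0 := by positivity
    have h2 : ((m i).choose (k + 1) : ℝ) * (k + 1) = (m i).choose k * ((m i : ℝ) - k) := by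
      rcases le_or_gt k (m i) with hk | hk
      · have := Nat.choose_succ_right_eq (m i) k
        rw [← Nat.cast_sub hk]
        exact_mod_cast this
      · rw [Nat.choose_eq_zero_of_lt hk, Nat.choose_eq_zero_of_lt (by omega)]; simp
    field_simp
    rw [pow_succ]
    linear_combination (-(N i : ℝ) ^ k * N i) * h2

lemma tendsto_chooseSum {ι : Type*} {L : Filter ι} {d : ℕ → ℝ} {j : ℕ}
    (hd : ∀ R : ℝ, 0 ≤ R → Summable fun l : ℕ => |d l| * R ^ l / (l + j).factorial)
    {N m : ι → ℕ} {ζ : ι → ℂ} {t : ℝ} {w : ℂ}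
    (hN : Tendsto N L atTop) (hm : Tendsto (fun i => (m i : ℝ) / N i) L (𝓝 t))
    (hmN : ∀ᶠ i in L, m i ≤ N i) (hζ : Tendsto (fun i => (N i : ℂ) * ζ i) L (𝓝 w)) :
    Tendsto (fun i => chooseSum d j (m i) (ζ i) / (N i : ℂ) ^ j) L
      (𝓝 (∑' l : ℕ, (d l : ℂ) * ((t : ℂ) ^ (l + j) * w ^ l / ((l + j).factorial : ℂ)))) := by
  simp_rw [chooseSum, ← tsum_div_const]
  have hN0 : ∀ᶠ i in L, N i ≠ 0 := (hN.eventually_ge_atTop 1).mono fun i hi => by omega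
  refine tendsto_tsum_of_dominated_convergence (hd (‖w‖ + 1) (by positivity)) (fun l => ?_) ?_
  · have h1 := tendsto_choose_div_pow hN hm (l + j)
    have h2 : Tendsto (fun i => ((((m i).choose (l + j) : ℝ) / (N i : ℝ) ^ (l + j) : ℝ) : ℂ)) L
      (𝓝 ((t ^ (l + j) / (l + j).factorial : ℝ) : ℂ)) :=
      (Complex.continuous_ofReal.tendsto _).comp h1
    have h3 := (h2.mul (hζ.pow l)).const_mul (d l : ℂ)
    have e : (d l : ℂ) * (((t ^ (l + j) / (l + j).factorial : ℝ) : ℂ) * w ^ l) =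
        (d l : ℂ) * ((t : ℂ) ^ (l + j) * w ^ l / ((l + j).factorial : ℂ)) := by
      push_cast; ring
    rw [e] at h3
    refine h3.congr' ?_
    filter_upwards [hN0] with i hi
    have hi' : (N i : ℂ) ≠ 0 := by exact_mod_cast hi
    push_cast
    rw [mul_pow, pow_add]
    field_simp
  · have h1 : ∀ᶠ i in L, ‖(N i : ℂ) * ζ i‖ ≤ ‖w‖ + 1 :=
      (hζ.norm.eventually_lt_const (lt_add_one _)).mono fun i hi => hi.le
    filter_upwards [hN0, hmN, h1] with i hi him hiz l
    exact norm_choose_term_le (d l) j l hi him hiz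

lemma succ_mul_negBinom_succ' (a : ℝ) (k : ℕ) :
    ((k : ℝ) + 1) * negBinom a (k + 1) = a * negBinom (a + 1) k := by
  induction k with
  | zero => simp [negBinom_succ]
  | succ k ih =>
    have h1 : (k : ℝ) + 1 ≠ 0 := by positivity
    have h2 := succ_mul_negBinom_succ a (k + 1)
    rw [negBinom_succ (a + 1)]
    push_cast at h2 ⊢
    rw [h2]
    field_simp
    linear_combination (a + (k + 1)) * ih

lemma sum_negBinom_two (a b : ℝ) (hab : a + b = 2) (n : ℕ) (z : ℂ) :
    ∑ ij ∈ antidiagonal n, ((negBinom a ij.1 * negBinom b ij.2 : ℝ) : ℂ) * z ^ ij.1 =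
      ∑ l ∈ range (n + 1), (negBinom a l : ℂ) * ((n + 1).choose (l + 1) : ℂ) * (z - 1) ^ l := by
  rw [sum_negBinom_mul_pow, hab]
  refine sum_congr rfl fun l hl => ?_
  have hl' : l ≤ n := by simpa [Nat.lt_succ_iff] using hl
  have : negBinom (2 + l) (n - l) = ((n + 1).choose (l + 1) : ℝ) := by
    have := negBinom_natCast_succ (l + 1) (n - l)
    rw [show n - l + (l + 1) = n + 1 by omega] at this
    rw [← this]; congr 1; push_cast; ring
  rw [this]
  push_cast; ring

lemma sum_negBinom_one (a b : ℝ) (hab : a + b = 1) (n : ℕ) (z : ℂ) :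
    ∑ ij ∈ antidiagonal n, ((negBinom a ij.1 * negBinom b ij.2 : ℝ) : ℂ) * z ^ ij.1 =
      chooseSum (negBinom a) 0 n (z - 1) := by
  rw [sum_negBinom_mul_pow, hab, chooseSum_eq_sum _ _ _ (n + 1) _ (by omega)]
  refine sum_congr rfl fun l hl => ?_
  have hl' : l ≤ n := by simpa [Nat.lt_succ_iff] using hl
  have : negBinom (1 + l) (n - l) = (n.choose l : ℝ) := by
    have := negBinom_natCast_succ l (n - l)
    rw [show n - l + l = n by omega] at this
    rw [← this, add_comm]
  rw [this]
  push_cast; ring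

lemma sum_mul_negBinom_one (a b : ℝ) (hab : a + b = 1) (n : ℕ) (z : ℂ) :
    ∑ ij ∈ antidiagonal n, (ij.1 : ℂ) * ((negBinom a ij.1 * negBinom b ij.2 : ℝ) : ℂ) * z ^ ij.1 =
      z * chooseSum (fun l => (l + 1) * negBinom a (l + 1)) 1 n (z - 1) := by
  cases n with
  | zero => rw [chooseSum_eq_sum _ _ _ 0 _ (by omega)]; simp
  | succ n =>
    rw [chooseSum_eq_sum _ _ _ (n + 1) _ (by omega), Nat.sum_antidiagonal_succ]
    have h := sum_negBinom_two (a + 1) b (by linarith) n z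
    have h1 : ∀ ij ∈ antidiagonal n, ((ij.1 + 1 : ℕ) : ℂ) *
        ((negBinom a (ij.1 + 1) * negBinom b ij.2 : ℝ) : ℂ) * z ^ (ij.1 + 1) =
        (z * a) * (((negBinom (a + 1) ij.1 * negBinom b ij.2 : ℝ) : ℂ) * z ^ ij.1) := by
      intro ij _
      have := congrArg Complex.ofReal (succ_mul_negBinom_succ' a ij.1)
      push_cast at this ⊢
      linear_combination (negBinom b ij.2 * z ^ (ij.1 + 1)) * this
    simp only
    rw [sum_congr rfl h1, ← mul_sum, h]
    simp only [Nat.cast_zero, zero_mul, zero_add]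
    rw [mul_assoc, mul_sum]
    congr 1
    refine sum_congr rfl fun l _ => ?_
    rw [succ_mul_negBinom_succ']
    push_cast; ring

lemma val_sum_monomial {ι : Type*} (T : Finset ι) (d : ι → ℕ) (a : ι → ℝ) (z : ℂ) :
    val (∑ i ∈ T, Polynomial.monomial (d i) (a i)) z = ∑ i ∈ T, (a i : ℂ) * z ^ d i := by
  simp [val, map_sum, Polynomial.aeval_monomial]

lemma val_skewPolyG (ε n : ℕ) (x : ℂ) :
    val (skewPolyG ε n) x = x ^ ε * chooseSum (negBinom (3 / 2)) 1 (n + 1) (x ^ 2 - 1) := by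
  rw [skewPolyG, val_sum_monomial, chooseSum_eq_sum _ _ _ (n + 1) _ (by omega),
    ← sum_negBinom_two (3 / 2) (1 / 2) (by norm_num), mul_sum]
  refine sum_congr rfl fun ij _ => ?_
  rw [pow_add, pow_mul]; ring

lemma val_skewPolyF (r : ℝ) (ε n : ℕ) (x : ℂ) :
    val (skewPolyF r ε n) x = x ^ (1 - ε) *
      ((1 - ((1 - ε + 1 : ℕ) : ℂ) * r) * chooseSum (negBinom (3 / 2)) 0 (n + ε) (x ^ 2 - 1) -
        2 * r * x ^ 2 *
          chooseSum (fun l => (l + 1) * negBinom (3 / 2) (l + 1)) 1 (n + ε) (x ^ 2 - 1)) := by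
  rw [skewPolyF, val_sum_monomial, mul_assoc (2 * (r : ℂ)),
    ← sum_negBinom_one (3 / 2) (-1 / 2) (by norm_num),
    ← sum_mul_negBinom_one (3 / 2) (-1 / 2) (by norm_num), mul_sum, mul_sum, ← sum_sub_distrib,
    mul_sum]
  refine sum_congr rfl fun ij _ => ?_
  rw [pow_add, pow_mul]
  push_cast
  ring

lemma sum_range_eq_integral_floor (f : ℕ → ℂ) (J : ℕ) :
    ∑ n ∈ range J, f n = J * ∫ τ in (0 : ℝ)..1, f ⌊(J : ℝ) * τ⌋₊ := by
  rcases Nat.eq_zero_or_pos J with rfl | hJ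
  · simp
  have hJ' : (J : ℝ) ≠ 0 := by positivity
  have hJc : (J : ℂ) ≠ 0 := by exact_mod_cast hJ'
  rw [intervalIntegral.integral_comp_mul_left (fun x => f ⌊x⌋₊) hJ', mul_zero, mul_one,
    Complex.real_smul, Complex.ofReal_inv, Complex.ofReal_natCast, mul_inv_cancel_left₀ hJc]
  have hae : ∀ n : ℕ, ∀ᵐ x : ℝ, x ∈ Set.uIoc (n : ℝ) ((n + 1 : ℕ) : ℝ) → f n = f ⌊x⌋₊ := by
    intro n
    have : ∀ᵐ x : ℝ, x ≠ ((n + 1 : ℕ) : ℝ) := by simp [ae_iff]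
    filter_upwards [this] with x hx hxm
    rw [Set.uIoc_of_le (by push_cast; linarith)] at hxm
    rw [(Nat.floor_eq_iff (le_trans (by positivity) hxm.1.le)).2
      ⟨hxm.1.le, by have := lt_of_le_of_ne hxm.2 hx; push_cast at this; exact this⟩]
  have h := intervalIntegral.sum_integral_adjacent_intervals (f := fun x : ℝ => f ⌊x⌋₊)
    (μ := volume) (a := fun k : ℕ => (k : ℝ)) (n := J) fun k _ =>
      (intervalIntegrable_const (c := f k)).congr_ae
        ((ae_restrict_iff' measurableSet_uIoc).2 (hae k))
  rw [Nat.cast_zero] at h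
  rw [← h]
  refine sum_congr rfl fun n _ => ?_
  rw [← intervalIntegral.integral_congr_ae (hae n), intervalIntegral.integral_const]
  simp

/-- The rescaled polynomials `skewPolyG`, up to a monomial factor. -/
def scaledG (N n : ℕ) (x : ℂ) : ℂ :=
  chooseSum (negBinom (3 / 2)) 1 (n + 1) (x ^ 2 - 1) / (N : ℂ) ^ 1

/-- The polynomials `skewPolyF`, up to a monomial factor. -/
def scaledF (r : ℝ) (N n : ℕ) (x : ℂ) : ℂ :=
  (1 - ((1 - N % 2 + 1 : ℕ) : ℂ) * r) *
      (chooseSum (negBinom (3 / 2)) 0 (n + N % 2) (x ^ 2 - 1) / (N : ℂ) ^ 0) -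
    2 * ((N * r : ℝ) : ℂ) * x ^ 2 * (chooseSum (fun l => (l + 1) * negBinom (3 / 2) (l + 1)) 1
      (n + N % 2) (x ^ 2 - 1) / (N : ℂ) ^ 1)

/-- The summand of the rescaled polynomial kernel, weighted for integration over `[0, 1]`. -/
def kernelSummand (r : ℝ) (N n : ℕ) (x y : ℂ) : ℂ :=
  1 / 2 * (((N / 2 : ℕ) : ℝ) / (N : ℝ) : ℝ) *
    (x ^ (N % 2) * y ^ (1 - N % 2) * (scaledG N n x * scaledF r N n y) -
      y ^ (N % 2) * x ^ (1 - N % 2) * (scaledG N n y * scaledF r N n x))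

lemma scaled_polyKernel_eq_integral {s : ℝ≥0∞} {p : ℕ → Polynomial ℝ} {N : ℕ} (hN : N ≠ 0)
    (hs : (N : ℝ≥0∞) < s) (hp : HasExactDegrees p N) (x y : ℂ) :
    1 / (N : ℂ) ^ 2 * polyKernel s p N x y =
      ∫ τ in (0 : ℝ)..1, kernelSummand (recip s) N ⌊((N / 2 : ℕ) : ℝ) * τ⌋₊ x y := by
  have hN' : (N : ℂ) ≠ 0 := by exact_mod_cast hN
  rw [polyKernel_eq_sum hs hp]
  rcases Nat.eq_zero_or_pos (N / 2) with h0 | h0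
  · simp [h0, kernelSummand]
  have hJ : ((N / 2 : ℕ) : ℂ) ≠ 0 := by exact_mod_cast h0.ne'
  apply mul_left_cancel₀ hJ
  refine Eq.trans ?_ (sum_range_eq_integral_floor (fun n => kernelSummand (recip s) N n x y) (N / 2))
  rw [mul_sum, mul_sum, mul_sum]
  refine sum_congr rfl fun n _ => ?_
  rw [val_skewPolyG, val_skewPolyG, val_skewPolyF, val_skewPolyF, kernelSummand, scaledG, scaledG,
    scaledF, scaledF]
  generalize chooseSum _ _ _ _ = a₁
  generalize chooseSum _ _ _ _ = a₂
  push_cast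
  field_simp

lemma summable_negBinom (j : ℕ) (R : ℝ) (hR : 0 ≤ R) :
    Summable fun l : ℕ => |negBinom (3 / 2) l| * R ^ l / (l + j).factorial := by
  refine Summable.of_nonneg_of_le (fun l => by positivity) (fun l => ?_)
    (summable_add_two_mul_pow_div_factorial R hR)
  rw [abs_of_pos (negBinom_pos (by norm_num) _)]
  have h1 := negBinom_three_halves_le l
  have h2 : (l.factorial : ℝ) ≤ (l + j).factorial := by
    exact_mod_cast Nat.factorial_le (Nat.le_add_right l j)
  gcongr
  linarith

lemma summable_negBinom_succ (R : ℝ) (hR : 0 ≤ R) :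
    Summable fun l : ℕ => |((l : ℝ) + 1) * negBinom (3 / 2) (l + 1)| * R ^ l /
      (l + 1).factorial := by
  refine Summable.of_nonneg_of_le (fun l => by positivity) (fun l => ?_)
    (summable_add_two_mul_pow_div_factorial R hR)
  rw [abs_of_pos (mul_pos (by positivity) (negBinom_pos (by norm_num) _))]
  have h1 := negBinom_three_halves_le (l + 1)
  push_cast at h1
  have h2 : (l : ℝ) + 1 ≠ 0 := by positivity
  calc ((l : ℝ) + 1) * negBinom (3 / 2) (l + 1) * R ^ l / (l + 1).factorial
      = negBinom (3 / 2) (l + 1) * R ^ l / l.factorial := by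
        rw [Nat.factorial_succ]; push_cast; field_simp
    _ ≤ _ := by
        gcongr
        linarith

section Limits

variable {ι : Type*} {L : Filter ι} {N n : ι → ℕ} {u v : ι → ℂ} {u₀ v₀ ξ : ℂ} {r : ι → ℝ}
  {lam τ : ℝ}

lemma tendsto_inv_natCast (hN : Tendsto N L atTop) : Tendsto (fun i => 1 / (N i : ℂ)) L (𝓝 0) := by
  have : Tendsto (fun k : ℕ => 1 / (k : ℂ)) atTop (𝓝 0) := tendsto_one_div_atTop_nhds_zero_nat
  exact this.comp hN

lemma tendsto_add_div (hN : Tendsto N L atTop) (hu : Tendsto u L (𝓝 u₀)) :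
    Tendsto (fun i => ξ + u i / N i) L (𝓝 ξ) := by
  have := (hu.mul (tendsto_inv_natCast hN)).const_add ξ
  simpa [div_eq_mul_inv] using this

lemma tendsto_mul_sq_sub_one (hξ : ξ = 1 ∨ ξ = -1) (hN : Tendsto N L atTop)
    (hu : Tendsto u L (𝓝 u₀)) :
    Tendsto (fun i => (N i : ℂ) * ((ξ + u i / N i) ^ 2 - 1)) L (𝓝 (2 * (u₀ * ξ))) := by
  have hξ2 : ξ ^ 2 = 1 := by rcases hξ with rfl | rfl <;> norm_num
  have h := ((hu.mul_const ξ).const_mul 2).add ((hu.pow 2).mul (tendsto_inv_natCast hN))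
  rw [mul_zero, add_zero] at h
  refine h.congr' ?_
  filter_upwards [hN.eventually_ge_atTop 1] with i hi
  have hi' : (N i : ℂ) ≠ 0 := by exact_mod_cast (show N i ≠ 0 by omega)
  field_simp
  linear_combination (-(N i : ℂ) ^ 2) * hξ2

lemma tendsto_scaledG (hξ : ξ = 1 ∨ ξ = -1) (hN : Tendsto N L atTop) (hu : Tendsto u L (𝓝 u₀))
    (hn : Tendsto (fun i => (n i : ℝ) / N i) L (𝓝 (τ / 2))) (hnN : ∀ᶠ i in L, n i + 1 ≤ N i) :
    Tendsto (fun i => scaledG (N i) (n i) (ξ + u i / N i)) L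
      (𝓝 (τ * (deriv M (u₀ * ξ * τ) - M (u₀ * ξ * τ)))) := by
  have h1 : Tendsto (fun i => ((n i + 1 : ℕ) : ℝ) / N i) L (𝓝 (τ / 2)) := by
    have h0 : Tendsto (fun i => (1 : ℝ) / N i) L (𝓝 0) :=
      tendsto_const_nhds.div_atTop (tendsto_natCast_atTop_atTop.comp hN)
    have := hn.add h0
    rw [add_zero] at this
    refine this.congr fun i => ?_
    push_cast; ring
  have h := tendsto_chooseSum (summable_negBinom 1) hN h1 hnN (tendsto_mul_sq_sub_one hξ hN hu)
  convert h using 2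
  · rfl
  rw [deriv_M_sub_M, ← tsum_mul_left, ← tsum_mul_left]
  refine tsum_congr fun l => ?_
  push_cast
  generalize u₀ * ξ = w
  rw [mul_pow w, div_pow, mul_pow 2, pow_succ, pow_succ (2 : ℂ)]
  field_simp

lemma tendsto_scaledF (hξ : ξ = 1 ∨ ξ = -1) (hN : Tendsto N L atTop) (hu : Tendsto u L (𝓝 u₀))
    (hn : Tendsto (fun i => ((n i + N i % 2 : ℕ) : ℝ) / N i) L (𝓝 (τ / 2)))
    (hnN : ∀ᶠ i in L, n i + N i % 2 ≤ N i)
    (hr : Tendsto (fun i => (N i : ℝ) * r i) L (𝓝 lam)) :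
    Tendsto (fun i => scaledF (r i) (N i) (n i) (ξ + u i / N i)) L
      (𝓝 (M (u₀ * ξ * τ) - lam * τ * deriv M (u₀ * ξ * τ))) := by
  have hξ2 : ξ ^ 2 = 1 := by rcases hξ with rfl | rfl <;> norm_num
  have hζ := tendsto_mul_sq_sub_one hξ hN hu
  have h0 := tendsto_chooseSum (summable_negBinom 0) hN hn hnN hζ
  have h1 := tendsto_chooseSum (d := fun l => (l + 1) * negBinom (3 / 2) (l + 1)) (j := 1)
    summable_negBinom_succ hN hn hnN hζ
  have hrc : Tendsto (fun i => ((N i * r i : ℝ) : ℂ)) L (𝓝 (lam : ℂ)) :=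
    (Complex.continuous_ofReal.tendsto _).comp hr
  have hr0 : Tendsto (fun i => ((1 - N i % 2 + 1 : ℕ) : ℂ) * (r i : ℂ)) L (𝓝 0) := by
    have h2 : Tendsto (fun i => 2 * ‖((N i * r i : ℝ) : ℂ) * (1 / (N i : ℂ))‖) L (𝓝 0) := by
      have := ((hrc.mul (tendsto_inv_natCast hN)).norm).const_mul 2
      simpa using this
    refine squeeze_zero_norm' ?_ h2
    filter_upwards [hN.eventually_ge_atTop 1] with i hi
    have hi' : (N i : ℂ) ≠ 0 := by exact_mod_cast (show N i ≠ 0 by omega)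
    have e : ((N i * r i : ℝ) : ℂ) * (1 / (N i : ℂ)) = r i := by push_cast; field_simp
    rw [e, norm_mul, Complex.norm_natCast]
    gcongr
    exact_mod_cast (show 1 - N i % 2 + 1 ≤ 2 by omega)
  have h := ((hr0.const_sub 1).mul h0).sub
    (((hrc.const_mul 2).mul ((tendsto_add_div (ξ := ξ) hN hu).pow 2)).mul h1)
  convert h using 2
  · rfl
  rw [sub_zero, one_mul, hξ2, mul_one, M_eq_tsum, deriv_M, ← tsum_mul_left, ← tsum_mul_left]
  congr 1
  · refine tsum_congr fun l => ?_
    push_cast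
    generalize u₀ * ξ = w
    rw [mul_pow w, div_pow, mul_pow 2, add_zero]
    field_simp
  · refine tsum_congr fun l => ?_
    have : (l : ℂ) + 1 ≠ 0 := by exact_mod_cast l.succ_ne_zero
    rw [Nat.factorial_succ]
    push_cast
    generalize u₀ * ξ = w
    rw [mul_pow w, div_pow, mul_pow 2, pow_succ, pow_succ (2 : ℂ)]
    field_simp

lemma tendsto_pow_mul_pow {x y : ι → ℂ} {e : ι → ℕ} (hx : Tendsto x L (𝓝 ξ))
    (hy : Tendsto y L (𝓝 ξ)) (he : ∀ i, e i < 2) :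
    Tendsto (fun i => x i ^ e i * y i ^ (1 - e i)) L (𝓝 ξ) := by
  have h : Tendsto (fun i => ‖x i - ξ‖ + ‖y i - ξ‖) L (𝓝 0) := by
    have := (hx.sub_const ξ).norm.add (hy.sub_const ξ).norm
    simpa using this
  rw [tendsto_iff_norm_sub_tendsto_zero]
  refine squeeze_zero (fun i => norm_nonneg _) (fun i => ?_) h
  have := he i
  obtain h1 | h1 : e i = 0 ∨ e i = 1 := by omega
  · rw [h1]; simp
  · rw [h1]; simp

lemma tendsto_half_div (hN : Tendsto N L atTop) :
    Tendsto (fun i => ((N i / 2 : ℕ) : ℝ) / (N i : ℝ)) L (𝓝 (1 / 2)) := by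
  have h := (tendsto_nat_floor_mul_div_atTop (R := ℝ) (a := 1 / 2) (by norm_num)).comp
    (tendsto_natCast_atTop_atTop.comp hN)
  refine h.congr fun i => ?_
  simp only [Function.comp_apply]
  rw [← Nat.floor_div_eq_div (K := ℝ)]
  congr 3
  push_cast; ring

lemma tendsto_floor_half_div (hN : Tendsto N L atTop) (hτ : 0 ≤ τ) :
    Tendsto (fun i => (⌊((N i / 2 : ℕ) : ℝ) * τ⌋₊ : ℝ) / (N i : ℝ)) L (𝓝 (τ / 2)) := by
  have hJ : Tendsto (fun i => N i / 2) L atTop := by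
    refine Tendsto.comp (g := fun k : ℕ => k / 2) ?_ hN
    exact Nat.tendsto_div_const_atTop two_ne_zero
  have h := (tendsto_nat_floor_mul_div_atTop (R := ℝ) (a := τ) hτ).comp
    (tendsto_natCast_atTop_atTop.comp hJ)
  have h2 := h.mul (tendsto_half_div hN)
  rw [mul_one_div] at h2
  refine h2.congr' ?_
  filter_upwards [hN.eventually_ge_atTop 2] with i hi
  have h3 : ((N i / 2 : ℕ) : ℝ) ≠ 0 := by
    exact_mod_cast (show N i / 2 ≠ 0 by omega)
  simp only [Function.comp_apply]
  rw [mul_comm τ]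
  field_simp

lemma floor_half_mul_le {K : ℕ} (hτ1 : τ ≤ 1) : ⌊((K / 2 : ℕ) : ℝ) * τ⌋₊ ≤ K / 2 := by
  have : ((K / 2 : ℕ) : ℝ) * τ ≤ ((K / 2 : ℕ) : ℝ) := mul_le_of_le_one_right (by positivity) hτ1
  exact (Nat.floor_le_floor this).trans (Nat.floor_natCast _).le

lemma tendsto_kernelSummand (hξ : ξ = 1 ∨ ξ = -1) (hN : Tendsto N L atTop)
    (hu : Tendsto u L (𝓝 u₀)) (hv : Tendsto v L (𝓝 v₀))
    (hr : Tendsto (fun i => (N i : ℝ) * r i) L (𝓝 lam)) (hτ0 : 0 ≤ τ) (hτ1 : τ ≤ 1) :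
    Tendsto (fun i => kernelSummand (r i) (N i) ⌊((N i / 2 : ℕ) : ℝ) * τ⌋₊ (ξ + u i / N i)
      (ξ + v i / N i)) L (𝓝 (ξ / 4 * ((τ : ℂ) * (1 - (lam : ℂ) * (τ : ℂ)) *
        (deriv M (u₀ * ξ * τ) * M (v₀ * ξ * τ) - M (u₀ * ξ * τ) * deriv M (v₀ * ξ * τ))))) := by
  have hn := tendsto_floor_half_div hN hτ0
  have hnN : ∀ᶠ i in L, ⌊((N i / 2 : ℕ) : ℝ) * τ⌋₊ + 1 ≤ N i := by
    filter_upwards [hN.eventually_ge_atTop 2] with i hi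
    have := floor_half_mul_le (K := N i) hτ1
    omega
  have hnN' : ∀ᶠ i in L, ⌊((N i / 2 : ℕ) : ℝ) * τ⌋₊ + N i % 2 ≤ N i :=
    hnN.mono fun i hi => by omega
  have hn' : Tendsto (fun i => ((⌊((N i / 2 : ℕ) : ℝ) * τ⌋₊ + N i % 2 : ℕ) : ℝ) / N i) L
      (𝓝 (τ / 2)) := by
    have h0 : Tendsto (fun i => ((N i % 2 : ℕ) : ℝ) / N i) L (𝓝 0) := by
      have h1 : Tendsto (fun i => (1 : ℝ) / N i) L (𝓝 0) :=
        tendsto_const_nhds.div_atTop (tendsto_natCast_atTop_atTop.comp hN)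
      refine squeeze_zero (fun i => by positivity) (fun i => ?_) h1
      gcongr
      exact_mod_cast (show N i % 2 ≤ 1 by omega)
    have := hn.add h0
    rw [add_zero] at this
    refine this.congr fun i => ?_
    push_cast; ring
  have hG := tendsto_scaledG hξ hN hu hn hnN
  have hG' := tendsto_scaledG hξ hN hv hn hnN
  have hF := tendsto_scaledF hξ hN hu hn' hnN' hr
  have hF' := tendsto_scaledF hξ hN hv hn' hnN' hr
  have hx := tendsto_add_div (ξ := ξ) hN hu
  have hy := tendsto_add_div (ξ := ξ) hN hv
  have hmod : ∀ i, N i % 2 < 2 := fun i => Nat.mod_lt _ (by norm_num)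
  have hJ : Tendsto (fun i => ((((N i / 2 : ℕ) : ℝ) / (N i : ℝ) : ℝ) : ℂ)) L
      (𝓝 ((1 / 2 : ℝ) : ℂ)) := (Complex.continuous_ofReal.tendsto _).comp (tendsto_half_div hN)
  have h := (hJ.const_mul (1 / 2)).mul
    (((tendsto_pow_mul_pow hx hy hmod).mul (hG.mul hF')).sub
      ((tendsto_pow_mul_pow hy hx hmod).mul (hG'.mul hF)))
  convert h using 2
  · rfl
  push_cast
  ring

end Limits

lemma exists_bound_kernelSummand (R : ℝ) (hR : 0 ≤ R) : ∃ C : ℝ, ∀ (r : ℝ) (N n : ℕ) (x y : ℂ),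
    N ≠ 0 → n + 1 ≤ N → 0 ≤ r → N * r ≤ 1 → ‖x‖ ≤ 2 → ‖y‖ ≤ 2 → ‖(N : ℂ) * (x ^ 2 - 1)‖ ≤ R →
      ‖(N : ℂ) * (y ^ 2 - 1)‖ ≤ R → ‖kernelSummand r N n x y‖ ≤ C := by
  obtain ⟨A, hA⟩ : ∃ A, A = ∑' l : ℕ, |negBinom (3 / 2) l| * R ^ l / (l + 1).factorial := ⟨_, rfl⟩
  obtain ⟨B, hB⟩ : ∃ B, B = ∑' l : ℕ, |negBinom (3 / 2) l| * R ^ l / (l + 0).factorial := ⟨_, rfl⟩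
  obtain ⟨D, hD⟩ : ∃ D, D = ∑' l : ℕ, |((l : ℝ) + 1) * negBinom (3 / 2) (l + 1)| * R ^ l /
    (l + 1).factorial := ⟨_, rfl⟩
  have hA0 : 0 ≤ A := hA ▸ tsum_nonneg fun l => by positivity
  have hB0 : 0 ≤ B := hB ▸ tsum_nonneg fun l => by positivity
  have hD0 : 0 ≤ D := hD ▸ tsum_nonneg fun l => by positivity
  refine ⟨1 / 2 * 1 * (2 * 2 * (A * (3 * B + 2 * 1 * 2 ^ 2 * D)) +
    2 * 2 * (A * (3 * B + 2 * 1 * 2 ^ 2 * D))), fun r N n x y hN hn hr0 hr1 hx hy hxR hyR => ?_⟩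
  have hG : ∀ z : ℂ, ‖(N : ℂ) * (z ^ 2 - 1)‖ ≤ R → ‖scaledG N n z‖ ≤ A := fun z hz => by
    rw [scaledG, hA]
    exact norm_chooseSum_le (summable_negBinom 1 R hR) hN hn hz
  have hmod : N % 2 < 2 := Nat.mod_lt _ (by norm_num)
  have hr1' : r ≤ 1 := by
    have : (1 : ℝ) ≤ N := by exact_mod_cast Nat.one_le_iff_ne_zero.2 hN
    nlinarith
  have hF : ∀ z : ℂ, ‖z‖ ≤ 2 → ‖(N : ℂ) * (z ^ 2 - 1)‖ ≤ R →
      ‖scaledF r N n z‖ ≤ 3 * B + 2 * 1 * 2 ^ 2 * D := fun z hz2 hz => by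
    rw [scaledF]
    refine (norm_sub_le _ _).trans (add_le_add ?_ ?_)
    · rw [norm_mul]
      have h1 : ‖(1 - ((1 - N % 2 + 1 : ℕ) : ℂ) * r)‖ ≤ 3 := by
        refine (norm_sub_le _ _).trans ?_
        rw [norm_one, norm_mul, Complex.norm_natCast, Complex.norm_real, Real.norm_of_nonneg hr0]
        have h2 : ((1 - N % 2 + 1 : ℕ) : ℝ) ≤ 2 := by
          exact_mod_cast (show 1 - N % 2 + 1 ≤ 2 by omega)
        have : ((1 - N % 2 + 1 : ℕ) : ℝ) * r ≤ 2 * 1 := by gcongr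
        linarith
      have h2 := norm_chooseSum_le (m := n + N % 2) (summable_negBinom 0 R hR) hN (by omega) hz
      rw [← hB] at h2
      gcongr
    · have h2 := norm_chooseSum_le (d := fun l => (l + 1) * negBinom (3 / 2) (l + 1)) (j := 1)
        (m := n + N % 2) (summable_negBinom_succ R hR) hN (by omega) hz
      rw [← hD] at h2
      rw [norm_mul, norm_mul, norm_mul, norm_pow, Complex.norm_real,
        Real.norm_of_nonneg (by positivity), Complex.norm_ofNat]
      gcongr
  have hpow : ∀ (z : ℂ) (k : ℕ), k ≤ 1 → ‖z‖ ≤ 2 → ‖z ^ k‖ ≤ 2 := fun z k hk hz => by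
    rw [norm_pow]
    obtain rfl | rfl : k = 0 ∨ k = 1 := by omega
    · norm_num
    · simpa using hz
  have hJ : ‖((((N / 2 : ℕ) : ℝ) / (N : ℝ) : ℝ) : ℂ)‖ ≤ 1 := by
    rw [Complex.norm_real, Real.norm_of_nonneg (by positivity)]
    apply div_le_one_of_le₀ _ (by positivity)
    exact_mod_cast Nat.div_le_self N 2
  rw [kernelSummand, norm_mul, norm_mul]
  refine mul_le_mul (mul_le_mul (by norm_num) hJ (norm_nonneg _) (by norm_num))
    ((norm_sub_le _ _).trans ?_) (norm_nonneg _) (by norm_num)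
  rw [norm_mul, norm_mul, norm_mul, norm_mul, norm_mul, norm_mul]
  have h1 := hpow x (N % 2) (by omega) hx
  have h2 := hpow y (N % 2) (by omega) hy
  have h3 := hpow x (1 - N % 2) (by omega) hx
  have h4 := hpow y (1 - N % 2) (by omega) hy
  have h5 := hG x hxR
  have h6 := hG y hyR
  have h7 := hF x hx hxR
  have h8 := hF y hy hyR
  gcongr

lemma tendsto_mul_recip {s : ℕ → ℝ≥0∞} {lam : ℝ}
    (hlam : Tendsto (fun N : ℕ => ((N : ℝ≥0∞) / s N).toReal) atTop (𝓝 lam)) :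
    Tendsto (fun N : ℕ => (N : ℝ) * recip (s N)) atTop (𝓝 lam) := by
  refine hlam.congr fun N => ?_
  rw [ENNReal.toReal_div, ENNReal.toReal_natCast, recip, div_eq_mul_inv]

lemma mul_recip_le_one {s : ℝ≥0∞} {N : ℕ} (hs : (N : ℝ≥0∞) < s) : (N : ℝ) * recip s ≤ 1 := by
  have := recip_pos_den hs
  linarith

/-- Continuous convergence of the rescaled polynomial kernel. -/
lemma tendsto_scaled_polyKernel {s : ℕ → ℝ≥0∞} (hs : ∀ N : ℕ, (N : ℝ≥0∞) < s N) {lam : ℝ}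
    (hlam : Tendsto (fun N : ℕ => ((N : ℝ≥0∞) / s N).toReal) atTop (𝓝 lam))
    {p : ℕ → Polynomial ℝ} (hp : ∀ n : ℕ, (p n).Monic ∧ (p n).natDegree = n)
    {ξ : ℂ} (hξ : ξ = 1 ∨ ξ = -1) (q : ℂ × ℂ) :
    Tendsto (fun i : ℕ × ℂ × ℂ => 1 / (i.1 : ℂ) ^ 2 *
      polyKernel (s i.1) p i.1 (ξ + i.2.1 / i.1) (ξ + i.2.2 / i.1)) (atTop ×ˢ 𝓝 q)
      (𝓝 (polyLimit lam ξ q.1 q.2)) := by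
  have hN : Tendsto (fun i : ℕ × ℂ × ℂ => i.1) (atTop ×ˢ 𝓝 q) atTop := tendsto_fst
  have hq : Tendsto (fun i : ℕ × ℂ × ℂ => i.2) (atTop ×ˢ 𝓝 q) (𝓝 q) := tendsto_snd
  have hu : Tendsto (fun i : ℕ × ℂ × ℂ => i.2.1) (atTop ×ˢ 𝓝 q) (𝓝 q.1) :=
    (continuous_fst.tendsto q).comp hq
  have hv : Tendsto (fun i : ℕ × ℂ × ℂ => i.2.2) (atTop ×ˢ 𝓝 q) (𝓝 q.2) :=
    (continuous_snd.tendsto q).comp hq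
  have hr : Tendsto (fun i : ℕ × ℂ × ℂ => (i.1 : ℝ) * recip (s i.1)) (atTop ×ˢ 𝓝 q) (𝓝 lam) :=
    (tendsto_mul_recip hlam).comp hN
  have hnξ : ‖ξ‖ = 1 := by rcases hξ with rfl | rfl <;> simp
  have hev : ∀ {w : ℕ × ℂ × ℂ → ℂ} {w₀ : ℂ}, Tendsto w (atTop ×ˢ 𝓝 q) (𝓝 w₀) →
      ∀ᶠ i in atTop ×ˢ 𝓝 q, ‖ξ + w i / i.1‖ ≤ 2 ∧
        ‖(i.1 : ℂ) * ((ξ + w i / i.1) ^ 2 - 1)‖ ≤ ‖2 * (w₀ * ξ)‖ + 1 := fun hw =>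
    (((tendsto_add_div (ξ := ξ) hN hw).norm.eventually_lt_const
      (show ‖ξ‖ < 2 by rw [hnξ]; norm_num)).mono fun i hi => hi.le).and
      (((tendsto_mul_sq_sub_one hξ hN hw).norm.eventually_lt_const (lt_add_one _)).mono
        fun i hi => hi.le)
  obtain ⟨C, hC⟩ := exists_bound_kernelSummand (max (‖2 * (q.1 * ξ)‖ + 1) (‖2 * (q.2 * ξ)‖ + 1))
    (by positivity)
  have key : Tendsto (fun i : ℕ × ℂ × ℂ => ∫ τ in (0 : ℝ)..1,
      kernelSummand (recip (s i.1)) i.1 ⌊((i.1 / 2 : ℕ) : ℝ) * τ⌋₊ (ξ + i.2.1 / i.1)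
        (ξ + i.2.2 / i.1)) (atTop ×ˢ 𝓝 q) (𝓝 (polyLimit lam ξ q.1 q.2)) := by
    rw [polyLimit, ← intervalIntegral.integral_const_mul]
    refine intervalIntegral.tendsto_integral_filter_of_dominated_convergence (fun _ => C) ?_ ?_
      intervalIntegrable_const ?_
    · refine Eventually.of_forall fun i => Measurable.aestronglyMeasurable ?_
      exact (measurable_from_nat (f := fun n => kernelSummand (recip (s i.1)) i.1 n
        (ξ + i.2.1 / i.1) (ξ + i.2.2 / i.1))).comp (Nat.measurable_floor.comp (by fun_prop))
    · filter_upwards [hev hu, hev hv, hN.eventually_ge_atTop 2] with i hi hi' hiN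
      refine Eventually.of_forall fun τ hτ => ?_
      rw [Set.uIoc_of_le zero_le_one] at hτ
      have hfl := floor_half_mul_le (K := i.1) hτ.2
      exact hC _ _ _ _ _ (by omega) (by omega) (inv_nonneg.2 ENNReal.toReal_nonneg)
        (mul_recip_le_one (hs i.1)) hi.1 hi'.1 (hi.2.trans (le_max_left _ _))
        (hi'.2.trans (le_max_right _ _))
    · refine Eventually.of_forall fun τ hτ => ?_
      rw [Set.uIoc_of_le zero_le_one] at hτ
      exact tendsto_kernelSummand hξ hN hu hv hr hτ.1.le hτ.2
  refine key.congr' ?_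
  filter_upwards [hN.eventually_ge_atTop 1] with i hi
  rw [scaled_polyKernel_eq_integral (by omega) (hs i.1) (hasExactDegrees_of_monic hp i.1)]

/-- Continuous convergence at the points of a compact set implies uniform convergence. -/
lemma tendstoUniformlyOn_of_tendsto_prod {α β : Type*} [TopologicalSpace α]
    [PseudoMetricSpace β] {F : ℕ → α → β} {f : α → β} {K : Set α} (hK : IsCompact K)
    (hF : ∀ x ∈ K, Tendsto (fun i : ℕ × α => F i.1 i.2) (atTop ×ˢ 𝓝 x) (𝓝 (f x)))
    (hf : ∀ x ∈ K, ContinuousAt f x) : TendstoUniformlyOn F f atTop K := by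
  rw [← tendstoLocallyUniformlyOn_iff_tendstoUniformlyOn_of_compact hK,
    tendstoLocallyUniformlyOn_iff_filter]
  intro x hx
  rw [Metric.tendstoUniformlyOnFilter_iff]
  intro ε hε
  have h1 : Tendsto (fun i : ℕ × α => dist (f i.2) (F i.1 i.2)) (atTop ×ˢ 𝓝 x)
      (𝓝 (dist (f x) (f x))) := ((hf x hx).tendsto.comp tendsto_snd).dist (hF x hx)
  rw [dist_self] at h1
  exact (h1.eventually_lt_const hε).filter_mono (prod_mono le_rfl nhdsWithin_le_nhds)

lemma continuous_polyLimit (lam : ℝ) (ξ : ℂ) :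
    Continuous fun q : ℂ × ℂ => polyLimit lam ξ q.1 q.2 := by
  have h1 := differentiable_M.continuous
  have h2 := continuous_deriv_M
  unfold polyLimit
  refine continuous_const.mul
    (intervalIntegral.continuous_parametric_intervalIntegral_of_continuous' ?_ 0 1)
  unfold Function.uncurry
  fun_prop

lemma omega_of_pos {lam : ℝ} (h : 0 < lam) (τ : ℂ) :
    omega lam τ = Real.exp (-(1 / lam * max 0 τ.re)) := by
  rw [omega, if_neg h.ne']
  rcases le_total τ.re 0 with h0 | h0
  · rw [max_eq_left h0, mul_zero, neg_zero, Real.exp_zero, min_eq_left]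
    exact Real.one_le_exp (div_nonneg (by linarith) h.le)
  · rw [max_eq_right h0, min_eq_right]
    · congr 1; ring
    · exact Real.exp_le_one_iff.2 (div_nonpos_of_nonpos_of_nonneg (by linarith) h.le)

lemma continuous_omega {lam : ℝ} (h : 0 < lam) : Continuous (omega lam) := by
  rw [show omega lam = _ from funext (omega_of_pos h)]
  fun_prop

section Weights

variable {ι : Type*} {L : Filter ι} {N : ι → ℕ} {u v : ι → ℂ} {u₀ v₀ ξ : ℂ}

lemma tendsto_mul_log_norm (hξ : ξ = 1 ∨ ξ = -1) (hN : Tendsto N L atTop)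
    (hu : Tendsto u L (𝓝 u₀)) :
    Tendsto (fun i => (N i : ℝ) * Real.log ‖ξ + u i / N i‖) L (𝓝 (u₀ * ξ).re) := by
  have hnξ : ‖ξ‖ = 1 := by rcases hξ with rfl | rfl <;> simp
  have hsq : ∀ z : ℂ, ‖ξ + z‖ ^ 2 = 1 + 2 * (z * ξ).re + ‖z‖ ^ 2 := fun z => by
    rw [Complex.sq_norm, Complex.sq_norm, Complex.normSq_apply, Complex.normSq_apply]
    rcases hξ with rfl | rfl <;> simp <;> ring
  have hρ : Tendsto (fun i => ‖ξ + u i / N i‖ ^ 2) L (𝓝 1) := by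
    have := ((tendsto_add_div (ξ := ξ) hN hu).norm).pow 2
    rwa [hnξ, one_pow] at this
  have hinv : Tendsto (fun i => (1 : ℝ) / N i) L (𝓝 0) :=
    tendsto_const_nhds.div_atTop (tendsto_natCast_atTop_atTop.comp hN)
  have hre : Tendsto (fun i => (u i * ξ).re) L (𝓝 (u₀ * ξ).re) :=
    (Complex.continuous_re.tendsto _).comp (hu.mul_const ξ)
  have hup : Tendsto (fun i => (N i : ℝ) * (‖ξ + u i / N i‖ ^ 2 - 1) / 2) L
      (𝓝 (u₀ * ξ).re) := by
    have h := hre.add (((hu.norm.pow 2).mul hinv).div_const 2)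
    rw [mul_zero, zero_div, add_zero] at h
    refine h.congr' ?_
    filter_upwards [hN.eventually_ge_atTop 1] with i hi
    have hi' : (N i : ℝ) ≠ 0 := by exact_mod_cast (show N i ≠ 0 by omega)
    have e : (u i / N i * ξ).re = (u i * ξ).re / N i := by
      rw [← Complex.div_natCast_re, div_mul_eq_mul_div]
    rw [hsq, e, norm_div, Complex.norm_natCast]
    field_simp
    ring
  have hlow : Tendsto (fun i => (N i : ℝ) * (‖ξ + u i / N i‖ ^ 2 - 1) / 2 *
      (‖ξ + u i / N i‖ ^ 2)⁻¹) L (𝓝 (u₀ * ξ).re) := by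
    have := hup.mul (hρ.inv₀ one_ne_zero)
    rwa [inv_one, mul_one] at this
  have hpos := hρ.eventually_const_lt one_pos
  refine tendsto_of_tendsto_of_tendsto_of_le_of_le' hlow hup ?_ ?_
  · filter_upwards [hpos] with i hi
    have h1 := Real.one_sub_inv_le_log_of_pos hi
    rw [Real.log_pow] at h1
    have h2 : (N i : ℝ) * (‖ξ + u i / N i‖ ^ 2 - 1) / 2 * (‖ξ + u i / N i‖ ^ 2)⁻¹ =
        N i * ((1 - (‖ξ + u i / N i‖ ^ 2)⁻¹) / 2) := by
      linear_combination (N i : ℝ) / 2 * mul_inv_cancel₀ hi.ne'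
    rw [h2]
    push_cast at h1
    gcongr
    linarith
  · filter_upwards [hpos] with i hi
    have h1 := Real.log_le_sub_one_of_pos hi
    rw [Real.log_pow] at h1
    push_cast at h1
    rw [mul_div_assoc]
    gcongr
    linarith

lemma max_one_rpow_neg {ρ t : ℝ} (hρ : 0 < ρ) {n : ℕ} (hn : n ≠ 0) :
    max 1 ρ ^ (-t) = Real.exp (-(t / n * max 0 (n * Real.log ρ))) := by
  have hn' : (0 : ℝ) < n := by exact_mod_cast Nat.pos_of_ne_zero hn
  rw [Real.rpow_def_of_pos (by positivity)]
  congr 1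
  have : max 0 (n * Real.log ρ) = n * Real.log (max 1 ρ) := by
    rcases le_total ρ 1 with h | h
    · rw [max_eq_left h, Real.log_one, mul_zero, max_eq_left]
      exact mul_nonpos_of_nonneg_of_nonpos hn'.le (Real.log_nonpos hρ.le h)
    · rw [max_eq_right h, max_eq_right (mul_nonneg hn'.le (Real.log_nonneg h))]
  rw [this]
  field_simp

variable {s : ℕ → ℝ≥0∞} {lam : ℝ}

lemma eventually_norm_pos (hξ : ξ = 1 ∨ ξ = -1) (hN : Tendsto N L atTop)
    (hu : Tendsto u L (𝓝 u₀)) : ∀ᶠ i in L, 0 < ‖ξ + u i / N i‖ := by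
  have hnξ : ‖ξ‖ = 1 := by rcases hξ with rfl | rfl <;> simp
  exact (tendsto_add_div (ξ := ξ) hN hu).norm.eventually_const_lt (by rw [hnξ]; exact one_pos)

lemma tendsto_weight_of_pos (hξ : ξ = 1 ∨ ξ = -1) (hN : Tendsto N L atTop)
    (hu : Tendsto u L (𝓝 u₀)) (hlam : Tendsto (fun n : ℕ => (n : ℝ) * recip (s n)) atTop (𝓝 lam))
    (h0 : 0 < lam) :
    Tendsto (fun i => weight (s (N i)) (ξ + u i / N i)) L (𝓝 (omega lam (u₀ * ξ))) := by
  have hr := hlam.comp hN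
  have h : Tendsto (fun i => Real.exp (-(1 / (N i * recip (s (N i))) *
      max 0 (N i * Real.log ‖ξ + u i / N i‖)))) L (𝓝 (omega lam (u₀ * ξ))) := by
    rw [omega_of_pos h0]
    exact (Real.continuous_exp.tendsto _).comp ((tendsto_const_nhds.div hr h0.ne').mul
      (tendsto_const_nhds.max (tendsto_mul_log_norm hξ hN hu))).neg
  refine h.congr' ?_
  filter_upwards [eventually_norm_pos hξ hN hu, hN.eventually_ge_atTop 1,
    hr.eventually_const_lt h0] with i hi hi1 hi2
  have hs : s (N i) ≠ ⊤ := fun hs => by simp [recip, hs] at hi2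
  have hs0 : (s (N i)).toReal ≠ 0 := fun hs => by simp [recip, hs] at hi2
  rw [weight, if_neg hs, max_one_rpow_neg hi (show N i ≠ 0 by omega), recip]
  congr 3
  field_simp

lemma tendsto_weight_of_re_neg (hξ : ξ = 1 ∨ ξ = -1) (hN : Tendsto N L atTop)
    (hu : Tendsto u L (𝓝 u₀)) (h0 : (u₀ * ξ).re < 0) :
    Tendsto (fun i => weight (s (N i)) (ξ + u i / N i)) L (𝓝 1) := by
  refine tendsto_const_nhds.congr' ?_
  filter_upwards [(tendsto_mul_log_norm hξ hN hu).eventually_lt_const h0] with i hi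
  refine (weight_eq_one _ ?_).symm
  by_contra! h
  exact hi.not_ge (mul_nonneg (by positivity) (Real.log_nonneg h.le))

lemma tendsto_weight_of_re_pos (hξ : ξ = 1 ∨ ξ = -1) (hN : Tendsto N L atTop)
    (hu : Tendsto u L (𝓝 u₀)) (hlam : Tendsto (fun n : ℕ => (n : ℝ) * recip (s n)) atTop (𝓝 0))
    (hs : ∀ n : ℕ, (n : ℝ≥0∞) < s n) (h0 : 0 < (u₀ * ξ).re) :
    Tendsto (fun i => weight (s (N i)) (ξ + u i / N i)) L (𝓝 0) := by
  have hr := hlam.comp hN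
  have hlog := tendsto_mul_log_norm hξ hN hu
  have hexp : Tendsto (fun k : ℝ => Real.exp (-(k * ((u₀ * ξ).re / 2)))) atTop (𝓝 0) :=
    Real.tendsto_exp_neg_atTop_nhds_zero.comp (tendsto_id.atTop_mul_const (by positivity))
  refine tendsto_order.2 ⟨fun a ha => Eventually.of_forall fun i =>
    ha.trans_le (weight_nonneg _ _), fun ε hε => ?_⟩
  obtain ⟨k, hk, hk0⟩ := ((hexp.eventually_lt_const hε).and (eventually_gt_atTop 0)).exists
  filter_upwards [eventually_norm_pos hξ hN hu, hN.eventually_ge_atTop 1,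
    hr.eventually_lt_const (inv_pos.2 hk0), hlog.eventually_const_lt (half_lt_self h0)]
    with i hi hi1 hi2 hi3
  have hle : ENNReal.ofReal (k * N i) ≤ s (N i) := by
    by_cases hst : s (N i) = ⊤
    · simp [hst]
    · refine ENNReal.ofReal_le_of_le_toReal ?_
      have h1 := natCast_lt_toReal hst (hs (N i))
      have h2 : 0 < (s (N i)).toReal := lt_of_le_of_lt (by positivity) h1
      simp only [Function.comp_apply, recip] at hi2
      rw [← div_eq_mul_inv, div_lt_iff₀ h2, inv_mul_eq_div, lt_div_iff₀ hk0] at hi2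
      linarith
  have hNi : (N i : ℝ) ≠ 0 := by exact_mod_cast (show N i ≠ 0 by omega)
  refine (weight_le_max_rpow hle _).trans_lt (lt_of_le_of_lt ?_ hk)
  rw [max_one_rpow_neg hi (show N i ≠ 0 by omega), Real.exp_le_exp, mul_div_assoc, div_self hNi,
    mul_one]
  gcongr
  exact hi3.le.trans (le_max_right _ _)

lemma tendsto_weight_mul_weight_of_re_pos (hξ : ξ = 1 ∨ ξ = -1) (hN : Tendsto N L atTop)
    (hu : Tendsto u L (𝓝 u₀)) (hlam : Tendsto (fun n : ℕ => (n : ℝ) * recip (s n)) atTop (𝓝 0))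
    (hs : ∀ n : ℕ, (n : ℝ≥0∞) < s n) (h0 : 0 < (u₀ * ξ).re) (w : ι → ℂ) :
    Tendsto (fun i => weight (s (N i)) (ξ + u i / N i) * weight (s (N i)) (w i)) L (𝓝 0) :=
  squeeze_zero (fun _ => mul_nonneg (weight_nonneg _ _) (weight_nonneg _ _))
    (fun _ => mul_le_of_le_one_right (weight_nonneg _ _) (weight_le_one _ _))
    (tendsto_weight_of_re_pos hξ hN hu hlam hs h0)

lemma tendsto_weight_mul_weight_of_zero (hξ : ξ = 1 ∨ ξ = -1) (hN : Tendsto N L atTop)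
    (hu : Tendsto u L (𝓝 u₀)) (hv : Tendsto v L (𝓝 v₀))
    (hlam : Tendsto (fun n : ℕ => (n : ℝ) * recip (s n)) atTop (𝓝 0))
    (hs : ∀ n : ℕ, (n : ℝ≥0∞) < s n) (h0 : max (u₀ * ξ).re (v₀ * ξ).re ≠ 0) :
    Tendsto (fun i => weight (s (N i)) (ξ + u i / N i) * weight (s (N i)) (ξ + v i / N i)) L
      (𝓝 (omega 0 (u₀ * ξ) * omega 0 (v₀ * ξ))) := by
  rcases lt_or_gt_of_ne h0 with h | h
  · obtain ⟨h1, h2⟩ := max_lt_iff.1 h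
    have := (tendsto_weight_of_re_neg (s := s) hξ hN hu h1).mul
      (tendsto_weight_of_re_neg (s := s) hξ hN hv h2)
    simpa only [omega, if_true, h1.le, h2.le] using this
  · rcases lt_max_iff.1 h with h1 | h1
    · have := tendsto_weight_mul_weight_of_re_pos hξ hN hu hlam hs h1 fun i => ξ + v i / N i
      simpa only [omega, if_true, h1.not_ge, if_false, zero_mul] using this
    · have := tendsto_weight_mul_weight_of_re_pos hξ hN hv hlam hs h1 fun i => ξ + u i / N i
      simp only [omega, if_true, h1.not_ge, if_false, mul_zero]
      exact this.congr fun i => mul_comm _ _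

end Weights

lemma continuousAt_omega_mul_omega_zero {ξ : ℂ} {q : ℂ × ℂ}
    (hq : max (q.1 * ξ).re (q.2 * ξ).re ≠ 0) :
    ContinuousAt (fun q : ℂ × ℂ => omega 0 (q.1 * ξ) * omega 0 (q.2 * ξ)) q := by
  have c1 : Continuous fun q : ℂ × ℂ => (q.1 * ξ).re :=
    Complex.continuous_re.comp (continuous_fst.mul_const ξ)
  have c2 : Continuous fun q : ℂ × ℂ => (q.2 * ξ).re :=
    Complex.continuous_re.comp (continuous_snd.mul_const ξ)
  rcases lt_or_gt_of_ne hq with h | h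
  · have hev := (c1.max c2).continuousAt.eventually_lt_const h
    refine (continuousAt_const (y := (1 : ℝ))).congr ?_
    filter_upwards [hev] with x hx
    obtain ⟨h1, h2⟩ := max_lt_iff.1 hx
    simp only [omega, if_true, h1.le, h2.le, mul_one]
  · have hev := (c1.max c2).continuousAt.eventually_const_lt h
    refine (continuousAt_const (y := (0 : ℝ))).congr ?_
    filter_upwards [hev] with x hx
    rcases lt_max_iff.1 hx with h1 | h1 <;>
      simp only [omega, if_true, h1.not_ge, if_false, zero_mul, mul_zero]

/-- Convergence of the weights upgrades convergence of the polynomial kernel to convergence of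
the weighted kernel. -/
lemma tendstoUniformlyOn_scaled_varkappa {s : ℕ → ℝ≥0∞} {p : ℕ → Polynomial ℝ} {lam : ℝ} {ξ : ℂ}
    {K : Set (ℂ × ℂ)} (hK : IsCompact K)
    (hpoly : ∀ q ∈ K, Tendsto (fun i : ℕ × ℂ × ℂ => 1 / (i.1 : ℂ) ^ 2 *
      polyKernel (s i.1) p i.1 (ξ + i.2.1 / i.1) (ξ + i.2.2 / i.1)) (atTop ×ˢ 𝓝 q)
      (𝓝 (polyLimit lam ξ q.1 q.2)))
    (hw : ∀ q ∈ K, Tendsto (fun i : ℕ × ℂ × ℂ => weight (s i.1) (ξ + i.2.1 / i.1) *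
      weight (s i.1) (ξ + i.2.2 / i.1)) (atTop ×ˢ 𝓝 q)
      (𝓝 (omega lam (q.1 * ξ) * omega lam (q.2 * ξ))))
    (hc : ∀ q ∈ K, ContinuousAt (fun q : ℂ × ℂ => omega lam (q.1 * ξ) * omega lam (q.2 * ξ)) q) :
    TendstoUniformlyOn (fun (N : ℕ) (q : ℂ × ℂ) =>
        1 / (N : ℂ) ^ 2 * varkappa (s N) p N (ξ + q.1 / N) (ξ + q.2 / N))
      (fun q => varkappaLimit lam ξ q.1 q.2) atTop K := by
  refine tendstoUniformlyOn_of_tendsto_prod hK (fun q hq => ?_) fun q hq => ?_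
  · have h := ((Complex.continuous_ofReal.tendsto _).comp (hw q hq)).mul (hpoly q hq)
    rw [Complex.ofReal_mul] at h
    refine h.congr fun i => ?_
    simp only [Function.comp_apply, varkappa]
    push_cast
    ring
  · have h := (Complex.continuous_ofReal.continuousAt.comp (hc q hq)).mul
      (continuous_polyLimit lam ξ).continuousAt
    refine h.congr (Eventually.of_forall fun x => ?_)
    simp only [Pi.mul_apply, Function.comp_apply, varkappaLimit]
    push_cast
    ring

end

end RealMahler

end

theorem theorem2p3
    (s : ℕ → ℝ≥0∞) (hs : ∀ N : ℕ, (N : ℝ≥0∞) < s N)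
    (lam : ℝ)
    (hlam : Filter.Tendsto (fun N : ℕ => ((N : ℝ≥0∞) / s N).toReal) Filter.atTop (𝓝 lam))
    (p : ℕ → Polynomial ℝ) (hp : ∀ n : ℕ, (p n).Monic ∧ (p n).natDegree = n)
    (ξ : ℂ) (hξ : ξ = 1 ∨ ξ = -1) :
    (0 < lam → ∀ K : Set (ℂ × ℂ), IsCompact K →
      TendstoUniformlyOn
        (fun (N : ℕ) (q : ℂ × ℂ) =>
          1 / (N : ℂ) ^ 2 * RealMahler.varkappa (s N) p N (ξ + q.1 / N) (ξ + q.2 / N))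
        (fun q : ℂ × ℂ => RealMahler.varkappaLimit lam ξ q.1 q.2) Filter.atTop K) ∧
    (lam = 0 → ∀ K : Set (ℂ × ℂ), IsCompact K →
      (∀ q ∈ K, max (q.1 * ξ).re (q.2 * ξ).re ≠ 0) →
      TendstoUniformlyOn
        (fun (N : ℕ) (q : ℂ × ℂ) =>
          1 / (N : ℂ) ^ 2 * RealMahler.varkappa (s N) p N (ξ + q.1 / N) (ξ + q.2 / N))
        (fun q : ℂ × ℂ => RealMahler.varkappaLimit lam ξ q.1 q.2) Filter.atTop K) ∧
    (∀ K : Set (ℂ × ℂ), IsCompact K →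
      TendstoUniformlyOn
        (fun (N : ℕ) (q : ℂ × ℂ) =>
          1 / (N : ℂ) ^ 2 * RealMahler.polyKernel (s N) p N (ξ + q.1 / N) (ξ + q.2 / N))
        (fun q : ℂ × ℂ => RealMahler.polyLimit lam ξ q.1 q.2) Filter.atTop K) := by
  have hpoly := RealMahler.tendsto_scaled_polyKernel hs hlam hp hξ
  have hr := RealMahler.tendsto_mul_recip hlam
  have hu : ∀ q : ℂ × ℂ, Filter.Tendsto (fun i : ℕ × ℂ × ℂ => i.2.1) (Filter.atTop ×ˢ 𝓝 q)
      (𝓝 q.1) := fun q => (continuous_fst.tendsto q).comp Filter.tendsto_snd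
  have hv : ∀ q : ℂ × ℂ, Filter.Tendsto (fun i : ℕ × ℂ × ℂ => i.2.2) (Filter.atTop ×ˢ 𝓝 q)
      (𝓝 q.2) := fun q => (continuous_snd.tendsto q).comp Filter.tendsto_snd
  refine ⟨fun h0 K hK => ?_, fun h0 K hK hne => ?_, fun K hK => ?_⟩
  · refine RealMahler.tendstoUniformlyOn_scaled_varkappa hK (fun q _ => hpoly q) (fun q _ => ?_)
      fun q _ => ?_
    · exact (RealMahler.tendsto_weight_of_pos hξ Filter.tendsto_fst (hu q) hr h0).mul
        (RealMahler.tendsto_weight_of_pos hξ Filter.tendsto_fst (hv q) hr h0)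
    · have := RealMahler.continuous_omega h0
      exact Continuous.continuousAt (by fun_prop)
  · subst h0
    exact RealMahler.tendstoUniformlyOn_scaled_varkappa hK (fun q _ => hpoly q)
      (fun q hq => RealMahler.tendsto_weight_mul_weight_of_zero hξ Filter.tendsto_fst (hu q) (hv q)
        hr hs (hne q hq))
      fun q hq => RealMahler.continuousAt_omega_mul_omega_zero (hne q hq)
  · exact RealMahler.tendstoUniformlyOn_of_tendsto_prod hK (fun q _ => hpoly q) fun q _ =>
      (RealMahler.continuous_polyLimit lam ξ).continuousAt
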